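/- **Conventions.** Let $\mathbb K=\mathbb R$ or $\mathbb C$; a clctvs is a complete Hausdorff locally convex $\mathbb K$-vector space and $\hat\otimes$ is the completed projective tensor product, extended to graded spaces by $(M\hat\otimes N)^n=\prod_{a+b=n}M^a\hat\otimes N^b$. A clct dg-algebra is a $\mathbb Z$-graded cochain complex $A$ of clctvs with a continuous, associative, unital multiplication $A\hat\otimes A\to A$ compatible with the differential; clct dg-modules and dg-bimodules have continuous actions in the same sense, and modules are right modules unless said otherwise. A sequence of dg-(bi)modules is called exact if, in each degree, it is split exact by continuous $\mathbb K$-linear maps. A dg-(bi)module is *contraacyclic* if it lies in the minimal thick triangulated subcategory of the homotopy category of dg-(bi)modules that contains the totalizations of all short exact sequences and is closed under arbitrary products; the contraderived category is the Verdier quotient by this subcategory. A dg-module is graded-projective if its underlying graded module is projective with respect to this exact structure. For a map $A\to B$ of clct dg-algebras and a dg-module $M$ over $A$, one sets $M\hat\otimes^L_A B:=P\hat\otimes_A B$, where $P\to M$ is a closed morphism of degree $0$ with contraacyclic cone and $P$ is graded-projective. A family of open sets has dimension $\le n$ if any $n+2$ of its members (with distinct indices) have empty intersection, and a space has finite covering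 dimension if, for some $n$, every open cover has an open refinement of dimension $\le n$. A sheaf $\mathcal A$ of clct dg-algebras on a topological space $X$ satisfies *strong descent* if for every open $V\subseteq X$ and every open cover $(U_i)_{i\in I}$ of $V$ of finite dimension, the natural map $\mathcal A(V)\to\check C^*((U_i)_{i\in I},\mathcal A)$ to the total complex of ordered Čech cochains is an isomorphism in the contraderived category of dg-bimodules over $\mathcal A(V)$. **Theorem.** Let $X$ be a topological space, $\mathcal A$ a sheaf of clct dg-algebras on $X$ satisfying strong descent, and $M$ a clct dg-module over $\mathcal A(X)$. For every open $U\subseteq X$ the derived tensor product $\mathcal M(U):=M\hat\otimes^L_{\mathcal A(X)}\mathcal A(U)$ exists, and for any choice of these modules: 1. $M$ is contraacyclic if and only if there is a cover $(U_i)_{i\in I}$ of $X$ of finite dimension such that each $\mathcal M(U_i)$ is contraacyclic as an $\mathcal A(U_i)$-module. 2. For every open $U\subseteq X$, the module $\mathcal M(U)$ is contraacyclic as an $\mathcal A(U)$-module if and only if it is contraacyclic as an $\mathcal A(X)$-module. 3. If $X$ has finite covering dimension, then $M$ is contraacyclic if and only if every $x\in X$ has an open neighbourhood $U$ such that $\mathcal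 M(U)$ is contraacyclic. -/

import Mathlib

universe w v v₂ u

namespace ClctDG

/-- A graded complete locally convex (Hausdorff) space over `ℝ` or `ℂ`, given by its total space
`∏ₙ Vⁿ` with the projections onto the factors: the last two fields say that `V` is, as a
topological vector space, the product of the images `Vⁿ` of the projections. An element `x` is
homogeneous of degree `n` when `proj n x = x`. -/
structure GrSpace (𝕜 : Type w) [RCLike 𝕜] where
  carrier : Type u
  [addCommGroup : AddCommGroup carrier]
  [module : Module 𝕜 carrier]
  [uniformSpace : UniformSpace carrier]
  [isUniformAddGroup : IsUniformAddGroup carrier]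
  [continuousSMul : ContinuousSMul 𝕜 carrier]
  [polynormable : PolynormableSpace 𝕜 carrier]
  [t2 : T2Space carrier]
  [complete : CompleteSpace carrier]
  proj : ℤ → carrier →L[𝕜] carrier
  proj_self : ∀ n x, proj n (proj n x) = proj n x
  proj_of_ne : ∀ m n x, m ≠ n → proj m (proj n x) = 0
  isInducing_proj : Topology.IsInducing fun (x : carrier) (n : ℤ) => proj n x
  exists_of_proj : ∀ f : ℤ → carrier, (∀ n, proj n (f n) = f n) → ∃ x, ∀ n, proj n x = f n

attribute [instance] GrSpace.addCommGroup GrSpace.module GrSpace.uniformSpace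
  GrSpace.isUniformAddGroup GrSpace.continuousSMul GrSpace.polynormable GrSpace.t2
  GrSpace.complete

namespace GrSpace
variable {𝕜 : Type w} [RCLike 𝕜]

theorem proj_ext (V : GrSpace.{w, u} 𝕜) {x y : V.carrier} (h : ∀ n, V.proj n x = V.proj n y) :
    x = y :=
  V.isInducing_proj.injective (funext h)

theorem hasSum_proj (V : GrSpace.{w, u} 𝕜) (x : V.carrier) : HasSum (fun n => V.proj n x) x := by
  unfold HasSum
  rw [V.isInducing_proj.tendsto_nhds_iff, tendsto_pi_nhds]
  intro m
  refine tendsto_const_nhds.congr' ?_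
  filter_upwards [Filter.eventually_ge_atTop ({m} : Finset ℤ)] with s hs
  simp only [Function.comp, map_sum]
  rw [Finset.sum_eq_single m]
  · rw [V.proj_self]
  · intro b _ hb
    exact V.proj_of_ne _ _ _ hb.symm
  · intro h
    exact absurd (hs (Finset.mem_singleton_self m)) h

/-- Continuous additive maps agreeing on homogeneous elements agree. -/
theorem hom_ext (V : GrSpace.{w, u} 𝕜) {E : Type v} [AddCommMonoid E] [TopologicalSpace E]
    [T2Space E] (f g : V.carrier →+ E) (hf : Continuous f) (hg : Continuous g)
    (h : ∀ n x, V.proj n x = x → f x = g x) (x : V.carrier) : f x = g x := by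
  have h1 := (V.hasSum_proj x).map f hf
  have h2 := (V.hasSum_proj x).map g hg
  have h3 : (f ∘ fun n => V.proj n x) = g ∘ fun n => V.proj n x :=
    funext fun n => h n _ (V.proj_self n x)
  rw [h3] at h1
  exact h1.unique h2

theorem exists_koszul (V : GrSpace.{w, u} 𝕜) (k : ℤ) (x : V.carrier) :
    ∃ y, ∀ n, V.proj n y = ((k * n).negOnePow : ℤ) • V.proj n x :=
  V.exists_of_proj _ fun n => by rw [map_zsmul, V.proj_self]

/-- The operator acting as `(-1)^(k n)` in degree `n`. -/
noncomputable def koszul (V : GrSpace.{w, u} 𝕜) (k : ℤ) : V.carrier →L[𝕜] V.carrier where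
  toFun x := (V.exists_koszul k x).choose
  map_add' x y := V.proj_ext fun n => by
    rw [map_add, (V.exists_koszul k _).choose_spec, (V.exists_koszul k _).choose_spec,
      (V.exists_koszul k _).choose_spec, map_add, smul_add]
  map_smul' c x := V.proj_ext fun n => by
    rw [RingHom.id_apply, map_smul, (V.exists_koszul k _).choose_spec,
      (V.exists_koszul k _).choose_spec, map_smul, smul_comm]
  cont := by
    rw [V.isInducing_proj.continuous_iff]
    refine continuous_pi fun n => ?_
    have : (fun x => V.proj n (V.exists_koszul k x).choose) =
        fun x => ((k * n).negOnePow : ℤ) • V.proj n x :=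
      funext fun x => (V.exists_koszul k x).choose_spec n
    exact this ▸ ((V.proj n).continuous.const_smul ((k * n).negOnePow : ℤ))

theorem proj_koszul (V : GrSpace.{w, u} 𝕜) (k n : ℤ) (x : V.carrier) :
    V.proj n (V.koszul k x) = ((k * n).negOnePow : ℤ) • V.proj n x :=
  (V.exists_koszul k x).choose_spec n

theorem koszul_of_homog (V : GrSpace.{w, u} 𝕜) (k n : ℤ) (x : V.carrier) (hx : V.proj n x = x) :
    V.koszul k x = ((k * n).negOnePow : ℤ) • x := by
  refine V.proj_ext fun m => ?_
  rw [proj_koszul, map_zsmul]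
  by_cases h : m = n
  · rw [h]
  · rw [← hx, V.proj_of_ne _ _ _ h, smul_zero, smul_zero]

/-- Shift: degree `n` of `V[k]` is degree `n + k` of `V`. -/
abbrev shift (V : GrSpace.{w, u} 𝕜) (k : ℤ) : GrSpace.{w, u} 𝕜 where
  carrier := V.carrier
  proj n := V.proj (n + k)
  proj_self n := V.proj_self (n + k)
  proj_of_ne m n x h := V.proj_of_ne _ _ x (by omega)
  isInducing_proj := by
    have h := ((Homeomorph.piCongrLeft (Y := fun _ : ℤ => V.carrier)
      (Equiv.addRight k)).symm.isInducing).comp V.isInducing_proj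
    exact h
  exists_of_proj f hf := by
    obtain ⟨x, hx⟩ := V.exists_of_proj (fun n => f (n - k)) fun n => by
      have := hf (n - k)
      rwa [sub_add_cancel] at this
    exact ⟨x, fun n => by rw [hx, add_sub_cancel_right]⟩

/-- The product of a family of graded spaces. -/
abbrev pi {ι : Type v} (V : ι → GrSpace.{w, u} 𝕜) : GrSpace.{w, max v u} 𝕜 where
  carrier := ∀ i, (V i).carrier
  proj n := ContinuousLinearMap.pi fun i => (V i).proj n ∘L ContinuousLinearMap.proj i
  proj_self n x := funext fun i => (V i).proj_self n (x i)
  proj_of_ne m n x h := funext fun i => (V i).proj_of_ne m n (x i) h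
  isInducing_proj := by
    have h1 : Topology.IsInducing fun (x : ∀ i, (V i).carrier) (i : ι) (n : ℤ) =>
      (V i).proj n (x i) := Topology.IsInducing.piMap fun i => (V i).isInducing_proj
    have h2 : Topology.IsInducing fun (p : ∀ i, ℤ → (V i).carrier) (n : ℤ) (i : ι) => p i n := by
      refine Topology.IsInducing.of_comp (g := fun (q : ℤ → ∀ i, (V i).carrier) (i : ι) (n : ℤ) =>
        q n i) (by fun_prop) (by fun_prop) ?_
      exact Topology.IsInducing.id
    exact h2.comp h1
  exists_of_proj f hf := by
    choose x hx using fun i => (V i).exists_of_proj (fun n => f n i) fun n => congrFun (hf n) i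
    exact ⟨x, fun n => funext fun i => hx i n⟩

/-- The direct sum of two graded spaces. -/
abbrev prod (V W : GrSpace.{w, u} 𝕜) : GrSpace.{w, u} 𝕜 where
  carrier := V.carrier × W.carrier
  proj n := (V.proj n).prodMap (W.proj n)
  proj_self n x := Prod.ext (V.proj_self n x.1) (W.proj_self n x.2)
  proj_of_ne m n x h := Prod.ext (V.proj_of_ne m n x.1 h) (W.proj_of_ne m n x.2 h)
  isInducing_proj := by
    have h1 := V.isInducing_proj.prodMap W.isInducing_proj
    have h2 : Topology.IsInducing fun (p : (ℤ → V.carrier) × (ℤ → W.carrier)) (n : ℤ) =>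
        (p.1 n, p.2 n) := by
      refine Topology.IsInducing.of_comp (g := fun q : ℤ → V.carrier × W.carrier =>
        ((fun n => (q n).1), fun n => (q n).2)) (by fun_prop) (by fun_prop) ?_
      exact Topology.IsInducing.id
    exact h2.comp h1
  exists_of_proj f hf := by
    obtain ⟨x, hx⟩ := V.exists_of_proj (fun n => (f n).1) fun n => congrArg Prod.fst (hf n)
    obtain ⟨y, hy⟩ := W.exists_of_proj (fun n => (f n).2) fun n => congrArg Prod.snd (hf n)
    exact ⟨(x, y), fun n => Prod.ext (hx n) (hy n)⟩

end GrSpace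

section

variable {𝕜 : Type w} [RCLike 𝕜]

/-- A unital associative graded algebra. A continuous linear map out of a completed projective
tensor product is the same as a jointly continuous bilinear map, so the multiplication
`A ⊗ A → A` is given in this form (likewise for the actions on modules). -/
structure GrAlg (𝕜 : Type w) [RCLike 𝕜] extends GrSpace.{w, u} 𝕜 where
  mul : carrier →ₗ[𝕜] carrier →ₗ[𝕜] carrier
  one : carrier
  continuous_mul : Continuous fun p : carrier × carrier => mul p.1 p.2
  mul_assoc : ∀ a b c, mul (mul a b) c = mul a (mul b c)
  one_mul : ∀ a, mul one a = a
  mul_one : ∀ a, mul a one = a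
  proj_one : proj 0 one = one
  proj_mul : ∀ m n a b, proj m a = a → proj n b = b → proj (m + n) (mul a b) = mul a b

/-- A dg-algebra; equivalently, a cochain complex of complete locally convex spaces with a
compatible multiplication. -/
structure DGAlg (𝕜 : Type w) [RCLike 𝕜] extends GrAlg.{w, u} 𝕜 where
  d : carrier →L[𝕜] carrier
  proj_d : ∀ n a, proj n a = a → proj (n + 1) (d a) = d a
  d_d : ∀ a, d (d a) = 0
  d_mul : ∀ n a b, proj n a = a → d (mul a b) = mul (d a) b + (n.negOnePow : ℤ) • mul a (d b)

theorem GrAlg.koszul_mul (A : GrAlg.{w, u} 𝕜) (k : ℤ) (a b : A.carrier) :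
    A.koszul k (A.mul a b) = A.mul (A.koszul k a) (A.koszul k b) := by
  have cl : ∀ b, Continuous fun a => A.mul a b := fun b =>
    A.continuous_mul.comp (continuous_id.prodMk continuous_const)
  have cr : ∀ a, Continuous fun b => A.mul a b := fun a =>
    A.continuous_mul.comp (continuous_const.prodMk continuous_id)
  refine A.hom_ext
    (((A.koszul k).toLinearMap ∘ₗ A.mul.flip b).toAddMonoidHom)
    (((A.mul.flip (A.koszul k b)) ∘ₗ (A.koszul k).toLinearMap).toAddMonoidHom)
    ((A.koszul k).continuous.comp (cl b)) ((cl _).comp (A.koszul k).continuous) ?_ a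
  intro m a ha
  refine A.hom_ext
    (((A.koszul k).toLinearMap ∘ₗ A.mul a).toAddMonoidHom)
    (((A.mul (A.koszul k a)) ∘ₗ (A.koszul k).toLinearMap).toAddMonoidHom)
    ((A.koszul k).continuous.comp (cr a)) ((cr _).comp (A.koszul k).continuous) ?_ b
  intro n b hb
  change A.koszul k (A.mul a b) = A.mul (A.koszul k a) (A.koszul k b)
  rw [A.koszul_of_homog k m a ha, A.koszul_of_homog k n b hb,
    A.koszul_of_homog k (m + n) _ (A.proj_mul m n a b ha hb), map_zsmul, map_zsmul,
    LinearMap.smul_apply, smul_smul, mul_add, Int.negOnePow_add, Units.val_mul, mul_comm]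

theorem GrAlg.koszul_one (A : GrAlg.{w, u} 𝕜) (k : ℤ) : A.koszul k A.one = A.one := by
  rw [A.koszul_of_homog k 0 _ A.proj_one]; simp

theorem GrSpace.proj_koszul_homog (V : GrSpace.{w, u} 𝕜) (k n : ℤ) (x : V.carrier)
    (hx : V.proj n x = x) : V.proj n (V.koszul k x) = V.koszul k x := by
  rw [V.proj_koszul, hx, V.koszul_of_homog k n x hx]

/-- The ground field, as a dg-algebra concentrated in degree `0`. -/
noncomputable def DGAlg.ground (𝕜 : Type w) [RCLike 𝕜] : DGAlg.{w, w} 𝕜 where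
  carrier := 𝕜
  proj n := if n = 0 then ContinuousLinearMap.id 𝕜 𝕜 else 0
  proj_self n x := by split_ifs <;> simp
  proj_of_ne m n x h := by
    split_ifs with h1 h2 <;> simp
    exact absurd (h1.trans h2.symm) h
  isInducing_proj := by
    refine Topology.IsInducing.of_comp (g := fun f : ℤ → 𝕜 => f 0) ?_ (by fun_prop) ?_
    · exact continuous_pi fun n => ContinuousLinearMap.continuous _
    · have : ((fun f : ℤ → 𝕜 => f 0) ∘ fun (x : 𝕜) (n : ℤ) =>
        (if n = 0 then ContinuousLinearMap.id 𝕜 𝕜 else 0) x) = id := by ext; simp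
      rw [this]; exact Topology.IsInducing.id
  exists_of_proj f hf := by
    refine ⟨f 0, fun n => ?_⟩
    by_cases h : n = 0
    · simp [h]
    · have := hf n
      simp only [h, if_false, zero_apply] at this ⊢
      exact this
  mul := LinearMap.mul 𝕜 𝕜
  one := 1
  continuous_mul := by simpa using continuous_mul
  mul_assoc a b c := by simp [_root_.mul_assoc]
  one_mul := by simp
  mul_one := by simp
  proj_one := by simp
  proj_mul m n a b ha hb := by
    by_cases h : m = 0
    · by_cases h' : n = 0
      · simp [h, h']
      · have : b = 0 := by rw [← hb]; simp [h']
        simp [this]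
    · have : a = 0 := by rw [← ha]; simp [h]
      simp [this]
  d := 0
  proj_d := by simp
  d_d := by simp
  d_mul := by simp

/-- A morphism of dg-algebras: continuous, unital, of degree `0`, commuting with `d`. -/
@[ext]
structure DGAlg.Hom (A : DGAlg.{w, v} 𝕜) (B : DGAlg.{w, v₂} 𝕜) where
  toCLM : A.carrier →L[𝕜] B.carrier
  map_proj : ∀ n a, toCLM (A.proj n a) = B.proj n (toCLM a)
  map_one : toCLM A.one = B.one
  map_mul : ∀ a b, toCLM (A.mul a b) = B.mul (toCLM a) (toCLM b)
  map_d : ∀ a, toCLM (A.d a) = B.d (toCLM a)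

def DGAlg.Hom.id (A : DGAlg.{w, v} 𝕜) : A.Hom A where
  toCLM := ContinuousLinearMap.id 𝕜 A.carrier
  map_proj _ _ := rfl
  map_one := rfl
  map_mul _ _ := rfl
  map_d _ := rfl

def DGAlg.Hom.comp {A B C : DGAlg.{w, v} 𝕜} (g : B.Hom C) (f : A.Hom B) : A.Hom C where
  toCLM := g.toCLM ∘L f.toCLM
  map_proj n a := by simp [f.map_proj, g.map_proj]
  map_one := by simp [f.map_one, g.map_one]
  map_mul a b := by simp [f.map_mul, g.map_mul]
  map_d a := by simp [f.map_d, g.map_d]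

instance : CategoryTheory.Category (DGAlg.{w, u} 𝕜) where
  Hom A B := A.Hom B
  id A := DGAlg.Hom.id A
  comp f g := DGAlg.Hom.comp g f

theorem DGAlg.Hom.map_koszul {A : DGAlg.{w, v} 𝕜} {B : DGAlg.{w, v₂} 𝕜} (f : A.Hom B) (k : ℤ)
    (a : A.carrier) : f.toCLM (A.koszul k a) = B.koszul k (f.toCLM a) := by
  refine B.proj_ext fun n => ?_
  rw [B.proj_koszul, ← f.map_proj, A.proj_koszul, map_zsmul, f.map_proj]

/-- Graded `A`-`B`-bimodules. -/
structure GrBimod (A : GrAlg.{w, v} 𝕜) (B : GrAlg.{w, v₂} 𝕜) extends GrSpace.{w, u} 𝕜 where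
  lact : A.carrier →ₗ[𝕜] carrier →ₗ[𝕜] carrier
  ract : carrier →ₗ[𝕜] B.carrier →ₗ[𝕜] carrier
  continuous_lact : Continuous fun p : A.carrier × carrier => lact p.1 p.2
  continuous_ract : Continuous fun p : carrier × B.carrier => ract p.1 p.2
  one_lact : ∀ x, lact A.one x = x
  ract_one : ∀ x, ract x B.one = x
  mul_lact : ∀ a b x, lact (A.mul a b) x = lact a (lact b x)
  ract_mul : ∀ x a b, ract x (B.mul a b) = ract (ract x a) b
  lact_ract : ∀ a x b, ract (lact a x) b = lact a (ract x b)
  proj_lact : ∀ m n a x, A.proj m a = a → proj n x = x → proj (m + n) (lact a x) = lact a x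
  proj_ract : ∀ m n x b, proj m x = x → B.proj n b = b → proj (m + n) (ract x b) = ract x b

/-- Continuous morphisms of degree `0` of graded bimodules. -/
structure GrBimod.Hom {A : GrAlg.{w, v} 𝕜} {B : GrAlg.{w, v₂} 𝕜} (M N : GrBimod.{w, v, v₂, u} A B)
    where
  toCLM : M.carrier →L[𝕜] N.carrier
  map_proj : ∀ n x, toCLM (M.proj n x) = N.proj n (toCLM x)
  map_lact : ∀ a x, toCLM (M.lact a x) = N.lact a (toCLM x)
  map_ract : ∀ x b, toCLM (M.ract x b) = N.ract (toCLM x) b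

namespace GrBimod
variable {A : GrAlg.{w, v} 𝕜} {B : GrAlg.{w, v₂} 𝕜}

/-- Shift: the right action is unchanged, the left action acquires the Koszul sign. -/
noncomputable abbrev shift (M : GrBimod.{w, v, v₂, u} A B) (k : ℤ) : GrBimod.{w, v, v₂, u} A B where
  toGrSpace := M.toGrSpace.shift k
  lact := M.lact ∘ₗ (A.koszul k).toLinearMap
  ract := M.ract
  continuous_lact := M.continuous_lact.comp ((A.koszul k).continuous.prodMap continuous_id)
  continuous_ract := M.continuous_ract
  one_lact x := by
    change M.lact (A.koszul k A.one) x = x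
    rw [A.koszul_one, M.one_lact]
  ract_one := M.ract_one
  mul_lact a b x := by
    change M.lact (A.koszul k (A.mul a b)) x = M.lact (A.koszul k a) (M.lact (A.koszul k b) x)
    rw [A.koszul_mul, M.mul_lact]
  ract_mul := M.ract_mul
  lact_ract a x b := M.lact_ract _ x b
  proj_lact m n a x ha hx := by
    have := M.proj_lact m (n + k) _ x (A.proj_koszul_homog k m a ha) hx
    rwa [← add_assoc] at this
  proj_ract m n x b hx hb := by
    have := M.proj_ract (m + k) n x b hx hb
    rwa [add_right_comm] at this

noncomputable abbrev pi {ι : Type u} (M : ι → GrBimod.{w, v, v₂, u} A B) : GrBimod.{w, v, v₂, u} A B where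
  toGrSpace := GrSpace.pi.{w, u, u} fun i => (M i).toGrSpace
  lact := LinearMap.mk₂ 𝕜 (fun a (x : ∀ i, (M i).carrier) i => (M i).lact a (x i))
    (fun _ _ _ => funext fun i => by simp) (fun _ _ _ => funext fun i => by simp)
    (fun _ _ _ => funext fun i => by simp) (fun _ _ _ => funext fun i => by simp)
  ract := LinearMap.mk₂ 𝕜 (fun (x : ∀ i, (M i).carrier) b i => (M i).ract (x i) b)
    (fun _ _ _ => funext fun i => by simp) (fun _ _ _ => funext fun i => by simp)
    (fun _ _ _ => funext fun i => by simp) (fun _ _ _ => funext fun i => by simp)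
  continuous_lact := continuous_pi fun i => (M i).continuous_lact.comp
    (continuous_fst.prodMk ((continuous_apply i).comp continuous_snd))
  continuous_ract := continuous_pi fun i => (M i).continuous_ract.comp
    (f := fun p : (∀ i, (M i).carrier) × B.carrier => (p.1 i, p.2))
    (((continuous_apply i).comp continuous_fst).prodMk continuous_snd)
  one_lact x := funext fun i => (M i).one_lact (x i)
  ract_one x := funext fun i => (M i).ract_one (x i)
  mul_lact a b x := funext fun i => (M i).mul_lact a b (x i)
  ract_mul x a b := funext fun i => (M i).ract_mul (x i) a b
  lact_ract a x b := funext fun i => (M i).lact_ract a (x i) b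
  proj_lact m n a x ha hx := funext fun i => (M i).proj_lact m n a (x i) ha (congrFun hx i)
  proj_ract m n x b hx hb := funext fun i => (M i).proj_ract m n (x i) b (congrFun hx i) hb

noncomputable abbrev prod (M N : GrBimod.{w, v, v₂, u} A B) : GrBimod.{w, v, v₂, u} A B where
  toGrSpace := M.toGrSpace.prod N.toGrSpace
  lact := LinearMap.mk₂ 𝕜 (fun a (x : M.carrier × N.carrier) => (M.lact a x.1, N.lact a x.2))
    (fun _ _ _ => by simp) (fun _ _ _ => by simp) (fun _ _ _ => by simp) (fun _ _ _ => by simp)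
  ract := LinearMap.mk₂ 𝕜 (fun (x : M.carrier × N.carrier) b => (M.ract x.1 b, N.ract x.2 b))
    (fun _ _ _ => by simp) (fun _ _ _ => by simp) (fun _ _ _ => by simp) (fun _ _ _ => by simp)
  continuous_lact := (M.continuous_lact.comp
    (continuous_fst.prodMk (continuous_fst.comp continuous_snd))).prodMk (N.continuous_lact.comp
    (continuous_fst.prodMk (continuous_snd.comp continuous_snd)))
  continuous_ract := (M.continuous_ract.comp
    ((continuous_fst.comp continuous_fst).prodMk continuous_snd)).prodMk (N.continuous_ract.comp
    ((continuous_snd.comp continuous_fst).prodMk continuous_snd))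
  one_lact x := Prod.ext (M.one_lact x.1) (N.one_lact x.2)
  ract_one x := Prod.ext (M.ract_one x.1) (N.ract_one x.2)
  mul_lact a b x := Prod.ext (M.mul_lact a b x.1) (N.mul_lact a b x.2)
  ract_mul x a b := Prod.ext (M.ract_mul x.1 a b) (N.ract_mul x.2 a b)
  lact_ract a x b := Prod.ext (M.lact_ract a x.1 b) (N.lact_ract a x.2 b)
  proj_lact m n a x ha hx := Prod.ext (M.proj_lact m n a x.1 ha (congrArg Prod.fst hx))
    (N.proj_lact m n a x.2 ha (congrArg Prod.snd hx))
  proj_ract m n x b hx hb := Prod.ext (M.proj_ract m n x.1 b (congrArg Prod.fst hx) hb)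
    (N.proj_ract m n x.2 b (congrArg Prod.snd hx) hb)

/-- Projectivity with respect to the split-exact structure: morphisms out of `P` lift along every
morphism `p` of graded bimodules that has a continuous `𝕜`-linear section in each degree. -/
def IsProjective (P : GrBimod.{w, v, v₂, u} A B) : Prop :=
  ∀ (M N : GrBimod.{w, v, v₂, u} A B) (p : M.Hom N) (s : N.carrier →L[𝕜] M.carrier),
    (∀ n y, s (N.proj n y) = M.proj n (s y)) → (∀ y, p.toCLM (s y) = y) →
    ∀ f : P.Hom N, ∃ g : P.Hom M, ∀ x, p.toCLM (g.toCLM x) = f.toCLM x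

end GrBimod

/-- dg-bimodules, that is, right dg-modules over the completed tensor product of the opposite of
`A` with `B`. For `A` the ground field these are the right dg-modules over `B`. -/
structure DGBimod (A : DGAlg.{w, v} 𝕜) (B : DGAlg.{w, v₂} 𝕜) extends
    GrBimod.{w, v, v₂, u} A.toGrAlg B.toGrAlg where
  d : carrier →L[𝕜] carrier
  proj_d : ∀ n x, proj n x = x → proj (n + 1) (d x) = d x
  d_d : ∀ x, d (d x) = 0
  d_lact : ∀ n a x, A.proj n a = a →
    d (lact a x) = lact (A.d a) x + (n.negOnePow : ℤ) • lact a (d x)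
  d_ract : ∀ n x b, proj n x = x →
    d (ract x b) = ract (d x) b + (n.negOnePow : ℤ) • ract x (B.d b)

namespace DGBimod
variable {A : DGAlg.{w, v} 𝕜} {B : DGAlg.{w, v₂} 𝕜}

/-- Closed morphisms of degree `0`. -/
structure Hom (M N : DGBimod.{w, v, v₂, u} A B) extends
    GrBimod.Hom M.toGrBimod N.toGrBimod where
  map_d : ∀ x, toCLM (M.d x) = N.d (toCLM x)

noncomputable abbrev shift (M : DGBimod.{w, v, v₂, u} A B) (k : ℤ) : DGBimod.{w, v, v₂, u} A B where
  toGrBimod := M.toGrBimod.shift k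
  d := (k.negOnePow : ℤ) • M.d
  proj_d n x hx := by
    change M.proj (n + 1 + k) ((k.negOnePow : ℤ) • M.d x) = (k.negOnePow : ℤ) • M.d x
    rw [map_zsmul, add_right_comm, M.proj_d _ x hx]
  d_d x := by
    change (k.negOnePow : ℤ) • M.d ((k.negOnePow : ℤ) • M.d x) = 0
    rw [map_zsmul, M.d_d, smul_zero, smul_zero]
  d_lact n a x ha := by
    change (k.negOnePow : ℤ) • M.d (M.lact (A.koszul k a) x) = M.lact (A.koszul k (A.d a)) x +
      (n.negOnePow : ℤ) • M.lact (A.koszul k a) ((k.negOnePow : ℤ) • M.d x)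
    have e := Units.val_mul k.negOnePow (Int.negOnePow (k * n))
    rw [A.koszul_of_homog k n a ha, A.koszul_of_homog k (n + 1) _ (A.proj_d n a ha)]
    simp only [map_zsmul, LinearMap.smul_apply, M.d_lact n a x ha, smul_add, smul_smul]
    congr 2
    · rw [mul_add, mul_one, Int.negOnePow_add, Units.val_mul, mul_comm]
    · ring
  d_ract n x b hx := by
    change (k.negOnePow : ℤ) • M.d (M.ract x b) = M.ract ((k.negOnePow : ℤ) • M.d x) b +
      (n.negOnePow : ℤ) • M.ract x (B.d b)
    rw [M.d_ract _ x b hx, smul_add, map_zsmul, LinearMap.smul_apply, smul_smul,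
      Int.negOnePow_add, Units.val_mul, mul_left_comm, ← Units.val_mul k.negOnePow,
      Int.units_mul_self, Units.val_one, mul_one]

noncomputable abbrev pi {ι : Type u} (M : ι → DGBimod.{w, v, v₂, u} A B) : DGBimod.{w, v, v₂, u} A B where
  toGrBimod := GrBimod.pi fun i => (M i).toGrBimod
  d := ContinuousLinearMap.pi fun i => (M i).d ∘L ContinuousLinearMap.proj i
  proj_d n x hx := funext fun i => (M i).proj_d n (x i) (congrFun hx i)
  d_d x := funext fun i => (M i).d_d (x i)
  d_lact n a x ha := funext fun i => (M i).d_lact n a (x i) ha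
  d_ract n x b hx := funext fun i => (M i).d_ract n (x i) b (congrFun hx i)

/-- The mapping cone `N ⊕ M[1]`, with `d (y, x) = (d y + f x, -d x)`. -/
noncomputable abbrev cone {M N : DGBimod.{w, v, v₂, u} A B} (f : M.Hom N) :
    DGBimod.{w, v, v₂, u} A B where
  toGrBimod := N.toGrBimod.prod (M.shift 1).toGrBimod
  d := (N.d ∘L ContinuousLinearMap.fst 𝕜 N.carrier M.carrier +
    f.toCLM ∘L ContinuousLinearMap.snd 𝕜 N.carrier M.carrier).prod
    ((M.shift 1).d ∘L ContinuousLinearMap.snd 𝕜 N.carrier M.carrier)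
  proj_d n x hx := by
    have h1 : N.proj n x.1 = x.1 := congrArg Prod.fst hx
    have h2 : M.proj (n + 1) x.2 = x.2 := congrArg Prod.snd hx
    refine Prod.ext ?_ ((M.shift 1).proj_d n x.2 h2)
    change N.proj (n + 1) (N.d x.1 + f.toCLM x.2) = N.d x.1 + f.toCLM x.2
    rw [map_add, N.proj_d n _ h1, ← f.map_proj, h2]
  d_d x := by
    refine Prod.ext ?_ ((M.shift 1).d_d x.2)
    change N.d (N.d x.1 + f.toCLM x.2) + f.toCLM (((1 : ℤ).negOnePow : ℤ) • M.d x.2) = 0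
    rw [map_add, N.d_d, map_zsmul, f.map_d]
    simp
  d_lact n a x ha := by
    refine Prod.ext ?_ ((M.shift 1).d_lact n a x.2 ha)
    change N.d (N.lact a x.1) + f.toCLM (M.lact (A.koszul 1 a) x.2) =
      N.lact (A.d a) x.1 + (n.negOnePow : ℤ) • N.lact a (N.d x.1 + f.toCLM x.2)
    rw [f.map_lact, A.koszul_of_homog 1 n a ha, N.d_lact n a _ ha, one_mul, map_zsmul,
      LinearMap.smul_apply, map_add, smul_add, add_assoc]
  d_ract n x b hx := by
    have h1 : N.proj n x.1 = x.1 := congrArg Prod.fst hx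
    refine Prod.ext ?_ ((M.shift 1).d_ract n x.2 b (congrArg Prod.snd hx))
    change N.d (N.ract x.1 b) + f.toCLM (M.ract x.2 b) =
      N.ract (N.d x.1 + f.toCLM x.2) b + (n.negOnePow : ℤ) • N.ract x.1 (B.d b)
    rw [f.map_ract, N.d_ract n _ b h1, map_add, LinearMap.add_apply, add_right_comm]

/-- A short exact sequence `0 → M → N → L → 0` of closed morphisms of degree `0`, split by
continuous `𝕜`-linear maps of degree `0`. -/
structure ShortExact {M N L : DGBimod.{w, v, v₂, u} A B} (i : M.Hom N) (p : N.Hom L) where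
  r : N.carrier →L[𝕜] M.carrier
  s : L.carrier →L[𝕜] N.carrier
  r_proj : ∀ n y, r (N.proj n y) = M.proj n (r y)
  s_proj : ∀ n z, s (L.proj n z) = N.proj n (s z)
  p_i : ∀ x, p.toCLM (i.toCLM x) = 0
  r_i : ∀ x, r (i.toCLM x) = x
  p_s : ∀ z, p.toCLM (s z) = z
  i_r_add_s_p : ∀ y, i.toCLM (r y) + s (p.toCLM y) = y

/-- The morphism `cone i → L` induced by `p : N → L` when `p ∘ i = 0`. -/
noncomputable abbrev coneDesc {M N L : DGBimod.{w, v, v₂, u} A B} {i : M.Hom N} {p : N.Hom L}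
    (h : ShortExact i p) : (cone i).Hom L where
  toCLM := p.toCLM ∘L ContinuousLinearMap.fst 𝕜 N.carrier M.carrier
  map_proj n x := p.map_proj n x.1
  map_lact a x := p.map_lact a x.1
  map_ract x b := p.map_ract x.1 b
  map_d x := by
    change p.toCLM (N.d x.1 + i.toCLM x.2) = L.d (p.toCLM x.1)
    rw [map_add, h.p_i, add_zero, p.map_d]

/-- The totalization `L ⊕ N[1] ⊕ M[2]` of a short exact sequence. -/
noncomputable abbrev tot {M N L : DGBimod.{w, v, v₂, u} A B} {i : M.Hom N} {p : N.Hom L}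
    (h : ShortExact i p) : DGBimod.{w, v, v₂, u} A B := cone (coneDesc h)

/-- `f` and `g` are equal in `H⁰`: their difference is the boundary of an element of degree `-1`
of the morphism complex. -/
def Homotopic {M N : DGBimod.{w, v, v₂, u} A B} (f g : M.Hom N) : Prop :=
  ∃ h : M.carrier →L[𝕜] N.carrier,
    (∀ n x, M.proj n x = x → N.proj (n - 1) (h x) = h x) ∧
    (∀ n a x, A.proj n a = a → h (M.lact a x) = (n.negOnePow : ℤ) • N.lact a (h x)) ∧
    (∀ x b, h (M.ract x b) = N.ract (h x) b) ∧
    ∀ x, f.toCLM x - g.toCLM x = N.d (h x) + h (M.d x)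

noncomputable abbrev Hom.id (M : DGBimod.{w, v, v₂, u} A B) : M.Hom M where
  toCLM := ContinuousLinearMap.id 𝕜 M.carrier
  map_proj _ _ := rfl
  map_lact _ _ := rfl
  map_ract _ _ := rfl
  map_d _ := rfl

noncomputable abbrev Hom.comp {M N L : DGBimod.{w, v, v₂, u} A B} (g : N.Hom L) (f : M.Hom N) : M.Hom L where
  toCLM := g.toCLM ∘L f.toCLM
  map_proj n x := by simp [f.map_proj, g.map_proj]
  map_lact a x := by simp [f.map_lact, g.map_lact]
  map_ract x b := by simp [f.map_ract, g.map_ract]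
  map_d x := by simp [f.map_d, g.map_d]

/-- The contraacyclic bimodules (the objects that vanish in the contraderived category), that is,
the minimal thick triangulated subcategory of the homotopy category that contains the totalizations
of short exact sequences and is closed under products: the smallest class containing the totalizations of short exact
sequences that is closed under shifts, cones and arbitrary products, and under retracts in the
homotopy category (hence under isomorphisms there). -/
inductive IsContraacyclic : DGBimod.{w, v, v₂, u} A B → Prop
  | tot {M N L : DGBimod.{w, v, v₂, u} A B} {i : M.Hom N} {p : N.Hom L} (h : ShortExact i p) :
      IsContraacyclic (tot h)
  | shift {M : DGBimod.{w, v, v₂, u} A B} (k : ℤ) : IsContraacyclic M → IsContraacyclic (M.shift k)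
  | cone {M N : DGBimod.{w, v, v₂, u} A B} (f : M.Hom N) :
      IsContraacyclic M → IsContraacyclic N → IsContraacyclic (cone f)
  | retract {M N : DGBimod.{w, v, v₂, u} A B} (i : M.Hom N) (r : N.Hom M) :
      Homotopic (r.comp i) (Hom.id M) → IsContraacyclic N → IsContraacyclic M
  | pi {ι : Type u} (M : ι → DGBimod.{w, v, v₂, u} A B) :
      (∀ i, IsContraacyclic (M i)) → IsContraacyclic (pi M)

/-- `f` becomes an isomorphism in the contraderived category, the Verdier quotient of the homotopy
category by the contraacyclic objects. -/
def IsContraIso {M N : DGBimod.{w, v, v₂, u} A B} (f : M.Hom N) : Prop :=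
  IsContraacyclic (cone f)

/-- Restriction of scalars along `f` on the left and `g` on the right. -/
noncomputable abbrev restrict {A' : DGAlg.{w, v} 𝕜} {B' : DGAlg.{w, v₂} 𝕜} (M : DGBimod.{w, v, v₂, u} A B)
    (f : A'.Hom A) (g : B'.Hom B) : DGBimod.{w, v, v₂, u} A' B' where
  toGrSpace := M.toGrSpace
  lact := M.lact ∘ₗ f.toCLM.toLinearMap
  ract := M.ract.compl₂ g.toCLM.toLinearMap
  continuous_lact := M.continuous_lact.comp (f.toCLM.continuous.prodMap continuous_id)
  continuous_ract := M.continuous_ract.comp (continuous_id.prodMap g.toCLM.continuous)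
  one_lact x := by
    change M.lact (f.toCLM _) x = x
    rw [f.map_one, M.one_lact]
  ract_one x := by
    change M.ract x (g.toCLM _) = x
    rw [g.map_one, M.ract_one]
  mul_lact a b x := by
    change M.lact (f.toCLM _) x = _
    rw [f.map_mul, M.mul_lact]; rfl
  ract_mul x a b := by
    change M.ract x (g.toCLM _) = _
    rw [g.map_mul, M.ract_mul]; rfl
  lact_ract a x b := M.lact_ract _ x _
  proj_lact m n a x ha hx := M.proj_lact m n _ x ((f.map_proj _ _).symm.trans (congrArg _ ha)) hx
  proj_ract m n x b hx hb := M.proj_ract m n x _ hx ((g.map_proj _ _).symm.trans (congrArg _ hb))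
  d := M.d
  proj_d := M.proj_d
  d_d := M.d_d
  d_lact n a x ha := by
    have := M.d_lact n (f.toCLM a) x ((f.map_proj _ _).symm.trans (congrArg _ ha))
    rwa [← f.map_d] at this
  d_ract n x b hx := by
    have := M.d_ract n x (g.toCLM b) hx
    rwa [← g.map_d] at this

/-- A dg-algebra as a bimodule over itself. -/
noncomputable abbrev regular (A : DGAlg.{w, u} 𝕜) : DGBimod.{w, u, u, u} A A where
  toGrSpace := A.toGrSpace
  lact := A.mul
  ract := A.mul
  continuous_lact := A.continuous_mul
  continuous_ract := A.continuous_mul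
  one_lact := A.one_mul
  ract_one := A.mul_one
  mul_lact := A.mul_assoc
  ract_mul x a b := (A.mul_assoc x a b).symm
  lact_ract := A.mul_assoc
  proj_lact := A.proj_mul
  proj_ract := A.proj_mul
  d := A.d
  proj_d := A.proj_d
  d_d := A.d_d
  d_lact := A.d_mul
  d_ract := A.d_mul

end DGBimod

/-- Right dg-modules over `A`. -/
abbrev RightDGMod (A : DGAlg.{w, v} 𝕜) := DGBimod.{w, w, v, u} (DGAlg.ground 𝕜) A

/-- `T`, with the bilinear map `β`, is the completed projective tensor product over `A` of the
right module `P` and the bimodule `N`: the cokernel, among complete locally convex spaces, of the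
difference of the two actions `P ⊗ A ⊗ N → P ⊗ N`. The last field is the universal property of this
cokernel, the others say that the grading, the differential and the right action of `B` are the
usual ones. -/
structure IsCompletedTensor {A : DGAlg.{w, u} 𝕜} {B : DGAlg.{w, u} 𝕜} (P : RightDGMod.{w, u, u} A)
    (N : DGBimod.{w, u, u, u} A B) (T : RightDGMod.{w, u, u} B)
    (β : P.carrier →ₗ[𝕜] N.carrier →ₗ[𝕜] T.carrier) : Prop where
  continuous : Continuous fun p : P.carrier × N.carrier => β p.1 p.2
  balanced : ∀ x a y, β (P.ract x a) y = β x (N.lact a y)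
  proj : ∀ m n x y, P.proj m x = x → N.proj n y = y → T.proj (m + n) (β x y) = β x y
  d : ∀ n x y, P.proj n x = x → T.d (β x y) = β (P.d x) y + (n.negOnePow : ℤ) • β x (N.d y)
  ract : ∀ x y b, T.ract (β x y) b = β x (N.ract y b)
  exists_unique_lift : ∀ (Z : Type u) [AddCommGroup Z] [Module 𝕜 Z] [UniformSpace Z]
    [IsUniformAddGroup Z] [ContinuousSMul 𝕜 Z] [PolynormableSpace 𝕜 Z] [T2Space Z]
    [CompleteSpace Z] (γ : P.carrier →ₗ[𝕜] N.carrier →ₗ[𝕜] Z),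
    (Continuous fun p : P.carrier × N.carrier => γ p.1 p.2) →
    (∀ x a y, γ (P.ract x a) y = γ x (N.lact a y)) →
    ∃! φ : T.carrier →L[𝕜] Z, ∀ x y, φ (β x y) = γ x y

/-- `T` is the derived extension of scalars of `M` along `f : A → B`: the tensor product `P ⊗ B`
for some graded-projective replacement `P → M`. -/
def IsDerivedExtension {A B : DGAlg.{w, u} 𝕜} (f : A.Hom B) (M : RightDGMod.{w, u, u} A)
    (T : RightDGMod.{w, u, u} B) : Prop :=
  ∃ (P : RightDGMod.{w, u, u} A) (q : P.Hom M) (β : _),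
    P.toGrBimod.IsProjective ∧ DGBimod.IsContraIso q ∧
    IsCompletedTensor P ((DGBimod.regular B).restrict f (DGAlg.Hom.id B)) T β

theorem sum_sum_alternating_eq_zero {E : Type v} [AddCommGroup E] (n : ℕ)
    (F : Fin (n + 1) → Fin n → E) (hF : ∀ i j : Fin n, i ≤ j → F j.succ i = F i.castSucc j) :
    ∑ j : Fin (n + 1), ((-1 : ℤ) ^ (j : ℕ)) • ∑ i : Fin n, ((-1 : ℤ) ^ (i : ℕ)) • F j i = 0 := by
  simp only [Finset.smul_sum, smul_smul]
  rw [← Finset.sum_product', Finset.univ_product_univ]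
  let S : Finset (Fin (n + 1) × Fin n) := {p | (p.1 : ℕ) ≤ (p.2 : ℕ)}
  rw [← Finset.sum_add_sum_compl S, ← eq_neg_iff_add_eq_zero, ← Finset.sum_neg_distrib]
  have key : ∀ p ∈ S, (p.1 : ℕ) ≤ (p.2 : ℕ) := fun p hp => (Finset.mem_filter.mp hp).2
  refine Finset.sum_bij (fun p hp => (p.2.succ, p.1.castLT ((key p hp).trans_lt p.2.is_lt)))
    ?_ ?_ ?_ ?_
  · intro p hp
    have := key p hp
    simp only [S, Finset.compl_filter, Finset.mem_filter_univ, Fin.val_succ, Fin.val_castLT]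
    omega
  · intro p hp q hq h
    have h1 := congrArg (fun x => (x.1 : ℕ)) h
    have h2 := congrArg (fun x => (x.2 : ℕ)) h
    simp only [Fin.val_succ, Fin.val_castLT] at h1 h2
    exact Prod.ext (Fin.ext h2) (Fin.ext (by omega))
  · rintro ⟨j, i⟩ hp
    simp only [S, Finset.compl_filter, Finset.mem_filter_univ, not_le] at hp
    have hj := j.is_lt
    refine ⟨(i.castSucc, ⟨j - 1, by omega⟩), ?_, ?_⟩
    · simp only [S, Finset.mem_filter_univ, Fin.val_castSucc]; omega
    · refine Prod.ext (Fin.ext ?_) (Fin.ext ?_) <;> simp; omega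
  · rintro ⟨j, i⟩ hp
    have h := key _ hp
    simp only at h ⊢
    rw [hF _ i (Fin.le_def.2 h), Fin.castSucc_castLT, ← neg_smul]
    congr 1
    simp only [Fin.val_succ, Fin.val_castLT]
    ring

theorem succ_succAbove_succAbove {n : ℕ} {i j : Fin (n + 1)} (h : i ≤ j) (a : Fin n) :
    j.succ.succAbove (i.succAbove a) = i.castSucc.succAbove (j.succAbove a) := by
  rcases i with ⟨i, _⟩
  rcases j with ⟨j, _⟩
  rcases a with ⟨a, _⟩
  ext
  dsimp [Fin.succAbove]
  split_ifs <;> · simp at * <;> lia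

section Cech

open CategoryTheory TopologicalSpace Opposite

/-- The intersection of the members of a finite nonempty subfamily. -/
def cechInter {X : TopCat.{u}} {I : Type u} [LinearOrder I] (U : I → Opens X) {k : ℕ}
    (s : Fin (k + 1) ↪o I) : Opens X := ⨅ j, U (s j)

theorem cechInter_le {X : TopCat.{u}} {I : Type u} [LinearOrder I] {U : I → Opens X} {V : Opens X}
    (hU : ∀ i, U i ≤ V) {k : ℕ} (s : Fin (k + 1) ↪o I) : cechInter U s ≤ V :=
  (iInf_le _ 0).trans (hU _)

def cechFace {I : Type u} [LinearOrder I] {k : ℕ} (s : Fin (k + 2) ↪o I) (j : Fin (k + 2)) :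
    Fin (k + 1) ↪o I := (Fin.succAboveOrderEmb j).trans s

theorem cechInter_face_le {X : TopCat.{u}} {I : Type u} [LinearOrder I] (U : I → Opens X) {k : ℕ}
    (s : Fin (k + 2) ↪o I) (j : Fin (k + 2)) : cechInter U s ≤ cechInter U (cechFace s j) :=
  le_iInf fun i => iInf_le _ (j.succAbove i)

variable {X : TopCat.{u}} (𝒜 : TopCat.Sheaf (DGAlg.{w, u} 𝕜) X)

/-- The dg-algebra of sections over `U`. -/
abbrev dgSections (U : Opens X) : DGAlg.{w, u} 𝕜 := 𝒜.presheaf.obj (op U)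

/-- The restriction of sections. -/
def resHom {U V : Opens X} (h : U ≤ V) : (dgSections 𝒜 V).Hom (dgSections 𝒜 U) :=
  𝒜.presheaf.map (homOfLE h).op

theorem resHom_resHom {U V W : Opens X} (h : U ≤ V) (h' : V ≤ W) (a : (dgSections 𝒜 W).carrier) :
    (resHom 𝒜 h).toCLM ((resHom 𝒜 h').toCLM a) = (resHom 𝒜 (h.trans h')).toCLM a := by
  have : resHom 𝒜 (h.trans h') = (resHom 𝒜 h).comp (resHom 𝒜 h') :=
    𝒜.presheaf.map_comp (homOfLE h').op (homOfLE h).op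
  rw [this]; rfl

/-- Sections over `U`, as a bimodule over the sections over a larger `V`. -/
noncomputable abbrev sectionsBimod {U V : Opens X} (h : U ≤ V) :
    DGBimod.{w, u, u, u} (dgSections 𝒜 V) (dgSections 𝒜 V) :=
  (DGBimod.regular (dgSections 𝒜 U)).restrict (resHom 𝒜 h) (resHom 𝒜 h)

variable {I : Type u} [LinearOrder I] {U : I → Opens X} {V : Opens X}

/-- The graded bimodule of ordered Čech cochains: the product of the `𝒜(U_{i₀} ∩ ⋯ ∩ U_{iₖ})[-k]`
over all `i₀ < ⋯ < iₖ`. -/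
noncomputable abbrev cechGr (hU : ∀ i, U i ≤ V) :
    GrBimod.{w, u, u, u} (dgSections 𝒜 V).toGrAlg (dgSections 𝒜 V).toGrAlg :=
  GrBimod.pi fun σ : (Σ k : ℕ, Fin (k + 1) ↪o I) =>
    (sectionsBimod 𝒜 (cechInter_le hU σ.2)).toGrBimod.shift (-(σ.1 : ℤ))

/-- The Čech differential `(δ c)_s = ∑ⱼ (-1)ʲ c_{∂ⱼ s}`. -/
noncomputable def cechδ (hU : ∀ i, U i ≤ V) : ∀ σ : (Σ k : ℕ, Fin (k + 1) ↪o I),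
    (cechGr 𝒜 hU).carrier →L[𝕜] (dgSections 𝒜 (cechInter U σ.2)).carrier
  | ⟨0, _⟩ => 0
  | ⟨k + 1, s⟩ => ∑ j : Fin (k + 2), ((-1 : ℤ) ^ (j : ℕ)) •
      ((resHom 𝒜 (cechInter_face_le U s j)).toCLM ∘L
        ContinuousLinearMap.proj (φ := fun σ : (Σ k : ℕ, Fin (k + 1) ↪o I) =>
          (dgSections 𝒜 (cechInter U σ.2)).carrier) ⟨k, cechFace s j⟩)

theorem cechδ_succ (hU : ∀ i, U i ≤ V) {k : ℕ} (s : Fin (k + 2) ↪o I)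
    (c : (cechGr 𝒜 hU).carrier) : cechδ 𝒜 hU ⟨k + 1, s⟩ c =
      ∑ j : Fin (k + 2), ((-1 : ℤ) ^ (j : ℕ)) •
        (resHom 𝒜 (cechInter_face_le U s j)).toCLM (c ⟨k, cechFace s j⟩) := by
  simp [cechδ]

theorem res_congr {k : ℕ} (c : ∀ σ : (Σ k : ℕ, Fin (k + 1) ↪o I),
    (dgSections 𝒜 (cechInter U σ.2)).carrier) {W : Opens X} {s t : Fin (k + 1) ↪o I} (e : s = t)
    (hs : W ≤ cechInter U s) (ht : W ≤ cechInter U t) :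
    (resHom 𝒜 hs).toCLM (c ⟨k, s⟩) = (resHom 𝒜 ht).toCLM (c ⟨k, t⟩) := by
  subst e; rfl

theorem cechδ_cechδ (hU : ∀ i, U i ≤ V) (c : (cechGr 𝒜 hU).carrier)
    (σ : Σ k : ℕ, Fin (k + 1) ↪o I) : cechδ 𝒜 hU σ (fun τ => cechδ 𝒜 hU τ c) = 0 := by
  obtain ⟨k, s⟩ := σ
  match k, s with
  | 0, _ => rfl
  | 1, s =>
    rw [cechδ_succ]
    refine Finset.sum_eq_zero fun j _ => ?_
    change _ • (resHom 𝒜 _).toCLM (0 : _) = _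
    rw [map_zero, smul_zero]
  | k + 2, s =>
    have h : ∀ j : Fin (k + 3), (resHom 𝒜 (cechInter_face_le U s j)).toCLM
        (cechδ 𝒜 hU ⟨k + 1, cechFace s j⟩ c) = ∑ i : Fin (k + 2), ((-1 : ℤ) ^ (i : ℕ)) •
          (resHom 𝒜 ((cechInter_face_le U s j).trans (cechInter_face_le U _ i))).toCLM
            (c ⟨k, cechFace (cechFace s j) i⟩) := fun j => by
      rw [cechδ_succ, map_sum]
      exact Finset.sum_congr rfl fun i _ => by rw [map_zsmul, resHom_resHom]
    rw [cechδ_succ]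
    simp only [h]
    refine sum_sum_alternating_eq_zero (k + 2) (fun j i => (resHom 𝒜
      ((cechInter_face_le U s j).trans (cechInter_face_le U _ i))).toCLM
        (c ⟨k, cechFace (cechFace s j) i⟩)) fun i j hij => res_congr 𝒜 c ?_ _ _
    ext a
    exact congrArg s (succ_succAbove_succAbove hij a)

theorem cechδ_d (hU : ∀ i, U i ≤ V) (c : (cechGr 𝒜 hU).carrier)
    (σ : Σ k : ℕ, Fin (k + 1) ↪o I) :
    cechδ 𝒜 hU σ (fun τ => ((-(τ.1 : ℤ)).negOnePow : ℤ) • (dgSections 𝒜 (cechInter U τ.2)).d (c τ)) =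
      -(((-(σ.1 : ℤ)).negOnePow : ℤ) • (dgSections 𝒜 (cechInter U σ.2)).d (cechδ 𝒜 hU σ c)) := by
  obtain ⟨k, s⟩ := σ
  match k, s with
  | 0, _ =>
    change (0 : _) = -(_ • (dgSections 𝒜 _).d (0 : _))
    rw [map_zero, smul_zero, neg_zero]
  | k + 1, s =>
    rw [cechδ_succ, cechδ_succ, map_sum, Finset.smul_sum, ← Finset.sum_neg_distrib]
    refine Finset.sum_congr rfl fun j _ => ?_
    rw [map_zsmul, map_zsmul, (resHom 𝒜 _).map_d, smul_comm, ← neg_smul]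
    congr 1
    have e : -((k + 1 : ℕ) : ℤ) = -((k : ℤ) + 1) := by push_cast; ring
    rw [e, Int.negOnePow_neg, Int.negOnePow_neg, Int.negOnePow_succ, Units.val_neg,
      neg_neg]

theorem cechδ_lact (hU : ∀ i, U i ≤ V) (n : ℤ) (a : (dgSections 𝒜 V).carrier)
    (ha : (dgSections 𝒜 V).proj n a = a) (c : (cechGr 𝒜 hU).carrier)
    (σ : Σ k : ℕ, Fin (k + 1) ↪o I) :
    cechδ 𝒜 hU σ ((cechGr 𝒜 hU).lact a c) = (n.negOnePow : ℤ) •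
      (sectionsBimod 𝒜 (cechInter_le hU σ.2)).lact
        ((dgSections 𝒜 V).koszul (-(σ.1 : ℤ)) a) (cechδ 𝒜 hU σ c) := by
  obtain ⟨k, s⟩ := σ
  match k, s with
  | 0, _ =>
    change (0 : _) = _ • (sectionsBimod 𝒜 _).lact _ (0 : _)
    rw [map_zero, smul_zero]
  | k + 1, s =>
    rw [cechδ_succ, cechδ_succ, map_sum, Finset.smul_sum]
    refine Finset.sum_congr rfl fun j _ => ?_
    change _ • (resHom 𝒜 _).toCLM ((dgSections 𝒜 _).mul
      ((resHom 𝒜 _).toCLM ((dgSections 𝒜 V).koszul (-(k : ℤ)) a)) (c ⟨k, cechFace s j⟩)) =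
      _ • (dgSections 𝒜 _).mul ((resHom 𝒜 _).toCLM ((dgSections 𝒜 V).koszul (-((k + 1 : ℕ) : ℤ)) a))
        (_ • (resHom 𝒜 _).toCLM (c ⟨k, cechFace s j⟩))
    rw [(resHom 𝒜 _).map_mul, resHom_resHom, GrSpace.koszul_of_homog _ _ n a ha,
      GrSpace.koszul_of_homog _ _ n a ha]
    simp only [map_zsmul, LinearMap.smul_apply, smul_smul]
    congr 1
    have : (-((k + 1 : ℕ) : ℤ)) * n = -(k : ℤ) * n - n := by push_cast; ring
    rw [this, Int.negOnePow_sub, Units.val_mul]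
    have := congrArg Units.val (Int.units_mul_self n.negOnePow)
    rw [Units.val_mul, Units.val_one] at this
    linear_combination (-((-1 : ℤ) ^ (j : ℕ)) * ((-(k : ℤ) * n).negOnePow : ℤ)) * this

theorem cechδ_ract (hU : ∀ i, U i ≤ V) (c : (cechGr 𝒜 hU).carrier) (b : (dgSections 𝒜 V).carrier)
    (σ : Σ k : ℕ, Fin (k + 1) ↪o I) :
    cechδ 𝒜 hU σ ((cechGr 𝒜 hU).ract c b) =
      (sectionsBimod 𝒜 (cechInter_le hU σ.2)).ract (cechδ 𝒜 hU σ c) b := by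
  obtain ⟨k, s⟩ := σ
  match k, s with
  | 0, _ =>
    change (0 : _) = (sectionsBimod 𝒜 _).ract (0 : _) _
    rw [map_zero, LinearMap.zero_apply]
  | k + 1, s =>
    rw [cechδ_succ, cechδ_succ, map_sum, LinearMap.sum_apply]
    refine Finset.sum_congr rfl fun j _ => ?_
    rw [map_zsmul, LinearMap.smul_apply]
    change _ • (resHom 𝒜 _).toCLM ((dgSections 𝒜 _).mul (c ⟨k, cechFace s j⟩)
      ((resHom 𝒜 _).toCLM b)) = _ • (dgSections 𝒜 _).mul
        ((resHom 𝒜 _).toCLM (c ⟨k, cechFace s j⟩)) ((resHom 𝒜 _).toCLM b)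
    rw [(resHom 𝒜 _).map_mul, resHom_resHom]

theorem cechδ_proj (hU : ∀ i, U i ≤ V) (n : ℤ) (c : (cechGr 𝒜 hU).carrier)
    (hc : (cechGr 𝒜 hU).proj n c = c) (σ : Σ k : ℕ, Fin (k + 1) ↪o I) :
    (dgSections 𝒜 (cechInter U σ.2)).proj (n + 1 + -(σ.1 : ℤ)) (cechδ 𝒜 hU σ c) =
      cechδ 𝒜 hU σ c := by
  obtain ⟨k, s⟩ := σ
  match k, s with
  | 0, _ =>
    change (dgSections 𝒜 _).proj _ (0 : _) = (0 : _)
    rw [map_zero]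
  | k + 1, s =>
    rw [cechδ_succ, map_sum]
    refine Finset.sum_congr rfl fun j _ => ?_
    have h : (dgSections 𝒜 (cechInter U (cechFace s j))).proj (n + -(k : ℤ)) (c ⟨k, cechFace s j⟩) =
        c ⟨k, cechFace s j⟩ := congrFun hc ⟨k, cechFace s j⟩
    have e : n + 1 + -((k + 1 : ℕ) : ℤ) = n + -(k : ℤ) := by push_cast; ring
    rw [map_zsmul, e, ← (resHom 𝒜 _).map_proj, h]

/-- The Čech complex of a cover, as a bimodule over the sections over `V`, with differential
`(D c)_s = (δ c)_s + (-1)ᵏ d (c_s)` for `s = (i₀ < ⋯ < iₖ)`. -/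
noncomputable def cech (hU : ∀ i, U i ≤ V) :
    DGBimod.{w, u, u, u} (dgSections 𝒜 V) (dgSections 𝒜 V) where
  toGrBimod := cechGr 𝒜 hU
  d := ContinuousLinearMap.pi fun σ => cechδ 𝒜 hU σ +
    ((sectionsBimod 𝒜 (cechInter_le hU σ.2)).shift (-(σ.1 : ℤ))).d ∘L
      ContinuousLinearMap.proj (φ := fun σ : (Σ k : ℕ, Fin (k + 1) ↪o I) =>
          (dgSections 𝒜 (cechInter U σ.2)).carrier) σ
  proj_d n c hc := funext fun σ => by
    have h1 := cechδ_proj 𝒜 hU n c hc σ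
    have h2 := ((sectionsBimod 𝒜 (cechInter_le hU σ.2)).shift (-(σ.1 : ℤ))).proj_d n (c σ)
      (congrFun hc σ)
    exact (map_add _ _ _).trans (congrArg₂ (· + ·) h1 h2)
  d_d c := funext fun σ => by
    have h1 := cechδ_cechδ 𝒜 hU c σ
    have h2 := cechδ_d 𝒜 hU c σ
    have h3 := ((sectionsBimod 𝒜 (cechInter_le hU σ.2)).shift (-(σ.1 : ℤ))).d_d (c σ)
    have e1 := map_add (cechδ 𝒜 hU σ) (fun τ => cechδ 𝒜 hU τ c) (fun τ =>
      ((-(τ.1 : ℤ)).negOnePow : ℤ) • (dgSections 𝒜 (cechInter U τ.2)).d (c τ))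
    have e2 := map_add ((sectionsBimod 𝒜 (cechInter_le hU σ.2)).shift (-(σ.1 : ℤ))).d
      (cechδ 𝒜 hU σ c) (((-(σ.1 : ℤ)).negOnePow : ℤ) • (dgSections 𝒜 (cechInter U σ.2)).d (c σ))
    refine (congrArg₂ (· + ·) e1 e2).trans ?_
    refine (congrArg₂ (· + ·) (congrArg₂ (· + ·) h1 h2) (congrArg₂ (· + ·) rfl h3)).trans ?_
    change (0 + -_) + (_ + 0) = (0 : (dgSections 𝒜 (cechInter U σ.2)).carrier)
    rw [zero_add, add_zero]
    exact neg_add_cancel _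
  d_lact n a c ha := funext fun σ => by
    have h1 := cechδ_lact 𝒜 hU n a ha c σ
    have h2 := ((sectionsBimod 𝒜 (cechInter_le hU σ.2)).shift (-(σ.1 : ℤ))).d_lact n a (c σ) ha
    refine (congrArg₂ (· + ·) h1 h2).trans ?_
    have e1 := map_add (((sectionsBimod 𝒜 (cechInter_le hU σ.2)).shift (-(σ.1 : ℤ))).lact a)
      (cechδ 𝒜 hU σ c) (((sectionsBimod 𝒜 (cechInter_le hU σ.2)).shift (-(σ.1 : ℤ))).d (c σ))
    refine (add_left_comm _ _ _).trans (congrArg₂ (· + ·) rfl ?_)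
    exact (smul_add _ _ _).symm.trans (congrArg _ e1.symm)
  d_ract n c b hc := funext fun σ => by
    have h1 := cechδ_ract 𝒜 hU c b σ
    have h2 := ((sectionsBimod 𝒜 (cechInter_le hU σ.2)).shift (-(σ.1 : ℤ))).d_ract n (c σ) b
      (congrFun hc σ)
    refine (congrArg₂ (· + ·) h1 h2).trans ?_
    refine (add_assoc _ _ _).symm.trans (congrArg₂ (· + ·) ?_ rfl)
    exact (LinearMap.map_add₂ ((sectionsBimod 𝒜 (cechInter_le hU σ.2)).shift
      (-(σ.1 : ℤ))).ract _ _ b).symm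

/-- The components of the natural map into the Čech complex: `a ↦ (a|_{Uᵢ})ᵢ`. -/
noncomputable def cechAugFun (hU : ∀ i, U i ≤ V) : ∀ σ : (Σ k : ℕ, Fin (k + 1) ↪o I),
    (dgSections 𝒜 V).carrier →L[𝕜] (dgSections 𝒜 (cechInter U σ.2)).carrier
  | ⟨0, s⟩ => (resHom 𝒜 (cechInter_le hU s)).toCLM
  | ⟨_ + 1, _⟩ => 0

/-- The natural map from the sections over `V` to the Čech complex. -/
noncomputable def cechAug (hU : ∀ i, U i ≤ V) :
    (DGBimod.regular (dgSections 𝒜 V)).Hom (cech 𝒜 hU) where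
  toCLM := ContinuousLinearMap.pi fun σ => cechAugFun 𝒜 hU σ
  map_proj n a := funext fun σ => by
    obtain ⟨k, s⟩ := σ
    match k, s with
    | 0, s =>
      refine ((resHom 𝒜 (cechInter_le hU s)).map_proj n a).trans ?_
      change _ = (dgSections 𝒜 (cechInter U s)).proj (n + -((0 : ℕ) : ℤ)) _
      rw [Nat.cast_zero, neg_zero, add_zero]; rfl
    | k + 1, s => exact (map_zero ((dgSections 𝒜 (cechInter U s)).proj _)).symm
  map_lact a x := funext fun σ => by
    obtain ⟨k, s⟩ := σ
    match k, s with
    | 0, s =>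
      refine ((resHom 𝒜 (cechInter_le hU s)).map_mul a x).trans ?_
      change _ = (dgSections 𝒜 (cechInter U s)).mul ((resHom 𝒜 (cechInter_le hU s)).toCLM
        ((dgSections 𝒜 V).koszul (-((0 : ℕ) : ℤ)) a)) _
      have : (dgSections 𝒜 V).koszul (-((0 : ℕ) : ℤ)) a = a :=
        (dgSections 𝒜 V).proj_ext fun n => by simp [GrSpace.proj_koszul]
      rw [this]; rfl
    | k + 1, s => exact (map_zero ((dgSections 𝒜 (cechInter U s)).mul _)).symm
  map_ract x b := funext fun σ => by
    obtain ⟨k, s⟩ := σ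
    match k, s with
    | 0, s => exact (resHom 𝒜 (cechInter_le hU s)).map_mul x b
    | k + 1, s => exact (LinearMap.map_zero₂ (dgSections 𝒜 (cechInter U s)).mul _).symm
  map_d x := funext fun σ => by
    obtain ⟨k, s⟩ := σ
    match k, s with
    | 0, s =>
      refine ((resHom 𝒜 (cechInter_le hU s)).map_d x).trans ?_
      change _ = (0 : (dgSections 𝒜 (cechInter U s)).carrier) +
        ((-((0 : ℕ) : ℤ)).negOnePow : ℤ) • (dgSections 𝒜 (cechInter U s)).d _
      rw [zero_add, Nat.cast_zero, neg_zero, Int.negOnePow_zero, Units.val_one, one_smul]; rfl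
    | 1, s =>
      change (0 : (dgSections 𝒜 (cechInter U s)).carrier) = cechδ 𝒜 hU ⟨1, s⟩ (fun σ => cechAugFun 𝒜 hU σ x) +
        ((-((1 : ℕ) : ℤ)).negOnePow : ℤ) • (dgSections 𝒜 (cechInter U s)).d 0
      rw [map_zero, smul_zero, add_zero, cechδ_succ, Fin.sum_univ_two]
      change _ = _ • (resHom 𝒜 _).toCLM ((resHom 𝒜 _).toCLM x) +
        _ • (resHom 𝒜 _).toCLM ((resHom 𝒜 _).toCLM x)
      rw [resHom_resHom, resHom_resHom]
      simp
    | k + 2, s =>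
      change (0 : (dgSections 𝒜 (cechInter U s)).carrier) = cechδ 𝒜 hU ⟨k + 2, s⟩ (fun σ => cechAugFun 𝒜 hU σ x) +
        ((-((k + 2 : ℕ) : ℤ)).negOnePow : ℤ) • (dgSections 𝒜 (cechInter U s)).d 0
      rw [map_zero, smul_zero, add_zero, cechδ_succ]
      refine (Finset.sum_eq_zero fun j _ => ?_).symm
      change _ • (resHom 𝒜 _).toCLM (0 : _) = _
      rw [map_zero, smul_zero]

end Cech

section Covers

open TopologicalSpace

/-- The family has dimension at most `n`: any `n + 2` of its members have empty intersection. -/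
def FamilyDimLE {X : TopCat.{u}} {I : Type u} (U : I → Opens X) (n : ℕ) : Prop :=
  ∀ s : Finset I, s.card = n + 2 → ∀ x, ∃ i ∈ s, x ∉ U i

/-- A family `U` of opens is a cover of finite dimension of `V`. -/
def IsFiniteDimCover {X : TopCat.{u}} {I : Type u} (U : I → Opens X) (V : Opens X) : Prop :=
  ⨆ i, U i = V ∧ ∃ n, FamilyDimLE U n

/-- Finite covering dimension: for some `n`, every open cover has an open refinement of dimension
at most `n`. -/
def HasFiniteCoveringDim (X : TopCat.{u}) : Prop :=
  ∃ n, ∀ (I : Type u) (U : I → Opens X), ⨆ i, U i = ⊤ →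
    ∃ (J : Type u) (W : J → Opens X), ⨆ j, W j = ⊤ ∧ (∀ j, ∃ i, W j ≤ U i) ∧ FamilyDimLE W n

theorem IsFiniteDimCover.le {X : TopCat.{u}} {I : Type u} {U : I → Opens X} {V : Opens X}
    (h : IsFiniteDimCover U V) (i : I) : U i ≤ V := h.1 ▸ le_iSup U i

/-- Strong descent: for every cover of finite dimension of an open `V`, the natural map from
`𝒜(V)` to the Čech complex is an isomorphism in the contraderived category of bimodules
over `𝒜(V)`. -/
def StrongDescent {X : TopCat.{u}} (𝒜 : TopCat.Sheaf (DGAlg.{w, u} 𝕜) X) : Prop :=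
  ∀ (V : Opens X) (I : Type u) [LinearOrder I] (U : I → Opens X) (h : IsFiniteDimCover U V),
    DGBimod.IsContraIso (cechAug 𝒜 h.le)

end Covers

end

end ClctDG

namespace ClctDG

open Filter Topology

/-! ### Bilinear maps and infinite sums in complete locally convex spaces. -/

section FunctionalAnalysis

variable {𝕜 : Type w} [RCLike 𝕜]

section Bilinear

variable {E F Z : Type*} [AddCommGroup E] [Module 𝕜 E] [TopologicalSpace E]
  [AddCommGroup F] [Module 𝕜 F] [TopologicalSpace F]
  [AddCommGroup Z] [Module 𝕜 Z] [TopologicalSpace Z]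

/-! Everything is computed with one graded-projective replacement `P → M`. Since its cone is
contraacyclic, `M` is contraacyclic exactly when `P` is, and `M ⊗ᴸ 𝒜(U)` is represented by the
honest tensor product `P ⊗ 𝒜(U)`. Any other choice comes from another replacement, which is homotopy
equivalent to `P`, so the choice does not affect contraacyclicity.

Two properties of a graded-projective `P` carry the proof. First, every closed morphism from `P` to
a contraacyclic module is null-homotopic (`isHomAcyclic_of_isContraacyclic`). Second, `P ⊗ -` sends
contraacyclic bimodules to contraacyclic modules (`isContraacyclic_tens`). Both go by induction over
the operations that generate the contraacyclic objects. For the second, `P ⊗ -` must preserve split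
exact sequences and arbitrary products. Exactness holds because `P` is a retract of a free module `P
⊗ A` over the ground field. Products are preserved because of the topology: a neighbourhood of the
origin in a product contains all but finitely many factors entirely, so a continuous bilinear map
followed by a continuous seminorm vanishes on all but finitely many factors
(`IsSmallFamily.bilinear`), and the componentwise maps have a convergent sum (`IsTens.pi`). The same
remark shows that products of graded-projective modules are graded-projective (`isProjective_pi`).
Hence the product-totalization of a resolution by free modules is a graded-projective replacement.
Its augmentation has contraacyclic cone because the cone is the limit of a split tower of
contraacyclic cones (`isContraIso_resolutionAug`).

Contraacyclicity of `T = P ⊗ B` is detected by the map `x ↦ x ⊗ 1` from `P` to `T`. If `T` is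
contraacyclic merely over `A`, this map is null-homotopic by the first property, and extending the
homotopy `B`-linearly contracts `T` over `B`. This gives the second claim of the theorem. A
null-homotopy also persists under a further extension of scalars, so contraacyclicity over `U`
passes to every smaller open set (`isContraacyclic_extension_mono`), and contraacyclicity of `P`
passes to every `U`.

For the local-to-global direction, the tensor product of `P` with the descent map shows that `P → P
⊗ Č` has contraacyclic cone, where `Č` is the Čech complex. The filtration of `Č` by Čech degree is
finite, because the cover has finite dimension and the sections over the empty set vanish. Its
layers are products of shifts of sections over intersections of members of the cover. So `P ⊗ Č`,
and with it `P`, is contraacyclic as soon as this is so over each member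
(`isContraacyclic_of_cover`). When the covering dimension is finite, a cover by good neighbourhoods
of points is refined to one of finite dimension, to which contraacyclicity restricts. -/

theorem exists_nhds_seminorm_le_one (γ : E →ₗ[𝕜] F →ₗ[𝕜] Z)
    (hγ : Continuous fun p : E × F => γ p.1 p.2) (q : Seminorm 𝕜 Z) (hq : Continuous q) :
    ∃ U ∈ 𝓝 (0 : E), ∃ V ∈ 𝓝 (0 : F), ∀ x ∈ U, ∀ y ∈ V, q (γ x y) ≤ 1 := by
  have h : Tendsto (fun p : E × F => q (γ p.1 p.2)) (𝓝 (0, 0)) (𝓝 0) :=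
    (hq.comp hγ).tendsto' _ _ (by simp)
  have h2 := h.eventually (Iic_mem_nhds zero_lt_one)
  rw [nhds_prod_eq, Filter.eventually_prod_iff] at h2
  obtain ⟨p, hp, r, hr, h3⟩ := h2
  exact ⟨{x | p x}, hp, {y | r y}, hr, fun x hx y hy => h3 hx hy⟩

theorem exists_smul_mem_of_nhds [ContinuousSMul 𝕜 E] {U : Set E} (hU : U ∈ 𝓝 (0 : E)) (x : E) :
    ∃ c : 𝕜, c ≠ 0 ∧ c • x ∈ U := by
  have h : Tendsto (fun c : 𝕜 => c • x) (𝓝[≠] 0) (𝓝 0) :=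
    ((continuous_id.smul continuous_const).tendsto' (0 : 𝕜) _ (zero_smul _ _)).mono_left
      nhdsWithin_le_nhds
  obtain ⟨c, hc, hc0⟩ := ((h.eventually hU).and self_mem_nhdsWithin).exists
  exact ⟨c, hc0, hc⟩

theorem eventually_seminorm_apply_le [ContinuousSMul 𝕜 E] {Z : Type*} [AddCommGroup Z]
    [Module 𝕜 Z] (f : E → Z) (q : Seminorm 𝕜 Z)
    (hf : ∀ (c : 𝕜) x, q (f (c • x)) = ‖c‖ * q (f x)) {U : Set E} (hU : U ∈ 𝓝 (0 : E))
    {C : ℝ} (hC : ∀ x ∈ U, q (f x) ≤ C) {ε : ℝ} (hε : 0 < ε) :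
    ∃ W ∈ 𝓝 (0 : E), ∀ x ∈ W, q (f x) ≤ ε := by
  -- The bound `C` may be zero or negative, so `|C| + 1` is used as the divisor.
  obtain ⟨c, hc0, hc⟩ := NormedField.exists_norm_lt 𝕜 (div_pos hε (by positivity : 0 < |C| + 1))
  have hcne : c ≠ 0 := norm_pos_iff.1 hc0
  refine ⟨{x | c⁻¹ • x ∈ U}, ?_, fun x hx => ?_⟩
  · exact ((continuous_const_smul c⁻¹).tendsto' (0 : E) 0 (smul_zero _)).eventually hU
  · have h := hf c (c⁻¹ • x)
    rw [smul_inv_smul₀ hcne] at h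
    rw [h]
    have h1 : q (f (c⁻¹ • x)) ≤ |C| + 1 := (hC _ hx).trans (by linarith [le_abs_self C])
    calc ‖c‖ * q (f (c⁻¹ • x)) ≤ ε / (|C| + 1) * (|C| + 1) := by gcongr
      _ = ε := div_mul_cancel₀ _ (by positivity)

/-- A bilinear map into a locally convex space is jointly continuous if every continuous seminorm
is bounded on the image of a neighbourhood of the origin. -/
theorem _root_.WithSeminorms.continuous_bilinear_of_bounded [IsTopologicalAddGroup E]
    [ContinuousSMul 𝕜 E] [IsTopologicalAddGroup F] [ContinuousSMul 𝕜 F] {ι : Type*}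
    {p : SeminormFamily 𝕜 Z ι} (hp : WithSeminorms p) (γ : E →ₗ[𝕜] F →ₗ[𝕜] Z)
    (h : ∀ i, ∃ U ∈ 𝓝 (0 : E), ∃ V ∈ 𝓝 (0 : F), ∀ x ∈ U, ∀ y ∈ V, p i (γ x y) ≤ 1) :
    Continuous fun p : E × F => γ p.1 p.2 := by
  rw [continuous_iff_continuousAt]
  rintro ⟨x₀, y₀⟩
  refine (hp.tendsto_nhds _ _).2 fun i ε hε => ?_
  obtain ⟨U, hU, V, hV, hUV⟩ := h i
  set q := p i
  -- The increment of `γ` splits into three terms, one quadratic and two linear in the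
  -- displacements. Each is kept below `ε / 4`, leaving room for the strict inequality.
  have hε4 : 0 < ε / 4 := by positivity
  obtain ⟨W₁, hW₁, h1⟩ : ∃ W ∈ 𝓝 (0 : E), ∀ x ∈ W, ∀ y ∈ V, q (γ x y) ≤ ε / 4 := by
    obtain ⟨c, hc0, hc⟩ := NormedField.exists_norm_lt 𝕜 hε4
    have hcne : c ≠ 0 := norm_pos_iff.1 hc0
    refine ⟨{x | c⁻¹ • x ∈ U},
      ((continuous_const_smul c⁻¹).tendsto' (0 : E) 0 (smul_zero _)).eventually hU,
      fun x hx y hy => ?_⟩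
    have h := hUV _ hx _ hy
    rw [map_smul, LinearMap.smul_apply, map_smul_eq_mul, norm_inv] at h
    calc q (γ x y) = ‖c‖ * (‖c‖⁻¹ * q (γ x y)) := by field_simp
      _ ≤ ε / 4 * 1 := by gcongr
      _ = ε / 4 := mul_one _
  obtain ⟨W₂, hW₂, h2⟩ : ∃ W ∈ 𝓝 (0 : E), ∀ x ∈ W, q (γ x y₀) ≤ ε / 4 := by
    obtain ⟨c, hcne, hc⟩ := exists_smul_mem_of_nhds (𝕜 := 𝕜) hV y₀
    refine eventually_seminorm_apply_le (fun x => γ x y₀) q (fun d x => by simp [map_smul_eq_mul])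
      hU (C := ‖c‖⁻¹) (fun x hx => ?_) hε4
    have h := hUV _ hx _ hc
    rw [map_smul, map_smul_eq_mul] at h
    have hc' : 0 < ‖c‖ := norm_pos_iff.2 hcne
    rwa [← one_div, le_div_iff₀' hc']
  obtain ⟨W₃, hW₃, h3⟩ : ∃ W ∈ 𝓝 (0 : F), ∀ y ∈ W, q (γ x₀ y) ≤ ε / 4 := by
    obtain ⟨c, hcne, hc⟩ := exists_smul_mem_of_nhds (𝕜 := 𝕜) hU x₀
    refine eventually_seminorm_apply_le (fun y => γ x₀ y) q (fun d x => by simp [map_smul_eq_mul])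
      hV (C := ‖c‖⁻¹) (fun y hy => ?_) hε4
    have h := hUV _ hc _ hy
    rw [map_smul, LinearMap.smul_apply, map_smul_eq_mul] at h
    have hc' : 0 < ‖c‖ := norm_pos_iff.2 hcne
    rwa [← one_div, le_div_iff₀' hc']
  have e1 : ∀ᶠ p : E × F in 𝓝 (x₀, y₀), p.1 - x₀ ∈ W₁ ∩ W₂ :=
    ((continuous_fst.sub continuous_const).tendsto' (x₀, y₀) 0 (sub_self _)).eventually
      (inter_mem hW₁ hW₂)
  have e2 : ∀ᶠ p : E × F in 𝓝 (x₀, y₀), p.2 - y₀ ∈ V ∩ W₃ :=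
    ((continuous_snd.sub continuous_const).tendsto' (x₀, y₀) 0 (sub_self _)).eventually
      (inter_mem hV hW₃)
  filter_upwards [e1, e2] with p hp1 hp2
  have e : γ p.1 p.2 - γ x₀ y₀ = γ (p.1 - x₀) (p.2 - y₀) + (γ (p.1 - x₀) y₀ + γ x₀ (p.2 - y₀)) := by
    simp only [map_sub, LinearMap.sub_apply]; abel
  have b1 := h1 _ hp1.1 _ hp2.1
  have b2 := h2 _ hp1.2
  have b3 := h3 _ hp2.2
  have t1 := map_add_le_add q (γ (p.1 - x₀) (p.2 - y₀)) (γ (p.1 - x₀) y₀ + γ x₀ (p.2 - y₀))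
  have t2 := map_add_le_add q (γ (p.1 - x₀) y₀) (γ x₀ (p.2 - y₀))
  change q (γ p.1 p.2 - γ x₀ y₀) < ε
  rw [e]
  linarith

theorem continuous_bilinear_of_bounded [IsTopologicalAddGroup E] [ContinuousSMul 𝕜 E]
    [IsTopologicalAddGroup F] [ContinuousSMul 𝕜 F] [PolynormableSpace 𝕜 Z]
    (γ : E →ₗ[𝕜] F →ₗ[𝕜] Z)
    (h : ∀ q : Seminorm 𝕜 Z, Continuous q →
      ∃ U ∈ 𝓝 (0 : E), ∃ V ∈ 𝓝 (0 : F), ∀ x ∈ U, ∀ y ∈ V, q (γ x y) ≤ 1) :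
    Continuous fun p : E × F => γ p.1 p.2 :=
  (PolynormableSpace.withSeminorms 𝕜 Z).continuous_bilinear_of_bounded γ fun q => h q.1 q.2

end Bilinear

section Sums

variable {Z : Type*} [AddCommGroup Z] [Module 𝕜 Z] [UniformSpace Z] [IsUniformAddGroup Z]
  [PolynormableSpace 𝕜 Z] [CompleteSpace Z]

/-- A family of continuous maps of which, for every continuous seminorm, only finitely many are
nonzero has a continuous sum. -/
theorem exists_continuous_hasSum {ι X : Type*} [TopologicalSpace X] (f : ι → X → Z)
    (hf : ∀ i, Continuous (f i))
    (h : ∀ q : Seminorm 𝕜 Z, Continuous q → ∃ S : Finset ι, ∀ i ∉ S, ∀ x, q (f i x) = 0) :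
    ∃ Φ : X → Z, Continuous Φ ∧ ∀ x, HasSum (fun i => f i x) (Φ x) := by
  -- One finite exceptional set serves all points at once, because a neighbourhood is governed by
  -- finitely many seminorms. This yields uniform convergence, hence continuity of the sum.
  have key : ∀ U ∈ 𝓝 (0 : Z), ∃ S : Finset ι, ∀ T : Finset ι, Disjoint T S →
      ∀ x, ∑ i ∈ T, f i x ∈ U := by
    intro U hU
    obtain ⟨s, r, hr, hs⟩ := ((PolynormableSpace.withSeminorms 𝕜 Z).mem_nhds_iff 0 U).1 hU
    choose S hS using fun q : {p : Seminorm 𝕜 Z // Continuous p} => h q.1 q.2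
    classical
    refine ⟨s.biUnion S, fun T hT x => hs ?_⟩
    rw [Seminorm.mem_ball_zero]
    refine Seminorm.finset_sup_apply_lt hr fun q hq => ?_
    refine lt_of_le_of_lt ?_ hr
    have : q.1 (∑ i ∈ T, f i x) ≤ ∑ i ∈ T, q.1 (f i x) :=
      Finset.le_sum_of_subadditive _ (map_zero q.1).le (map_add_le_add q.1) _ _
    refine this.trans (le_of_eq (Finset.sum_eq_zero fun i hi => hS q i (fun h' => ?_) x))
    exact Finset.disjoint_left.1 hT hi (Finset.mem_biUnion.2 ⟨q, hq, h'⟩)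
  have hsum : ∀ x, Summable fun i => f i x := fun x =>
    summable_iff_vanishing.2 fun U hU => (key U hU).imp fun S hS T hT => hS T hT x
  choose Φ hΦ using fun x => hsum x
  refine ⟨Φ, ?_, hΦ⟩
  have hunif : TendstoUniformly (fun (S : Finset ι) x => ∑ i ∈ S, f i x) Φ atTop := by
    intro V hV
    rw [uniformity_eq_comap_nhds_zero] at hV
    obtain ⟨U, hU, hUV⟩ := hV
    obtain ⟨C, hC, hCc, hCU⟩ := exists_mem_nhds_isClosed_subset hU
    -- The partial sum over `T` minus the one over a larger `T'` is minus the sum over `T' \ T`,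
    -- hence the reflected neighbourhood. Closedness of `C` lets `T'` tend to infinity.
    obtain ⟨S, hS⟩ := key {z | -z ∈ C}
      ((continuous_neg.tendsto' (0 : Z) 0 neg_zero).eventually hC)
    filter_upwards [eventually_ge_atTop S] with T hT x
    refine hUV (hCU ?_)
    have : Tendsto (fun T' : Finset ι => (∑ i ∈ T, f i x) - ∑ i ∈ T', f i x) atTop
      (𝓝 ((∑ i ∈ T, f i x) - Φ x)) := tendsto_const_nhds.sub (hΦ x)
    refine hCc.mem_of_tendsto this ?_
    filter_upwards [eventually_ge_atTop T] with T' hT'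
    classical
    rw [← Finset.sum_sdiff hT', sub_add_cancel_right]
    exact hS _ (Finset.disjoint_of_subset_right hT Finset.sdiff_disjoint) x
  exact hunif.continuous (Frequently.of_forall fun S => continuous_finsetSum _ fun i _ => hf i)

end Sums

section SmallFamilies

variable {ι : Type*} {V : ι → Type*} {E W Z : Type*} [∀ i, AddCommGroup (V i)]
  [∀ i, Module 𝕜 (V i)] [AddCommGroup E] [Module 𝕜 E] [TopologicalSpace E]
  [AddCommGroup W] [Module 𝕜 W] [TopologicalSpace W]
  [AddCommGroup Z] [Module 𝕜 Z] [TopologicalSpace Z]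

/-- A family of linear maps into `W` is small if every neighbourhood of the origin contains the
ranges of all but finitely many of them. -/
def IsSmallFamily (f : ∀ i, V i →ₗ[𝕜] W) : Prop :=
  ∀ U ∈ 𝓝 (0 : W), ∃ S : Finset ι, ∀ i ∉ S, ∀ v, f i v ∈ U

/-- The range of `f i` is a linear subspace. Once it lies in the neighbourhood where `q ∘ γ` is
bounded, rescaling `v` forces `q ∘ γ` to vanish on it. The exceptional set does not depend on `x`,
since every `x` can be scaled into the neighbourhood on its side. -/
theorem IsSmallFamily.bilinear [ContinuousSMul 𝕜 E] {f : ∀ i, V i →ₗ[𝕜] W} (hf : IsSmallFamily f)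
    (γ : E →ₗ[𝕜] W →ₗ[𝕜] Z) (hγ : Continuous fun p : E × W => γ p.1 p.2)
    (q : Seminorm 𝕜 Z) (hq : Continuous q) :
    ∃ S : Finset ι, ∀ i ∉ S, ∀ x v, q (γ x (f i v)) = 0 := by
  obtain ⟨A, hA, U, hU, hAU⟩ := exists_nhds_seminorm_le_one γ hγ q hq
  obtain ⟨S, hS⟩ := hf U hU
  refine ⟨S, fun i hi x v => ?_⟩
  obtain ⟨c, hc0, hc⟩ := exists_smul_mem_of_nhds (𝕜 := 𝕜) hA x
  have hc' : 0 < ‖c‖ := norm_pos_iff.2 hc0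
  refine le_antisymm (le_of_forall_pos_le_add fun ε hε => ?_) (apply_nonneg q _)
  -- The scalar is chosen so that the bound by `1` becomes the bound by `ε` for the unscaled vector.
  have h := hAU _ hc _ (hS i hi (((RCLike.ofReal (‖c‖⁻¹ * ε⁻¹) : 𝕜)) • v))
  rw [map_smul, map_smul, map_smul, LinearMap.smul_apply, map_smul_eq_mul, map_smul_eq_mul,
    RCLike.norm_ofReal, abs_of_pos (by positivity)] at h
  have h2 : ‖c‖⁻¹ * ε⁻¹ * (‖c‖ * q (γ x (f i v))) = q (γ x (f i v)) / ε := by field_simp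
  rw [h2, div_le_one hε] at h
  rwa [zero_add]

/-- A basic neighbourhood of the origin in a product constrains only finitely many coordinates. This
is the source of all compatibility of completed tensor products with infinite products. -/
theorem isSmallFamily_single {V : ι → Type*} [∀ i, AddCommGroup (V i)] [∀ i, Module 𝕜 (V i)]
    [∀ i, TopologicalSpace (V i)] [DecidableEq ι] :
    IsSmallFamily fun i => LinearMap.single 𝕜 V i := by
  intro U hU
  rw [nhds_pi, Filter.mem_pi'] at hU
  obtain ⟨S, t, ht, htU⟩ := hU
  refine ⟨S, fun i hi v => htU fun j hj => ?_⟩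
  have : j ≠ i := fun h => hi (h ▸ hj)
  simpa [Pi.single_eq_of_ne this] using mem_of_mem_nhds (ht j)

theorem GrSpace.isSmallFamily_proj (W : GrSpace.{w, u} 𝕜) :
    IsSmallFamily fun n => (W.proj n : W.carrier →ₗ[𝕜] W.carrier) := by
  intro U hU
  rw [W.isInducing_proj.nhds_eq_comap, Filter.mem_comap] at hU
  obtain ⟨T, hT, hTU⟩ := hU
  rw [nhds_pi, Filter.mem_pi'] at hT
  obtain ⟨S, t, ht, htT⟩ := hT
  refine ⟨S, fun n hn v => hTU (htT fun m hm => ?_)⟩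
  have : m ≠ n := fun h => hn (h ▸ hm)
  have h0 := mem_of_mem_nhds (ht m)
  simpa [W.proj_of_ne m n v this] using h0

end SmallFamilies

/-! ### The completed projective tensor product modulo relations. -/

section CompletedTensor

open TensorProduct

variable (E F : Type*) [AddCommGroup E] [Module 𝕜 E] [TopologicalSpace E]
  [AddCommGroup F] [Module 𝕜 F] [TopologicalSpace F]

/-- The seminorms on `E ⊗ F` that are continuous on pure tensors and vanish on the relations. -/
abbrev TensorSeminorm (R : Set (E ⊗[𝕜] F)) : Type _ :=
  {p : Seminorm 𝕜 (E ⊗[𝕜] F) // (Continuous fun z : E × F => p (z.1 ⊗ₜ z.2)) ∧ ∀ r ∈ R, p r = 0}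

/-- The space `V` with the topology of a single seminorm. -/
def WithSeminorm {V : Type*} [AddCommGroup V] [Module 𝕜 V] (_ : Seminorm 𝕜 V) : Type _ := V

noncomputable instance {V : Type*} [AddCommGroup V] [Module 𝕜 V] (p : Seminorm 𝕜 V) :
    SeminormedAddCommGroup (WithSeminorm p) :=
  AddGroupSeminorm.toSeminormedAddCommGroup (E := V) p.toAddGroupSeminorm

noncomputable instance {V : Type*} [AddCommGroup V] [Module 𝕜 V] (p : Seminorm 𝕜 V) :
    Module 𝕜 (WithSeminorm p) := inferInstanceAs (Module 𝕜 V)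

noncomputable instance {V : Type*} [AddCommGroup V] [Module 𝕜 V] (p : Seminorm 𝕜 V) :
    NormedSpace 𝕜 (WithSeminorm p) where
  norm_smul_le c x := (map_smul_eq_mul p c x).le

/-- Besides serving to build the tensor product, this turns a statement `q (f t) = 0` into the
vanishing of a continuous linear map with complete Hausdorff target. Such a statement can then be
checked on pure tensors. -/
noncomputable def toSeminormCompletion {V : Type*} [AddCommGroup V] [Module 𝕜 V]
    (p : Seminorm 𝕜 V) : V →ₗ[𝕜] UniformSpace.Completion (WithSeminorm p) where
  toFun v := ((show WithSeminorm p from v : WithSeminorm p) :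
    UniformSpace.Completion (WithSeminorm p))
  map_add' v w := UniformSpace.Completion.coe_add (α := WithSeminorm p) v w
  map_smul' c v := UniformSpace.Completion.coe_smul (X := WithSeminorm p) c v

theorem norm_toSeminormCompletion {V : Type*} [AddCommGroup V] [Module 𝕜 V]
    (p : Seminorm 𝕜 V) (v : V) : ‖toSeminormCompletion p v‖ = p v :=
  UniformSpace.Completion.norm_coe (E := WithSeminorm p) v

variable {E F}
variable (R : Set (E ⊗[𝕜] F))

noncomputable def tensorToPi : E ⊗[𝕜] F →ₗ[𝕜]
    ∀ p : TensorSeminorm E F R, UniformSpace.Completion (WithSeminorm p.1) :=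
  LinearMap.pi fun p => toSeminormCompletion p.1

/-- The completed projective tensor product of `E` and `F` modulo the relations `R`. -/
noncomputable abbrev CTensor : Submodule 𝕜
    (∀ p : TensorSeminorm E F R, UniformSpace.Completion (WithSeminorm p.1)) :=
  (LinearMap.range (tensorToPi R)).topologicalClosure

noncomputable def CTensor.of : E ⊗[𝕜] F →ₗ[𝕜] CTensor R :=
  (tensorToPi R).codRestrict _ fun x => Submodule.le_topologicalClosure _ ⟨x, rfl⟩

noncomputable def CTensor.mk : E →ₗ[𝕜] F →ₗ[𝕜] CTensor R :=
  (TensorProduct.mk 𝕜 E F).compr₂ (CTensor.of R)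

instance : CompleteSpace (CTensor R) :=
  (Submodule.isClosed_topologicalClosure _).completeSpace_coe

instance : IsUniformAddGroup (CTensor R) :=
  (CTensor R).toAddSubgroup.isUniformAddGroup

variable {R}

theorem CTensor.denseRange_of : DenseRange (CTensor.of R) := by
  intro z
  rw [Topology.IsInducing.subtypeVal.closure_eq_preimage_closure_image, Set.mem_preimage]
  have : (Subtype.val '' Set.range (CTensor.of R)) = (LinearMap.range (tensorToPi R) : Set _) := by
    ext y
    simp only [Set.mem_image, Set.mem_range, SetLike.mem_coe, LinearMap.mem_range]
    constructor
    · rintro ⟨_, ⟨x, rfl⟩, rfl⟩; exact ⟨x, rfl⟩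
    · rintro ⟨x, rfl⟩; exact ⟨_, ⟨x, rfl⟩, rfl⟩
  exact (congrArg (z.1 ∈ closure ·) this).mpr z.2

theorem CTensor.norm_of (p : TensorSeminorm E F R) (w : E ⊗[𝕜] F) :
    ‖(CTensor.of R w).1 p‖ = p.1 w := norm_toSeminormCompletion _ _

theorem CTensor.mk_relation {r : E ⊗[𝕜] F} (hr : r ∈ R) : CTensor.of R r = 0 := by
  refine Subtype.ext (funext fun p => norm_eq_zero.1 ?_)
  rw [CTensor.norm_of, p.2.2 r hr]

theorem CTensor.continuous_mk [IsTopologicalAddGroup E] [ContinuousSMul 𝕜 E]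
    [IsTopologicalAddGroup F] [ContinuousSMul 𝕜 F] :
    Continuous fun z : E × F => CTensor.mk R z.1 z.2 := by
  refine Continuous.subtype_mk (continuous_pi fun p => ?_) _
  refine (norm_withSeminorms 𝕜 _).continuous_bilinear_of_bounded ((TensorProduct.mk 𝕜 E F).compr₂
    (toSeminormCompletion p.1)) fun _ => ?_
  have h : Tendsto (fun z : E × F => p.1 (z.1 ⊗ₜ z.2)) (𝓝 (0, 0)) (𝓝 0) :=
    p.2.1.tendsto' _ _ (by simp)
  have h2 := h.eventually (Iic_mem_nhds zero_lt_one)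
  rw [nhds_prod_eq, Filter.eventually_prod_iff] at h2
  obtain ⟨a, ha, b, hb, h3⟩ := h2
  refine ⟨{x | a x}, ha, {y | b y}, hb, fun x hx y hy => ?_⟩
  exact (norm_toSeminormCompletion p.1 (x ⊗ₜ y)).trans_le (h3 hx hy)

theorem CTensor.ext {Z : Type*} [AddCommGroup Z] [Module 𝕜 Z] [TopologicalSpace Z] [T2Space Z]
    {φ ψ : CTensor R →L[𝕜] Z} (h : ∀ x y, φ (CTensor.mk R x y) = ψ (CTensor.mk R x y)) :
    φ = ψ := by
  refine ContinuousLinearMap.ext fun z => ?_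
  refine congrFun (CTensor.denseRange_of.equalizer φ.continuous ψ.continuous (funext fun w => ?_)) z
  have : φ.toLinearMap ∘ₗ CTensor.of R = ψ.toLinearMap ∘ₗ CTensor.of R :=
    TensorProduct.ext' h
  exact LinearMap.congr_fun this w

/-- The seminorm on `E ⊗ F` induced by a bilinear map and a seminorm on its target. -/
noncomputable def TensorSeminorm.comp {Z : Type*} [AddCommGroup Z] [Module 𝕜 Z]
    [TopologicalSpace Z] (γ : E →ₗ[𝕜] F →ₗ[𝕜] Z) (hγ : Continuous fun z : E × F => γ z.1 z.2)
    (hR : ∀ r ∈ R, TensorProduct.lift γ r = 0) (q : Seminorm 𝕜 Z) (hq : Continuous q) :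
    TensorSeminorm E F R :=
  ⟨q.comp (TensorProduct.lift γ),
    by simpa [Function.comp_def] using hq.comp hγ, fun r hr => by simp [hR r hr]⟩

/-- The universal property of the completed tensor product. -/
theorem CTensor.exists_lift {Z : Type*} [AddCommGroup Z] [Module 𝕜 Z] [UniformSpace Z]
    [IsUniformAddGroup Z] [ContinuousSMul 𝕜 Z] [PolynormableSpace 𝕜 Z] [T2Space Z]
    [CompleteSpace Z] (γ : E →ₗ[𝕜] F →ₗ[𝕜] Z) (hγ : Continuous fun z : E × F => γ z.1 z.2)
    (hR : ∀ r ∈ R, TensorProduct.lift γ r = 0) :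
    ∃ φ : CTensor R →L[𝕜] Z, ∀ x y, φ (CTensor.mk R x y) = γ x y := by
  -- The algebraic tensor product receives the uniformity pulled back from the completion. It is
  -- dense there, so a continuous map on it extends.
  let _ : UniformSpace (E ⊗[𝕜] F) := UniformSpace.comap (CTensor.of R) inferInstance
  have hi : IsUniformInducing (CTensor.of R) := ⟨rfl⟩
  have : IsUniformAddGroup (E ⊗[𝕜] F) := hi.isUniformAddGroup (CTensor.of R)
  -- For every continuous seminorm `q` on the target, `q ∘ lift γ` is itself one of the seminorms
  -- indexing the product, hence is the norm of a coordinate.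
  have hg : Continuous (TensorProduct.lift γ) := by
    refine (PolynormableSpace.withSeminorms 𝕜 Z).continuous_of_continuous_comp _ fun q => ?_
    have : ∀ w, (q.1.comp (TensorProduct.lift γ)) w =
        ‖(CTensor.of R w).1 (TensorSeminorm.comp γ hγ hR q.1 q.2)‖ := fun w =>
      (CTensor.norm_of (TensorSeminorm.comp γ hγ hR q.1 q.2) w).symm
    have h2 : Continuous fun w => ‖(CTensor.of R w).1 (TensorSeminorm.comp γ hγ hR q.1 q.2)‖ :=
      ((continuous_apply _).comp
        (continuous_subtype_val.comp hi.isInducing.continuous)).norm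
    exact (funext this : ⇑(q.1.comp (TensorProduct.lift γ)) = _) ▸ h2
  let e : E ⊗[𝕜] F →L[𝕜] CTensor R := ⟨CTensor.of R, hi.isInducing.continuous⟩
  let f : E ⊗[𝕜] F →L[𝕜] Z := ⟨TensorProduct.lift γ, hg⟩
  refine ⟨f.extend e, fun x y => ?_⟩
  exact (f.extend_eq (e := e) CTensor.denseRange_of hi (x ⊗ₜ y)).trans (TensorProduct.lift.tmul x y)

/-- A continuous trilinear map on `E × F × L` induces a jointly continuous bilinear map on
`(E ⊗ F) × L`. -/
theorem CTensor.exists_lift_trilinear {L Z : Type*} [IsTopologicalAddGroup E] [ContinuousSMul 𝕜 E]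
    [IsTopologicalAddGroup F] [ContinuousSMul 𝕜 F]
    [AddCommGroup L] [Module 𝕜 L] [TopologicalSpace L] [IsTopologicalAddGroup L]
    [ContinuousSMul 𝕜 L] [AddCommGroup Z] [Module 𝕜 Z] [UniformSpace Z]
    [IsUniformAddGroup Z] [ContinuousSMul 𝕜 Z] [PolynormableSpace 𝕜 Z] [T2Space Z]
    [CompleteSpace Z] (τ : L →ₗ[𝕜] E →ₗ[𝕜] F →ₗ[𝕜] Z)
    (hτ : Continuous fun z : L × E × F => τ z.1 z.2.1 z.2.2)
    (hR : ∀ r ∈ R, ∀ l, TensorProduct.lift (τ l) r = 0) :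
    ∃ Θ : CTensor R →ₗ[𝕜] L →ₗ[𝕜] Z, (Continuous fun z : CTensor R × L => Θ z.1 z.2) ∧
      ∀ x y l, Θ (CTensor.mk R x y) l = τ l x y := by
  have hl : ∀ l, Continuous fun z : E × F => τ l z.1 z.2 := fun l =>
    hτ.comp (continuous_const.prodMk continuous_id)
  choose θ hθ using fun l => CTensor.exists_lift (τ l) (hl l) fun r hr => hR r hr l
  let Θ : CTensor R →ₗ[𝕜] L →ₗ[𝕜] Z := LinearMap.mk₂ 𝕜 (fun w l => θ l w)
    (fun _ _ _ => map_add _ _ _) (fun _ _ _ => map_smul _ _ _)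
    (fun w l l' => by
      have : θ (l + l') = θ l + θ l' := CTensor.ext fun x y => by simp [hθ]
      rw [this]; rfl)
    (fun c w l => by
      have : θ (c • l) = c • θ l := CTensor.ext fun x y => by simp [hθ]
      rw [this]; rfl)
  refine ⟨Θ, continuous_bilinear_of_bounded Θ fun q hq => ?_, fun x y l => hθ l x y⟩
  have h : Tendsto (fun z : L × E × F => q (τ z.1 z.2.1 z.2.2)) (𝓝 (0, 0, 0)) (𝓝 0) :=
    (hq.comp hτ).tendsto' _ _ (by simp)
  have h2 := h.eventually (Iic_mem_nhds zero_lt_one)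
  rw [nhds_prod_eq, Filter.eventually_prod_iff] at h2
  obtain ⟨a, ha, b, hb, h3⟩ := h2
  rw [nhds_prod_eq, Filter.eventually_prod_iff] at hb
  obtain ⟨b₁, hb₁, b₂, hb₂, h4⟩ := hb
  -- The supremum of these seminorms over a whole neighbourhood of the origin in `L` is finite and
  -- again an admissible tensor seminorm. It controls all `θ l` with `l` in that neighbourhood
  -- simultaneously, which gives joint rather than separate continuity.
  let P : {l | a l} → Seminorm 𝕜 (E ⊗[𝕜] F) := fun l => q.comp (TensorProduct.lift (τ l.1))
  have hbdd : BddAbove (Set.range P) := by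
    rw [Seminorm.bddAbove_range_iff]
    intro w
    induction w with
    | zero => exact ⟨0, by rintro _ ⟨l, rfl⟩; simp⟩
    | tmul x y =>
      obtain ⟨c, hc0, hc⟩ := exists_smul_mem_of_nhds (𝕜 := 𝕜) hb₁ x
      obtain ⟨d, hd0, hd⟩ := exists_smul_mem_of_nhds (𝕜 := 𝕜) hb₂ y
      refine ⟨‖c‖⁻¹ * ‖d‖⁻¹, ?_⟩
      rintro _ ⟨l, rfl⟩
      have h : q (τ l.1 (c • x) (d • y)) ≤ 1 := h3 l.2 (h4 hc hd)
      have hc' : 0 < ‖c‖ := norm_pos_iff.2 hc0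
      have hd' : 0 < ‖d‖ := norm_pos_iff.2 hd0
      simp only [LinearMap.map_smul, LinearMap.smul_apply, map_smul_eq_mul] at h
      change q (τ l.1 x y) ≤ _
      rw [← mul_inv, ← one_div, le_div_iff₀ (by positivity)]
      linarith
    | add w w' h h' =>
      obtain ⟨C, hC⟩ := h
      obtain ⟨C', hC'⟩ := h'
      refine ⟨C + C', ?_⟩
      rintro _ ⟨l, rfl⟩
      exact (map_add_le_add (P l) w w').trans (add_le_add (hC ⟨l, rfl⟩) (hC' ⟨l, rfl⟩))
  have hP : ∀ l w, P l w ≤ (⨆ l, P l) w := fun l w => (le_ciSup hbdd l) w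
  let p : TensorSeminorm E F R := by
    refine ⟨⨆ l, P l, ?_, fun r hr => ?_⟩
    · refine Continuous.norm (E := WithSeminorm (⨆ l, P l)) (f := fun z : E × F => z.1 ⊗ₜ z.2) ?_
      refine (norm_withSeminorms 𝕜 (WithSeminorm (⨆ l, P l))).continuous_bilinear_of_bounded
        (TensorProduct.mk 𝕜 E F) fun _ => ⟨{x | b₁ x}, hb₁, {y | b₂ y}, hb₂, fun x hx y hy => ?_⟩
      change (⨆ l, P l) (x ⊗ₜ y) ≤ 1
      rw [Seminorm.iSup_apply hbdd]
      exact Real.iSup_le (fun l => h3 l.2 (h4 hx hy)) zero_le_one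
    · rw [Seminorm.iSup_apply hbdd]
      refine le_antisymm (Real.iSup_le (fun l => ?_) le_rfl) (Real.iSup_nonneg fun l =>
        apply_nonneg (P l) r)
      simp [P, hR r hr]
  refine ⟨{z | ‖z.1 p‖ < 1}, ?_, {l | a l}, ha, fun w hw l hl => ?_⟩
  · have : Continuous fun z : CTensor R => ‖z.1 p‖ :=
      ((continuous_apply p).comp continuous_subtype_val).norm
    exact (this.tendsto' 0 0 (by simp)).eventually (Iio_mem_nhds zero_lt_one)
  · refine le_trans ?_ (le_of_lt hw)
    -- The estimate is a closed condition, so it passes from the algebraic tensors to the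
    -- completion.
    have hc : IsClosed {z : CTensor R | q (θ l z) ≤ ‖z.1 p‖} :=
      isClosed_le (hq.comp (θ l).continuous)
        ((continuous_apply p).comp continuous_subtype_val).norm
    refine (CTensor.denseRange_of (R := R)).induction_on (p := fun z => q (θ l z) ≤ ‖z.1 p‖) w hc
      fun v => ?_
    have e : θ l (CTensor.of R v) = TensorProduct.lift (τ l) v := by
      have : (θ l).toLinearMap ∘ₗ CTensor.of R = TensorProduct.lift (τ l) :=
        TensorProduct.ext' fun x y => (hθ l x y).trans (TensorProduct.lift.tmul x y).symm
      exact LinearMap.congr_fun this v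
    rw [e, CTensor.norm_of]
    exact hP ⟨l, hl⟩ v

end CompletedTensor

end FunctionalAnalysis

/-! ### Homogeneous maps and graded components of bilinear maps. -/

section Graded

variable {𝕜 : Type w} [RCLike 𝕜]

namespace GrSpace

theorem clm_ext (V : GrSpace.{w, u} 𝕜) {E : Type*} [AddCommGroup E] [Module 𝕜 E]
    [TopologicalSpace E] [T2Space E] {f g : V.carrier →L[𝕜] E}
    (h : ∀ n x, V.proj n x = x → f x = g x) : f = g :=
  ContinuousLinearMap.ext fun x => by
    have h1 := (V.hasSum_proj x).map f f.continuous
    have h2 := (V.hasSum_proj x).map g g.continuous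
    rw [show f ∘ (fun n => V.proj n x) = g ∘ fun n => V.proj n x from
      funext fun n => h n _ (V.proj_self n x)] at h1
    exact h1.unique h2

theorem proj_of_homog (V : GrSpace.{w, u} 𝕜) {n : ℤ} {x : V.carrier} (hx : V.proj n x = x) (m : ℤ) :
    V.proj m x = if m = n then x else 0 := by
  split_ifs with h
  · rw [h, hx]
  · rw [← hx, V.proj_of_ne _ _ _ h]

theorem linear_ext (V : GrSpace.{w, u} 𝕜) {E : Type*} [AddCommGroup E] [Module 𝕜 E]
    [TopologicalSpace E] [T2Space E] {f g : V.carrier →ₗ[𝕜] E} (hf : Continuous f)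
    (hg : Continuous g) (h : ∀ n x, V.proj n x = x → f x = g x) : f = g := by
  have : (⟨f, hf⟩ : V.carrier →L[𝕜] E) = ⟨g, hg⟩ := V.clm_ext h
  exact congrArg ContinuousLinearMap.toLinearMap this

theorem bilinear_ext (V : GrSpace.{w, u} 𝕜) (W : GrSpace.{w, v} 𝕜) {E : Type*}
    [AddCommGroup E] [Module 𝕜 E]
    [TopologicalSpace E] [T2Space E] {f g : V.carrier →ₗ[𝕜] W.carrier →ₗ[𝕜] E}
    (hf : Continuous fun p : V.carrier × W.carrier => f p.1 p.2)
    (hg : Continuous fun p : V.carrier × W.carrier => g p.1 p.2)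
    (h : ∀ m n x y, V.proj m x = x → W.proj n y = y → f x y = g x y) : f = g := by
  refine LinearMap.ext fun x => ?_
  refine W.linear_ext (hf.comp (continuous_const.prodMk continuous_id))
    (hg.comp (continuous_const.prodMk continuous_id)) fun n y hy => ?_
  have : f.flip y = g.flip y := V.linear_ext (hf.comp (continuous_id.prodMk continuous_const))
    (hg.comp (continuous_id.prodMk continuous_const)) fun m x hx => h m n x y hx hy
  exact LinearMap.congr_fun this x

theorem koszul_koszul (V : GrSpace.{w, u} 𝕜) (k l : ℤ) (x : V.carrier) :
    V.koszul k (V.koszul l x) = V.koszul (k + l) x := V.proj_ext fun n => by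
  rw [proj_koszul, proj_koszul, proj_koszul, smul_smul, add_mul, Int.negOnePow_add, Units.val_mul]

theorem koszul_of_even (V : GrSpace.{w, u} 𝕜) {k : ℤ} (hk : Even k) (x : V.carrier) :
    V.koszul k x = x := V.proj_ext fun n => by
  rw [proj_koszul, Int.negOnePow_even _ (hk.mul_right n), Units.val_one, one_smul]

@[simp]
theorem koszul_one_one (V : GrSpace.{w, u} 𝕜) (x : V.carrier) :
    V.koszul 1 (V.koszul 1 x) = x := by
  rw [koszul_koszul, koszul_of_even _ (by decide)]

/-- Homogeneous maps of degree `k`. -/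
def IsDeg (V W : GrSpace.{w, u} 𝕜) (k : ℤ) (φ : V.carrier →L[𝕜] W.carrier) : Prop :=
  ∀ n x, φ (V.proj n x) = W.proj (n + k) (φ x)

variable {V W Y : GrSpace.{w, u} 𝕜}

theorem isDeg_of_homog {k : ℤ} {φ : V.carrier →L[𝕜] W.carrier}
    (h : ∀ n x, V.proj n x = x → W.proj (n + k) (φ x) = φ x) : IsDeg V W k φ := by
  intro n x
  have : φ ∘L V.proj n = W.proj (n + k) ∘L φ := V.clm_ext fun m x hx => by
    simp only [ContinuousLinearMap.comp_apply]
    rw [V.proj_of_homog hx, W.proj_of_homog (h m x hx)]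
    by_cases e : n = m
    · simp [e]
    · simp [e]
  exact DFunLike.congr_fun this x

theorem IsDeg.homog {k : ℤ} {φ : V.carrier →L[𝕜] W.carrier} (h : IsDeg V W k φ) {n m : ℤ}
    {x : V.carrier} (hx : V.proj n x = x) (hm : m = n + k := by ring) : W.proj m (φ x) = φ x := by
  rw [hm, ← h, hx]

theorem IsDeg.comp {k l m : ℤ} {ψ : W.carrier →L[𝕜] Y.carrier} {φ : V.carrier →L[𝕜] W.carrier}
    (hψ : IsDeg W Y l ψ) (hφ : IsDeg V W k φ) (hm : m = k + l := by ring) :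
    IsDeg V Y m (ψ ∘L φ) :=
  fun n x => by simp only [ContinuousLinearMap.comp_apply]; rw [hφ, hψ, hm, add_assoc]

theorem IsDeg.add {k : ℤ} {φ ψ : V.carrier →L[𝕜] W.carrier} (hφ : IsDeg V W k φ)
    (hψ : IsDeg V W k ψ) : IsDeg V W k (φ + ψ) := fun n x => by simp [hφ n x, hψ n x]

theorem IsDeg.sub {k : ℤ} {φ ψ : V.carrier →L[𝕜] W.carrier} (hφ : IsDeg V W k φ)
    (hψ : IsDeg V W k ψ) : IsDeg V W k (φ - ψ) := fun n x => by simp [hφ n x, hψ n x]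

theorem IsDeg.zsmul {k : ℤ} {φ : V.carrier →L[𝕜] W.carrier} (hφ : IsDeg V W k φ) (c : ℤ) :
    IsDeg V W k (c • φ) := fun n x => by
  change c • φ _ = W.proj _ (c • φ x)
  rw [hφ n x, map_zsmul]

theorem IsDeg.map_koszul {k : ℤ} {φ : V.carrier →L[𝕜] W.carrier} (hφ : IsDeg V W k φ) (l : ℤ)
    (x : V.carrier) : φ (V.koszul l x) = ((l * k).negOnePow : ℤ) • W.koszul l (φ x) := by
  refine W.proj_ext fun n => ?_
  obtain ⟨m, rfl⟩ : ∃ m, n = m + k := ⟨n - k, by ring⟩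
  rw [← hφ, proj_koszul, map_zsmul, map_zsmul, proj_koszul, hφ, smul_smul, ← Units.val_mul,
    ← Int.negOnePow_add, mul_add, ← add_assoc, add_right_comm, Int.negOnePow_add (l * k + l * k),
    Int.negOnePow_even (l * k + l * k) ⟨_, rfl⟩, one_mul]

end GrSpace

theorem exists_clm_hasSum {ι X Z : Type*} [AddCommGroup X] [Module 𝕜 X] [TopologicalSpace X]
    [AddCommGroup Z] [Module 𝕜 Z] [UniformSpace Z] [IsUniformAddGroup Z] [ContinuousSMul 𝕜 Z]
    [PolynormableSpace 𝕜 Z] [CompleteSpace Z] [T2Space Z] (f : ι → X →L[𝕜] Z)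
    (h : ∀ q : Seminorm 𝕜 Z, Continuous q → ∃ S : Finset ι, ∀ i ∉ S, ∀ x, q (f i x) = 0) :
    ∃ Φ : X →L[𝕜] Z, ∀ x, HasSum (fun i => f i x) (Φ x) := by
  obtain ⟨Φ, hΦ, hs⟩ := exists_continuous_hasSum (fun i x => f i x) (fun i => (f i).continuous) h
  refine ⟨⟨⟨⟨Φ, fun x y => ?_⟩, fun c x => ?_⟩, hΦ⟩, hs⟩
  · exact (hs _).unique (by simpa using (hs x).add (hs y))
  · exact (hs _).unique (by simpa using (hs x).const_smul c)

/-- The component is `∑ₐ γ (proj a x) (proj (n - a) y)`. The sum converges because the projections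
form a small family, so a given seminorm sees only finitely many `a`. It supplies the grading of the
tensor product. -/
theorem GrSpace.exists_bilinear_degree (V W : GrSpace.{w, u} 𝕜) {Z : Type*}
    [AddCommGroup Z] [Module 𝕜 Z] [UniformSpace Z] [IsUniformAddGroup Z] [ContinuousSMul 𝕜 Z]
    [PolynormableSpace 𝕜 Z] [CompleteSpace Z] [T2Space Z]
    (γ : V.carrier →ₗ[𝕜] W.carrier →ₗ[𝕜] Z)
    (hγ : Continuous fun p : V.carrier × W.carrier => γ p.1 p.2) (n : ℤ) :
    ∃ γn : V.carrier →ₗ[𝕜] W.carrier →ₗ[𝕜] Z,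
      (Continuous fun p : V.carrier × W.carrier => γn p.1 p.2) ∧
      ∀ k l x y, V.proj k x = x → W.proj l y = y → γn x y = if n = k + l then γ x y else 0 := by
  obtain ⟨Φ, hΦ, hs⟩ := exists_continuous_hasSum (𝕜 := 𝕜)
    (fun (a : ℤ) (p : V.carrier × W.carrier) => γ (V.proj a p.1) (W.proj (n - a) p.2))
    (fun a => hγ.comp (((V.proj a).continuous.comp continuous_fst).prodMk
      ((W.proj (n - a)).continuous.comp continuous_snd))) (fun q hq => by
    obtain ⟨S, hS⟩ := V.isSmallFamily_proj.bilinear γ.flip (hγ.comp continuous_swap) q hq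
    exact ⟨S, fun a ha p => hS a ha _ p.1⟩)
  refine ⟨LinearMap.mk₂ 𝕜 (fun x y => Φ (x, y)) ?_ ?_ ?_ ?_, hΦ, ?_⟩
  · exact fun x x' y => (hs _).unique (by simpa using (hs (x, y)).add (hs (x', y)))
  · exact fun c x y => (hs _).unique (by simpa using (hs (x, y)).const_smul c)
  · exact fun x y y' => (hs _).unique (by simpa using (hs (x, y)).add (hs (x, y')))
  · exact fun c x y => (hs _).unique (by simpa using (hs (x, y)).const_smul c)
  · intro k l x y hx hy
    refine (hs (x, y)).unique ?_
    have : ∀ a, γ (V.proj a x) (W.proj (n - a) y) =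
        if a = k then (if n = k + l then γ x y else 0) else 0 := by
      intro a
      rw [V.proj_of_homog hx, W.proj_of_homog hy]
      by_cases h : a = k
      · subst h
        by_cases h' : n = a + l
        · simp [h']
        · simp [h', show n - a ≠ l by omega]
      · simp [h]
    simp only [this]
    exact hasSum_ite_eq k _

end Graded

/-! ### Right dg-modules, and pairings that present tensor products. -/

section DGModules

variable {𝕜 : Type w} [RCLike 𝕜]

open GrSpace

theorem DGAlg.d_one (A : DGAlg.{w, v} 𝕜) : A.d A.one = 0 := by
  have h := A.d_mul 0 A.one A.one A.proj_one
  rw [A.mul_one, A.mul_one, Int.negOnePow_zero, Units.val_one, one_smul, A.one_mul] at h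
  simpa using h

namespace DGBimod

variable {A : DGAlg.{w, v} 𝕜} {B : DGAlg.{w, v₂} 𝕜} (M N : DGBimod.{w, v, v₂, u} A B)

theorem isDeg_d : IsDeg M.toGrSpace M.toGrSpace 1 M.d := isDeg_of_homog M.proj_d

theorem continuous_ract_left (b : B.carrier) : Continuous fun x => M.ract x b :=
  M.continuous_ract.comp (continuous_id.prodMk continuous_const)

theorem continuous_ract_right (x : M.carrier) : Continuous fun b => M.ract x b :=
  M.continuous_ract.comp (continuous_const.prodMk continuous_id)

theorem continuous_lact_left (x : M.carrier) : Continuous fun a => M.lact a x :=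
  M.continuous_lact.comp (continuous_id.prodMk continuous_const)

theorem continuous_lact_right (a : A.carrier) : Continuous fun x => M.lact a x :=
  M.continuous_lact.comp (continuous_const.prodMk continuous_id)

/-- The right action of a fixed element. -/
noncomputable def ractCLM (b : B.carrier) : M.carrier →L[𝕜] M.carrier :=
  ⟨M.ract.flip b, M.continuous_ract_left b⟩

@[simp] theorem ractCLM_apply (b : B.carrier) (x : M.carrier) : M.ractCLM b x = M.ract x b := rfl

/-- With the Koszul operator in place of the sign `(-1)ⁿ`, the Leibniz rule holds for all elements
and not only for homogeneous ones. By continuity it needs checking on homogeneous elements alone.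
Later sign computations are carried out in this form. -/
theorem d_ract' (x : M.carrier) (b : B.carrier) :
    M.d (M.ract x b) = M.ract (M.d x) b + M.ract (M.koszul 1 x) (B.d b) := by
  have : M.d ∘L M.ractCLM b = M.ractCLM b ∘L M.d + M.ractCLM (B.d b) ∘L M.koszul 1 :=
    M.clm_ext fun n x hx => by
      simp only [ContinuousLinearMap.comp_apply, add_apply, ractCLM_apply]
      rw [M.d_ract n x b hx, M.koszul_of_homog 1 n x hx, one_mul, map_zsmul, LinearMap.smul_apply]
  exact DFunLike.congr_fun this x

theorem d_lact' (a : A.carrier) (x : M.carrier) :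
    M.d (M.lact a x) = M.lact (A.d a) x + M.lact (A.koszul 1 a) (M.d x) := by
  have : M.d.toLinearMap ∘ₗ M.lact.flip x =
      M.lact.flip x ∘ₗ A.d.toLinearMap + M.lact.flip (M.d x) ∘ₗ (A.koszul 1).toLinearMap := by
    refine A.linear_ext (M.d.continuous.comp (M.continuous_lact_left x))
      (((M.continuous_lact_left x).comp A.d.continuous).add
        ((M.continuous_lact_left _).comp (A.koszul 1).continuous)) fun n a ha => ?_
    change M.d (M.lact a x) = M.lact (A.d a) x + M.lact (A.koszul 1 a) (M.d x)
    rw [M.d_lact n a x ha, A.koszul_of_homog 1 n a ha, one_mul, map_zsmul, LinearMap.smul_apply]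
  exact LinearMap.congr_fun this a

theorem koszul_ract (k : ℤ) (x : M.carrier) (b : B.carrier) :
    M.koszul k (M.ract x b) = M.ract (M.koszul k x) (B.koszul k b) := by
  have : (M.ract.compr₂ (M.koszul k).toLinearMap) =
      M.ract.compl₁₂ (M.koszul k).toLinearMap (B.koszul k).toLinearMap := by
    refine bilinear_ext M.toGrSpace B.toGrSpace
      ((M.koszul k).continuous.comp M.continuous_ract)
      (M.continuous_ract.comp ((M.koszul k).continuous.prodMap (B.koszul k).continuous))
      fun m n x b hx hb => ?_
    change M.koszul k (M.ract x b) = M.ract (M.koszul k x) (B.koszul k b)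
    rw [M.koszul_of_homog k m x hx, B.koszul_of_homog k n b hb,
      M.koszul_of_homog k (m + n) _ (M.proj_ract m n x b hx hb), map_zsmul, map_zsmul,
      LinearMap.smul_apply, smul_smul, mul_add, Int.negOnePow_add, Units.val_mul, mul_comm]
  exact LinearMap.congr_fun₂ this x b

theorem d_koszul (x : M.carrier) : M.d (M.koszul 1 x) = -M.koszul 1 (M.d x) := by
  rw [M.isDeg_d.map_koszul]; simp

end DGBimod

namespace RightDGMod

variable {A : DGAlg.{w, v} 𝕜}

/-- An element of the ground dg-algebra, as a scalar. -/
def scalar (c : (DGAlg.ground 𝕜).carrier) : 𝕜 := c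

/-- Linearity and the unit axiom force the left action of the ground field, so the left structure of
a right module carries no information. -/
theorem lact_eq_smul (M : GrBimod.{w, w, v, u} (DGAlg.ground 𝕜).toGrAlg A.toGrAlg)
    (c : (DGAlg.ground 𝕜).carrier) (x : M.carrier) : M.lact c x = scalar c • x := by
  have h := M.lact.map_smul (scalar c) (DGAlg.ground 𝕜).one
  have e : scalar c • (DGAlg.ground 𝕜).one = c := mul_one (scalar c)
  rw [e] at h
  rw [h, LinearMap.smul_apply]
  exact congrArg (scalar c • ·) (M.one_lact x)

theorem scalar_eq_zero {n : ℤ} (hn : n ≠ 0) {c : (DGAlg.ground 𝕜).carrier}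
    (hc : (DGAlg.ground 𝕜).proj n c = c) : scalar c = 0 := by
  have : (DGAlg.ground 𝕜).proj n = 0 := if_neg hn
  rw [← hc, this]
  rfl

/-- A right dg-module from a graded space with a right action and a differential. -/
noncomputable abbrev ofRight (V : GrSpace.{w, u} 𝕜)
    (ract : V.carrier →ₗ[𝕜] A.carrier →ₗ[𝕜] V.carrier)
    (continuous_ract : Continuous fun p : V.carrier × A.carrier => ract p.1 p.2)
    (ract_one : ∀ x, ract x A.one = x)
    (ract_mul : ∀ x a b, ract x (A.mul a b) = ract (ract x a) b)
    (proj_ract : ∀ m n x b, V.proj m x = x → A.proj n b = b →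
      V.proj (m + n) (ract x b) = ract x b)
    (d : V.carrier →L[𝕜] V.carrier)
    (proj_d : ∀ n x, V.proj n x = x → V.proj (n + 1) (d x) = d x)
    (d_d : ∀ x, d (d x) = 0)
    (d_ract : ∀ n x b, V.proj n x = x →
      d (ract x b) = ract (d x) b + (n.negOnePow : ℤ) • ract x (A.d b)) :
    RightDGMod.{w, v, u} A where
  toGrSpace := V
  lact := LinearMap.lsmul 𝕜 V.carrier
  ract := ract
  continuous_lact := continuous_smul (M := 𝕜) (X := V.carrier)
  continuous_ract := continuous_ract
  one_lact x := one_smul 𝕜 x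
  ract_one := ract_one
  mul_lact a b x := mul_smul (α := 𝕜) a b x
  ract_mul := ract_mul
  lact_ract a x b := by
    change ract (scalar a • x) b = scalar a • ract x b
    rw [map_smul, LinearMap.smul_apply]
  proj_lact m n a x ha hx := by
    change V.proj (m + n) (scalar a • x) = scalar a • x
    by_cases hm : m = 0
    · rw [hm, zero_add, map_smul, hx]
    · rw [scalar_eq_zero hm ha, zero_smul, map_zero]
  proj_ract := proj_ract
  d := d
  proj_d := proj_d
  d_d := d_d
  d_lact n a x ha := by
    change d (scalar a • x) = (0 : 𝕜) • x + (n.negOnePow : ℤ) • (scalar a • d x)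
    rw [zero_smul, zero_add, map_smul]
    by_cases hm : n = 0
    · rw [hm, Int.negOnePow_zero, Units.val_one, one_smul]
    · rw [scalar_eq_zero hm ha, zero_smul, smul_zero]
  d_ract := d_ract

/-- Morphisms of right modules automatically commute with scalars. -/
noncomputable abbrev mkGrHom
    {M N : GrBimod.{w, w, v, u} (DGAlg.ground 𝕜).toGrAlg A.toGrAlg} (φ : M.carrier →L[𝕜] N.carrier)
    (map_proj : ∀ n x, φ (M.proj n x) = N.proj n (φ x))
    (map_ract : ∀ x b, φ (M.ract x b) = N.ract (φ x) b) : M.Hom N where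
  toCLM := φ
  map_proj := map_proj
  map_lact a x := by rw [lact_eq_smul, lact_eq_smul, map_smul]
  map_ract := map_ract

noncomputable abbrev mkHom {M N : RightDGMod.{w, v, u} A} (φ : M.carrier →L[𝕜] N.carrier)
    (map_proj : ∀ n x, φ (M.proj n x) = N.proj n (φ x))
    (map_ract : ∀ x b, φ (M.ract x b) = N.ract (φ x) b)
    (map_d : ∀ x, φ (M.d x) = N.d (φ x)) : M.Hom N where
  toHom := mkGrHom φ map_proj map_ract
  map_d := map_d

/-- The sign condition for the left action is automatic: the ground field has no nonzero elements
outside degree `0`, and in degree `0` the sign is trivial. -/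
theorem homotopic_of {M N : RightDGMod.{w, v, u} A} {f g : M.Hom N}
    (h : M.carrier →L[𝕜] N.carrier) (hdeg : IsDeg M.toGrSpace N.toGrSpace (-1) h)
    (hract : ∀ x b, h (M.ract x b) = N.ract (h x) b)
    (hd : ∀ x, f.toCLM x - g.toCLM x = N.d (h x) + h (M.d x)) : DGBimod.Homotopic f g := by
  refine ⟨h, fun n x hx => hdeg.homog hx, fun n a x ha => ?_, hract, hd⟩
  rw [lact_eq_smul, lact_eq_smul, map_smul]
  by_cases hm : n = 0
  · rw [hm, Int.negOnePow_zero, Units.val_one, one_smul]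
  · rw [scalar_eq_zero hm ha, zero_smul, smul_zero]

theorem _root_.ClctDG.GrBimod.Hom.isDeg {A : GrAlg.{w, v} 𝕜} {B : GrAlg.{w, v₂} 𝕜}
    {M N : GrBimod.{w, v, v₂, u} A B} (f : M.Hom N) :
    IsDeg M.toGrSpace N.toGrSpace 0 f.toCLM := fun n x => by
  rw [f.map_proj, add_zero]

theorem _root_.ClctDG.GrBimod.Hom.map_koszul {A : GrAlg.{w, v} 𝕜} {B : GrAlg.{w, v₂} 𝕜}
    {M N : GrBimod.{w, v, v₂, u} A B} (f : M.Hom N) (k : ℤ) (x : M.carrier) :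
    f.toCLM (M.koszul k x) = N.koszul k (f.toCLM x) := by
  rw [f.isDeg.map_koszul]; simp

end RightDGMod

/-- `T` with `β` is the tensor product of `P` and `N` over `A`. -/
structure IsTens {A : DGAlg.{w, v} 𝕜} {B : DGAlg.{w, v₂} 𝕜} (P : RightDGMod.{w, v, u} A)
    (N : DGBimod.{w, v, v₂, u} A B) (T : RightDGMod.{w, v₂, u} B)
    (β : P.carrier →ₗ[𝕜] N.carrier →ₗ[𝕜] T.carrier) : Prop where
  continuous : Continuous fun p : P.carrier × N.carrier => β p.1 p.2
  balanced : ∀ x a y, β (P.ract x a) y = β x (N.lact a y)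
  proj : ∀ m n x y, P.proj m x = x → N.proj n y = y → T.proj (m + n) (β x y) = β x y
  d : ∀ x y, T.d (β x y) = β (P.d x) y + β (P.koszul 1 x) (N.d y)
  ract : ∀ x y b, T.ract (β x y) b = β x (N.ract y b)
  exists_lift : ∀ (Z : Type u) [AddCommGroup Z] [Module 𝕜 Z] [UniformSpace Z]
    [IsUniformAddGroup Z] [ContinuousSMul 𝕜 Z] [PolynormableSpace 𝕜 Z] [T2Space Z]
    [CompleteSpace Z] (γ : P.carrier →ₗ[𝕜] N.carrier →ₗ[𝕜] Z),
    (Continuous fun p : P.carrier × N.carrier => γ p.1 p.2) →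
    (∀ x a y, γ (P.ract x a) y = γ x (N.lact a y)) →
    ∃ φ : T.carrier →L[𝕜] Z, ∀ x y, φ (β x y) = γ x y
  ext : ∀ (Z : Type u) [AddCommGroup Z] [Module 𝕜 Z] [UniformSpace Z]
    [IsUniformAddGroup Z] [ContinuousSMul 𝕜 Z] [PolynormableSpace 𝕜 Z] [T2Space Z]
    [CompleteSpace Z] (φ ψ : T.carrier →L[𝕜] Z), (∀ x y, φ (β x y) = ψ (β x y)) → φ = ψ

/-- The variant `IsTens` writes the differential with the Koszul operator, separates existence from
uniqueness in the universal property, and allows the two algebras to live in different universes.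
The last point is needed for tensor products over the ground field. -/
theorem isCompletedTensor_iff {A B : DGAlg.{w, u} 𝕜} {P : RightDGMod.{w, u, u} A}
    {N : DGBimod.{w, u, u, u} A B} {T : RightDGMod.{w, u, u} B}
    {β : P.carrier →ₗ[𝕜] N.carrier →ₗ[𝕜] T.carrier} :
    IsCompletedTensor P N T β ↔ IsTens P N T β := by
  constructor
  · intro h
    refine ⟨h.continuous, h.balanced, h.proj, fun x y => ?_, h.ract, fun Z => ?_, fun Z => ?_⟩
    · have cl : ∀ y, Continuous fun x => β x y := fun y =>
        h.continuous.comp (continuous_id.prodMk continuous_const)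
      have : T.d.toLinearMap ∘ₗ β.flip y = β.flip y ∘ₗ P.d.toLinearMap +
          β.flip (N.d y) ∘ₗ (P.koszul 1).toLinearMap := by
        refine P.linear_ext (T.d.continuous.comp (cl y)) (((cl y).comp P.d.continuous).add
          ((cl _).comp (P.koszul 1).continuous)) fun n x hx => ?_
        refine (h.d n x y hx).trans ?_
        change _ = β (P.d x) y + β (P.koszul 1 x) (N.d y)
        rw [P.koszul_of_homog 1 n x hx, one_mul, map_zsmul, LinearMap.smul_apply]
      exact LinearMap.congr_fun this x
    · intros
      exact (h.exists_unique_lift Z _ ‹_› ‹_›).exists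
    · intro _ _ _ _ _ _ _ _ φ ψ e
      refine (h.exists_unique_lift Z (β.compr₂ ψ.toLinearMap) (ψ.continuous.comp h.continuous)
        fun x a y => congrArg ψ (h.balanced x a y)).unique e fun x y => rfl
  · intro h
    refine ⟨h.continuous, h.balanced, h.proj, fun n x y hx => ?_, h.ract, fun Z => ?_⟩
    · rw [h.d, P.koszul_of_homog 1 n x hx, one_mul, map_zsmul, LinearMap.smul_apply]
    · intro _ _ _ _ _ _ _ _ γ hγ hb
      obtain ⟨φ, hφ⟩ := h.exists_lift Z γ hγ hb
      exact ⟨φ, hφ, fun ψ hψ => h.ext Z _ _ fun x y => by rw [hφ, hψ]⟩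

/-! ### Existence of the tensor product: the underlying graded space. -/

section Existence

open TensorProduct

variable {A : DGAlg.{w, v} 𝕜} {B : DGAlg.{w, v₂} 𝕜} (P : RightDGMod.{w, v, u} A)
    (N : DGBimod.{w, v, v₂, u} A B)

/-- The relations of the tensor product over `A`. -/
def tensRel : Set (P.carrier ⊗[𝕜] N.carrier) :=
  {r | ∃ x a y, r = P.ract x a ⊗ₜ y - x ⊗ₜ N.lact a y}

/-- The underlying space of the tensor product over `A`. -/
def TensSpace : Type u := CTensor (tensRel P N)

noncomputable instance : AddCommGroup (TensSpace P N) :=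
  inferInstanceAs (AddCommGroup (CTensor (tensRel P N)))

noncomputable instance : Module 𝕜 (TensSpace P N) :=
  inferInstanceAs (Module 𝕜 (CTensor (tensRel P N)))

noncomputable instance : UniformSpace (TensSpace P N) :=
  inferInstanceAs (UniformSpace (CTensor (tensRel P N)))

instance : IsUniformAddGroup (TensSpace P N) :=
  inferInstanceAs (IsUniformAddGroup (CTensor (tensRel P N)))

instance : ContinuousSMul 𝕜 (TensSpace P N) :=
  inferInstanceAs (ContinuousSMul 𝕜 (CTensor (tensRel P N)))

instance : PolynormableSpace 𝕜 (TensSpace P N) :=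
  inferInstanceAs (PolynormableSpace 𝕜 (CTensor (tensRel P N)))

instance : T2Space (TensSpace P N) :=
  inferInstanceAs (T2Space (CTensor (tensRel P N)))

instance : CompleteSpace (TensSpace P N) :=
  inferInstanceAs (CompleteSpace (CTensor (tensRel P N)))

noncomputable def tensMk : P.carrier →ₗ[𝕜] N.carrier →ₗ[𝕜] TensSpace P N :=
  CTensor.mk (tensRel P N)

variable {P N}

theorem continuous_tensMk : Continuous fun p : P.carrier × N.carrier => tensMk P N p.1 p.2 :=
  CTensor.continuous_mk (R := tensRel P N)

theorem tensMk_balanced (x : P.carrier) (a : A.carrier) (y : N.carrier) :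
    tensMk P N (P.ract x a) y = tensMk P N x (N.lact a y) := by
  have := CTensor.mk_relation (R := tensRel P N) ⟨x, a, y, rfl⟩
  rw [map_sub, sub_eq_zero] at this
  exact this

section

variable {Z : Type*} [AddCommGroup Z] [Module 𝕜 Z] [UniformSpace Z]
    [IsUniformAddGroup Z] [ContinuousSMul 𝕜 Z] [PolynormableSpace 𝕜 Z] [T2Space Z]
    [CompleteSpace Z]

theorem tensMk_lift (γ : P.carrier →ₗ[𝕜] N.carrier →ₗ[𝕜] Z)
    (hγ : Continuous fun p : P.carrier × N.carrier => γ p.1 p.2)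
    (hb : ∀ x a y, γ (P.ract x a) y = γ x (N.lact a y)) :
    ∃ φ : TensSpace P N →L[𝕜] Z, ∀ x y, φ (tensMk P N x y) = γ x y := by
  refine CTensor.exists_lift (R := tensRel P N) γ hγ ?_
  rintro _ ⟨x, a, y, rfl⟩
  simp [hb]

theorem tensMk_lift_trilinear {L : Type*} [AddCommGroup L] [Module 𝕜 L] [TopologicalSpace L]
    [IsTopologicalAddGroup L] [ContinuousSMul 𝕜 L]
    (τ : L →ₗ[𝕜] P.carrier →ₗ[𝕜] N.carrier →ₗ[𝕜] Z)
    (hτ : Continuous fun z : L × P.carrier × N.carrier => τ z.1 z.2.1 z.2.2)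
    (hb : ∀ l x a y, τ l (P.ract x a) y = τ l x (N.lact a y)) :
    ∃ Θ : TensSpace P N →ₗ[𝕜] L →ₗ[𝕜] Z, (Continuous fun z : TensSpace P N × L => Θ z.1 z.2) ∧
      ∀ x y l, Θ (tensMk P N x y) l = τ l x y := by
  refine CTensor.exists_lift_trilinear (R := tensRel P N) τ hτ ?_
  rintro _ ⟨x, a, y, rfl⟩ l
  simp [hb]

theorem tensMk_ext {Z : Type*} [AddCommGroup Z] [Module 𝕜 Z] [TopologicalSpace Z] [T2Space Z]
    {φ ψ : TensSpace P N →L[𝕜] Z}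
    (h : ∀ m n x y, P.proj m x = x → N.proj n y = y →
      φ (tensMk P N x y) = ψ (tensMk P N x y)) : φ = ψ := by
  refine CTensor.ext (R := tensRel P N) fun x y => ?_
  have := bilinear_ext P.toGrSpace N.toGrSpace (f := (tensMk P N).compr₂ φ.toLinearMap)
    (g := (tensMk P N).compr₂ ψ.toLinearMap) (φ.continuous.comp continuous_tensMk)
    (ψ.continuous.comp continuous_tensMk) h
  exact LinearMap.congr_fun₂ this x y

end

attribute [irreducible] tensMk

/-- The degree-`n` part of the universal pairing is still balanced: for homogeneous `x`, `a`, `y`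
both `xa ⊗ y` and `x ⊗ ay` have the total degree of the three, and continuity extends this to all
elements. -/
theorem exists_tensProj (n : ℤ) : ∃ φ : TensSpace P N →L[𝕜] TensSpace P N,
    ∀ k l x y, P.proj k x = x → N.proj l y = y →
      φ (tensMk P N x y) = if n = k + l then tensMk P N x y else 0 := by
  obtain ⟨γ, hγ, h⟩ := exists_bilinear_degree P.toGrSpace N.toGrSpace (tensMk P N)
    continuous_tensMk n
  obtain ⟨φ, hφ⟩ := tensMk_lift γ hγ fun x a y => by
    have h1 : ∀ y, Continuous fun x => γ x y := fun y =>
      hγ.comp (continuous_id.prodMk continuous_const)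
    have h2 : ∀ x, Continuous fun y => γ x y := fun x =>
      hγ.comp (continuous_const.prodMk continuous_id)
    have e1 : γ.flip y ∘ₗ P.ract x = γ x ∘ₗ N.lact.flip y := by
      refine A.linear_ext ((h1 y).comp (P.continuous_ract_right x))
        ((h2 x).comp (N.continuous_lact_left y)) fun j a ha => ?_
      have e2 : γ.compl₁₂ (P.ract.flip a) LinearMap.id =
          γ.compl₁₂ LinearMap.id (N.lact a) := by
        refine bilinear_ext P.toGrSpace N.toGrSpace
          (hγ.comp ((P.continuous_ract_left a).prodMap continuous_id))
          (hγ.comp (continuous_id.prodMap (N.continuous_lact_right a))) fun k l x y hx hy => ?_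
        change γ (P.ract x a) y = γ x (N.lact a y)
        rw [h _ _ _ _ (P.proj_ract _ _ _ _ hx ha) hy, h _ _ _ _ hx (N.proj_lact _ _ _ _ ha hy),
          tensMk_balanced, add_assoc]
      exact LinearMap.congr_fun₂ e2 x y
    exact LinearMap.congr_fun e1 a
  exact ⟨φ, fun k l x y hx hy => by rw [hφ, h k l x y hx hy]⟩

variable (P N) in
noncomputable def tensProj (n : ℤ) : TensSpace P N →L[𝕜] TensSpace P N :=
  (exists_tensProj n).choose

theorem tensProj_mk {k l : ℤ} {x : P.carrier} {y : N.carrier} (hx : P.proj k x = x)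
    (hy : N.proj l y = y) (n : ℤ) :
    tensProj P N n (tensMk P N x y) = if n = k + l then tensMk P N x y else 0 :=
  (exists_tensProj n).choose_spec k l x y hx hy

theorem tensProj_self (n : ℤ) (t : TensSpace P N) :
    tensProj P N n (tensProj P N n t) = tensProj P N n t := by
  have : tensProj P N n ∘L tensProj P N n = tensProj P N n := tensMk_ext fun k l x y hx hy => by
    rw [ContinuousLinearMap.comp_apply, tensProj_mk hx hy]
    split_ifs with h
    · rw [tensProj_mk hx hy, if_pos h]
    · rw [map_zero]
  exact DFunLike.congr_fun this t

theorem tensProj_of_ne {m n : ℤ} (hmn : m ≠ n) (t : TensSpace P N) :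
    tensProj P N m (tensProj P N n t) = 0 := by
  have : tensProj P N m ∘L tensProj P N n = 0 := tensMk_ext fun k l x y hx hy => by
    rw [ContinuousLinearMap.comp_apply, tensProj_mk hx hy]
    split_ifs with h
    · rw [tensProj_mk hx hy, if_neg (h ▸ hmn)]; rfl
    · rw [map_zero]; rfl
  exact DFunLike.congr_fun this t

theorem continuous_toSeminormCompletion {V : Type*} [AddCommGroup V] [Module 𝕜 V]
    [TopologicalSpace V] [IsTopologicalAddGroup V] (q : Seminorm 𝕜 V) (hq : Continuous q) :
    Continuous (toSeminormCompletion q) := by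
  refine (norm_withSeminorms 𝕜 _).continuous_of_continuous_comp _ fun _ => ?_
  exact (funext (norm_toSeminormCompletion q) :
    ⇑((normSeminorm 𝕜 _).comp (toSeminormCompletion q)) = q) ▸ hq

/-- A pure tensor of bidegree `(k, l)` is seen by `q` only if `k` and `l` both lie in finite sets,
so only finitely many sums `k + l` matter. Composing with the completion for `q` reduces the claim
to pure tensors. -/
theorem tensProj_small (q : Seminorm 𝕜 (TensSpace P N)) (hq : Continuous q) :
    ∃ S : Finset ℤ, ∀ n ∉ S, ∀ t, q (tensProj P N n t) = 0 := by
  obtain ⟨S₁, h1⟩ := P.isSmallFamily_proj.bilinear (tensMk P N).flip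
    (continuous_tensMk.comp continuous_swap) q hq
  obtain ⟨S₂, h2⟩ := N.isSmallFamily_proj.bilinear (tensMk P N) continuous_tensMk q hq
  refine ⟨Finset.image₂ (· + ·) S₁ S₂, fun n hn t => ?_⟩
  have : (⟨toSeminormCompletion q, continuous_toSeminormCompletion q hq⟩ :
      TensSpace P N →L[𝕜] _) ∘L tensProj P N n = 0 := tensMk_ext fun k l x y hx hy => by
    refine norm_eq_zero.1 ((norm_toSeminormCompletion q _).trans ?_)
    change q (tensProj P N n (tensMk P N x y)) = 0
    rw [tensProj_mk hx hy]
    split_ifs with h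
    · by_cases hk : k ∈ S₁
      · by_cases hl : l ∈ S₂
        · exact absurd (h ▸ Finset.mem_image₂_of_mem hk hl) hn
        · have := h2 l hl x y
          rwa [ContinuousLinearMap.coe_coe, hy] at this
      · have := h1 k hk y x
        rwa [ContinuousLinearMap.coe_coe, hx] at this
    · exact map_zero q
  rw [← norm_toSeminormCompletion q]
  exact norm_eq_zero.2 (DFunLike.congr_fun this t)

theorem exists_tensSum : ∃ Φ : (ℤ → TensSpace P N) →L[𝕜] TensSpace P N,
    ∀ f, HasSum (fun n => tensProj P N n (f n)) (Φ f) :=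
  exists_clm_hasSum (fun n => tensProj P N n ∘L ContinuousLinearMap.proj n) fun q hq => by
    obtain ⟨S, hS⟩ := tensProj_small q hq
    exact ⟨S, fun n hn f => hS n hn (f n)⟩

variable (P N)

/-- The summation map of `exists_tensSum` is a continuous left inverse of the family of projections.
Hence that family is an embedding, and any family of homogeneous components is assembled by the same
map. -/
noncomputable abbrev tensGr : GrSpace.{w, u} 𝕜 where
  carrier := TensSpace P N
  proj := tensProj P N
  proj_self := tensProj_self
  proj_of_ne m n x h := tensProj_of_ne h x
  isInducing_proj := by
    obtain ⟨Φ, hΦ⟩ := exists_tensSum (P := P) (N := N)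
    have : Φ ∘L ContinuousLinearMap.pi (tensProj P N) = ContinuousLinearMap.id 𝕜 _ :=
      tensMk_ext fun k l x y hx hy => by
        refine (hΦ _).unique ?_
        change HasSum (fun n => tensProj P N n (tensProj P N n (tensMk P N x y))) (tensMk P N x y)
        simp only [tensProj_self]
        simp only [tensProj_mk hx hy]
        exact hasSum_ite_eq (k + l) (tensMk P N x y)
    exact (Function.LeftInverse.isEmbedding (f := Φ)
      (g := fun t n => tensProj P N n t) (DFunLike.congr_fun this) Φ.continuous
      (continuous_pi fun n => (tensProj P N n).continuous)).isInducing
  exists_of_proj f hf := by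
    obtain ⟨Φ, hΦ⟩ := exists_tensSum (P := P) (N := N)
    refine ⟨Φ f, fun m => ?_⟩
    refine ((hΦ f).map (tensProj P N m) (tensProj P N m).continuous).unique ?_
    have : (tensProj P N m ∘ fun n => tensProj P N n (f n)) =
        fun n => if n = m then f m else 0 := by
      funext n
      simp only [Function.comp_apply]
      split_ifs with h
      · rw [h, hf, hf]
      · exact tensProj_of_ne (Ne.symm h) _
    rw [this]
    exact hasSum_ite_eq m _

end Existence

end DGModules

/-! ### The action and the differential on the tensor product. -/

section DGModules

variable {𝕜 : Type w} [RCLike 𝕜]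

open GrSpace

section Existence

open TensorProduct

variable {A : DGAlg.{w, v} 𝕜} {B : DGAlg.{w, v₂} 𝕜} {P : RightDGMod.{w, v, u} A}
    {N : DGBimod.{w, v, v₂, u} A B}

/-- The action has to be jointly continuous in the tensor and in `b`. Lifting for each `b`
separately would not give this, so the trilinear universal property is used. -/
theorem exists_tensRact : ∃ ρ : TensSpace P N →ₗ[𝕜] B.carrier →ₗ[𝕜] TensSpace P N,
    (Continuous fun p : TensSpace P N × B.carrier => ρ p.1 p.2) ∧
    ∀ x y b, ρ (tensMk P N x y) b = tensMk P N x (N.ract y b) := by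
  let τ : B.carrier →ₗ[𝕜] P.carrier →ₗ[𝕜] N.carrier →ₗ[𝕜] TensSpace P N :=
    { toFun := fun b => (tensMk P N).compl₂ (N.ract.flip b)
      map_add' := fun b b' => by ext; simp
      map_smul' := fun c b => by ext; simp }
  refine tensMk_lift_trilinear τ ?_ fun b x a y => ?_
  · exact continuous_tensMk.comp ((continuous_fst.comp continuous_snd).prodMk
      (N.continuous_ract.comp ((continuous_snd.comp continuous_snd).prodMk continuous_fst)))
  · change tensMk P N (P.ract x a) (N.ract y b) = tensMk P N x (N.ract (N.lact a y) b)
    rw [tensMk_balanced, N.lact_ract]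

variable (P N) in
noncomputable def tensRact : TensSpace P N →ₗ[𝕜] B.carrier →ₗ[𝕜] TensSpace P N :=
  exists_tensRact.choose

theorem continuous_tensRact :
    Continuous fun p : TensSpace P N × B.carrier => tensRact P N p.1 p.2 :=
  exists_tensRact.choose_spec.1

theorem tensRact_mk (x : P.carrier) (y : N.carrier) (b : B.carrier) :
    tensRact P N (tensMk P N x y) b = tensMk P N x (N.ract y b) :=
  exists_tensRact.choose_spec.2 x y b

/-- Each of the two summands alone fails to be balanced. On `xa ⊗ y` and `x ⊗ ay` the terms
containing `da` sit in different summands, and they agree. -/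
theorem exists_tensD : ∃ δ : TensSpace P N →L[𝕜] TensSpace P N, ∀ x y,
    δ (tensMk P N x y) = tensMk P N (P.d x) y + tensMk P N (P.koszul 1 x) (N.d y) := by
  refine tensMk_lift ((tensMk P N).compl₁₂ P.d.toLinearMap LinearMap.id +
    (tensMk P N).compl₁₂ (P.koszul 1).toLinearMap N.d.toLinearMap) ?_ fun x a y => ?_
  · exact (continuous_tensMk.comp (P.d.continuous.prodMap continuous_id)).add
      (continuous_tensMk.comp ((P.koszul 1).continuous.prodMap N.d.continuous))
  · change tensMk P N (P.d (P.ract x a)) y + tensMk P N (P.koszul 1 (P.ract x a)) (N.d y) =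
      tensMk P N (P.d x) (N.lact a y) + tensMk P N (P.koszul 1 x) (N.d (N.lact a y))
    rw [P.d_ract', P.koszul_ract, N.d_lact', LinearMap.map_add₂, LinearMap.map_add,
      tensMk_balanced, tensMk_balanced, tensMk_balanced, add_assoc]

variable (P N) in
noncomputable def tensD : TensSpace P N →L[𝕜] TensSpace P N := exists_tensD.choose

theorem tensD_mk (x : P.carrier) (y : N.carrier) : tensD P N (tensMk P N x y) =
    tensMk P N (P.d x) y + tensMk P N (P.koszul 1 x) (N.d y) :=
  exists_tensD.choose_spec x y

theorem tensGr_proj_mk {k l : ℤ} {x : P.carrier} {y : N.carrier} (hx : P.proj k x = x)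
    (hy : N.proj l y = y) :
    (tensGr P N).proj (k + l) (tensMk P N x y) = tensMk P N x y := by
  rw [tensProj_mk hx hy, if_pos rfl]

theorem isDeg_tensGr {V : GrSpace.{w, u} 𝕜} {j : ℤ} {φ : TensSpace P N →L[𝕜] V.carrier}
    (h : ∀ k l x y, P.proj k x = x → N.proj l y = y →
      V.proj (k + l + j) (φ (tensMk P N x y)) = φ (tensMk P N x y)) :
    IsDeg (tensGr P N) V j φ := by
  intro n t
  have : φ ∘L tensProj P N n = V.proj (n + j) ∘L φ := tensMk_ext fun k l x y hx hy => by
    rw [ContinuousLinearMap.comp_apply, ContinuousLinearMap.comp_apply, tensProj_mk hx hy,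
      V.proj_of_homog (h k l x y hx hy)]
    by_cases e : n = k + l
    · simp [e]
    · simp [e]
  exact DFunLike.congr_fun this t

noncomputable def tensRactCLM (P : RightDGMod.{w, v, u} A)
    (N : DGBimod.{w, v, v₂, u} A B) (b : B.carrier) : TensSpace P N →L[𝕜] TensSpace P N :=
  ⟨(tensRact P N).flip b, continuous_tensRact.comp (continuous_id.prodMk continuous_const)⟩

theorem tensRactCLM_apply (b : B.carrier) (t : TensSpace P N) :
    tensRactCLM P N b t = tensRact P N t b := rfl

theorem tensRact_one (t : TensSpace P N) : tensRact P N t B.one = t := by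
  have : tensRactCLM P N B.one = ContinuousLinearMap.id 𝕜 _ := tensMk_ext fun k l x y _ _ => by
    rw [tensRactCLM_apply, tensRact_mk, N.ract_one]; rfl
  exact DFunLike.congr_fun this t

theorem tensRact_mul (t : TensSpace P N) (a b : B.carrier) :
    tensRact P N t (B.mul a b) = tensRact P N (tensRact P N t a) b := by
  have : tensRactCLM P N (B.mul a b) = tensRactCLM P N b ∘L tensRactCLM P N a :=
    tensMk_ext fun k l x y _ _ => by
      rw [ContinuousLinearMap.comp_apply]
      simp only [tensRactCLM_apply, tensRact_mk, N.ract_mul]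
  exact DFunLike.congr_fun this t

theorem tensD_tensD (t : TensSpace P N) : tensD P N (tensD P N t) = 0 := by
  have : tensD P N ∘L tensD P N = 0 := tensMk_ext fun k l x y _ _ => by
    rw [ContinuousLinearMap.comp_apply, tensD_mk, map_add, tensD_mk, tensD_mk, P.d_d, N.d_d,
      P.d_koszul]
    simp
  exact DFunLike.congr_fun this t

theorem isDeg_tensD : IsDeg (tensGr P N) (tensGr P N) 1 (tensD P N) :=
  isDeg_tensGr fun k l x y hx hy => by
    rw [tensD_mk, map_add]
    have h1 := tensGr_proj_mk (P.proj_d k x hx) hy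
    have h2 := tensGr_proj_mk (P.proj_koszul_homog 1 k x hx) (N.proj_d l y hy)
    rw [add_right_comm] at h1
    rw [← add_assoc] at h2
    rw [h1, h2]

theorem isDeg_tensRactCLM {n : ℤ} {b : B.carrier} (hb : B.proj n b = b) :
    IsDeg (tensGr P N) (tensGr P N) n (tensRactCLM P N b) :=
  isDeg_tensGr fun k l x y hx hy => by
    rw [tensRactCLM_apply, tensRact_mk, add_assoc]
    exact tensGr_proj_mk hx (N.proj_ract l n y b hy hb)

theorem tensGr_koszul_mk (j : ℤ) (x : P.carrier) (y : N.carrier) :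
    (tensGr P N).koszul j (tensMk P N x y) = tensMk P N (P.koszul j x) (N.koszul j y) := by
  have : (tensMk P N).compr₂ ((tensGr P N).koszul j).toLinearMap =
      (tensMk P N).compl₁₂ (P.koszul j).toLinearMap (N.koszul j).toLinearMap := by
    refine bilinear_ext P.toGrSpace N.toGrSpace
      (((tensGr P N).koszul j).continuous.comp continuous_tensMk)
      (continuous_tensMk.comp ((P.koszul j).continuous.prodMap (N.koszul j).continuous))
      fun m n x y hx hy => ?_
    change (tensGr P N).koszul j (tensMk P N x y) = tensMk P N (P.koszul j x) (N.koszul j y)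
    rw [P.koszul_of_homog j m x hx, N.koszul_of_homog j n y hy,
      (tensGr P N).koszul_of_homog j (m + n) _ (tensGr_proj_mk hx hy), map_zsmul, map_zsmul,
      LinearMap.smul_apply, smul_smul, mul_add, Int.negOnePow_add, Units.val_mul, mul_comm]
  exact LinearMap.congr_fun₂ this x y

theorem tensD_ract (t : TensSpace P N) (b : B.carrier) : tensD P N (tensRact P N t b) =
    tensRact P N (tensD P N t) b + tensRact P N ((tensGr P N).koszul 1 t) (B.d b) := by
  have : tensD P N ∘L tensRactCLM P N b = tensRactCLM P N b ∘L tensD P N +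
      tensRactCLM P N (B.d b) ∘L (tensGr P N).koszul 1 := tensMk_ext fun k l x y _ _ => by
    simp only [ContinuousLinearMap.comp_apply, add_apply, tensRactCLM_apply]
    rw [tensRact_mk, tensD_mk, tensD_mk, tensGr_koszul_mk, N.d_ract', LinearMap.map_add,
      LinearMap.map_add₂, tensRact_mk, tensRact_mk, tensRact_mk, add_assoc]
  exact DFunLike.congr_fun this t

variable (P N) in
/-- The completed tensor product of a right dg-module and a dg-bimodule over `A`. -/
noncomputable def tens : RightDGMod.{w, v₂, u} B :=
  RightDGMod.ofRight (tensGr P N) (tensRact P N) continuous_tensRact tensRact_one tensRact_mul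
    (fun _ _ _ _ hx hb => (isDeg_tensRactCLM hb).homog hx) (tensD P N)
    (fun _ _ hx => isDeg_tensD.homog hx) tensD_tensD (fun n t b ht => by
      rw [tensD_ract, (tensGr P N).koszul_of_homog 1 n t ht, one_mul, map_zsmul,
        LinearMap.smul_apply])

theorem isTens_tens : IsTens P N (tens P N) (tensMk P N) where
  continuous := continuous_tensMk
  balanced := tensMk_balanced
  proj _ _ _ _ hx hy := tensGr_proj_mk hx hy
  d := tensD_mk
  ract := tensRact_mk
  exists_lift _ := by intros; exact tensMk_lift _ ‹_› ‹_›
  ext _ := by intros; exact tensMk_ext fun _ _ _ _ _ _ => by apply_assumption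

end Existence

namespace IsTens

variable {A : DGAlg.{w, v} 𝕜} {B : DGAlg.{w, v₂} 𝕜} {P : RightDGMod.{w, v, u} A}
    {N : DGBimod.{w, v, v₂, u} A B} {T : RightDGMod.{w, v₂, u} B}
    {β : P.carrier →ₗ[𝕜] N.carrier →ₗ[𝕜] T.carrier}

theorem ext_homog (h : IsTens P N T β) {Z : Type u} [AddCommGroup Z] [Module 𝕜 Z] [UniformSpace Z]
    [IsUniformAddGroup Z] [ContinuousSMul 𝕜 Z] [PolynormableSpace 𝕜 Z] [T2Space Z]
    [CompleteSpace Z] {φ ψ : T.carrier →L[𝕜] Z}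
    (H : ∀ m n x y, P.proj m x = x → N.proj n y = y → φ (β x y) = ψ (β x y)) : φ = ψ :=
  h.ext Z φ ψ fun x y => LinearMap.congr_fun₂ (bilinear_ext P.toGrSpace N.toGrSpace
    (f := β.compr₂ φ.toLinearMap) (g := β.compr₂ ψ.toLinearMap) (φ.continuous.comp h.continuous)
    (ψ.continuous.comp h.continuous) H) x y

theorem isDeg_of (h : IsTens P N T β) {V : GrSpace.{w, u} 𝕜} {j : ℤ} {φ : T.carrier →L[𝕜] V.carrier}
    (H : ∀ k l x y, P.proj k x = x → N.proj l y = y →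
      V.proj (k + l + j) (φ (β x y)) = φ (β x y)) : IsDeg T.toGrSpace V j φ := by
  intro n t
  have : φ ∘L T.proj n = V.proj (n + j) ∘L φ := h.ext_homog fun k l x y hx hy => by
    rw [ContinuousLinearMap.comp_apply, ContinuousLinearMap.comp_apply,
      T.proj_of_homog (h.proj k l x y hx hy), V.proj_of_homog (H k l x y hx hy)]
    by_cases e : n = k + l
    · simp [e]
    · simp [e]
  exact DFunLike.congr_fun this t

end IsTens

end DGModules

/-! ### Contraacyclic right modules: contractions, cones and two-out-of-three. -/

section DGModules

variable {𝕜 : Type w} [RCLike 𝕜]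

open GrSpace

namespace DGBimod

section Bimod

variable {A : DGAlg.{w, v} 𝕜} {B : DGAlg.{w, v₂} 𝕜} {M N L : DGBimod.{w, v, v₂, u} A B}

theorem shift_d (k : ℤ) (x : M.carrier) : (M.shift k).d x = (k.negOnePow : ℤ) • M.d x := rfl

theorem shift_one_d (x : M.carrier) : (M.shift 1).d x = -M.d x := by
  rw [shift_d]; simp

theorem cone_d (f : M.Hom N) (y : N.carrier) (x : M.carrier) :
    (cone f).d (y, x) = (N.d y + f.toCLM x, -M.d x) :=
  Prod.ext rfl (shift_one_d x)

theorem IsContraacyclic.of_retract (i : M.Hom N) (r : N.Hom M)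
    (h : ∀ x, r.toCLM (i.toCLM x) = x) (hN : N.IsContraacyclic) : M.IsContraacyclic :=
  .retract i r ⟨0, fun n x _ => map_zero _, fun n a x _ => by simp, fun x b => by simp,
    fun x => by
      change r.toCLM (i.toCLM x) - x = _
      simp [h x]⟩ hN

end Bimod

end DGBimod

namespace RightDGMod

open DGBimod

variable {A : DGAlg.{w, v} 𝕜} {M N L : RightDGMod.{w, v, u} A}

/-- A right dg-module whose identity is null-homotopic. -/
def IsContractible (T : RightDGMod.{w, v, u} A) : Prop :=
  ∃ h : T.carrier →L[𝕜] T.carrier, IsDeg T.toGrSpace T.toGrSpace (-1) h ∧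
    (∀ x b, h (T.ract x b) = T.ract (h x) b) ∧ ∀ x, T.d (h x) + h (T.d x) = x

/-- The empty product is a contraacyclic zero module, and a contractible module is a homotopy
retract of it. -/
theorem IsContractible.isContraacyclic {T : RightDGMod.{w, v, u} A} (hT : IsContractible T) :
    T.IsContraacyclic := by
  obtain ⟨h, hdeg, hr, hd⟩ := hT
  let Z : RightDGMod.{w, v, u} A := DGBimod.pi (ι := PEmpty.{u + 1}) fun i => i.elim
  have hZ : Z.IsContraacyclic := .pi _ fun i => i.elim
  let i : T.Hom Z := mkHom 0 (fun _ _ => by simp) (fun _ _ => by simp) (fun _ => by simp)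
  let r : Z.Hom T := mkHom 0 (fun _ _ => by simp) (fun _ _ => by simp) (fun _ => by simp)
  refine .retract i r (homotopic_of (-h) ?_ ?_ ?_) hZ
  · exact fun n x => by
      change -h _ = T.proj _ (-h x)
      rw [hdeg, map_neg]
  · intro x b
    change -h _ = T.ract (-h x) b
    rw [hr, map_neg, LinearMap.neg_apply]
  · intro x
    change (0 : T.carrier) - x = T.d (-h x) + -h (T.d x)
    rw [map_neg, ← neg_add, hd, zero_sub]

theorem isContractible_of_subsingleton (T : RightDGMod.{w, v, u} A) [Subsingleton T.carrier] :
    IsContractible T :=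
  ⟨0, fun _ _ => Subsingleton.elim _ _, fun _ _ => Subsingleton.elim _ _,
    fun _ => Subsingleton.elim _ _⟩

/-- The contraction is `(y, x) ↦ (0, y)`. -/
theorem isContractible_cone_id (M : RightDGMod.{w, v, u} A) :
    IsContractible (cone (Hom.id M)) := by
  refine ⟨(0 : M.carrier × M.carrier →L[𝕜] M.carrier).prod (ContinuousLinearMap.fst 𝕜 _ _),
    fun n x => ?_, fun x b => ?_, fun x => ?_⟩
  · refine Prod.ext (map_zero (M.proj (n + -1))).symm ?_
    change M.proj n x.1 = M.proj (n + -1 + 1) x.1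
    rw [neg_add_cancel_right]
  · exact Prod.ext (LinearMap.map_zero₂ M.ract b).symm rfl
  · obtain ⟨y, x⟩ := x
    change (cone (Hom.id M)).d (0, y) + (0, ((cone (Hom.id M)).d (y, x)).1) = (y, x)
    rw [cone_d, cone_d]
    refine Prod.ext ?_ ?_
    · change M.d 0 + y + 0 = y
      simp
    · change -M.d y + (M.d y + x) = x
      simp

theorem isContraacyclic_unshift {k : ℤ} (h : (M.shift k).IsContraacyclic) :
    M.IsContraacyclic := by
  have h2 := IsContraacyclic.shift (-k) h
  have e : ∀ n : ℤ, n + -k + k = n := fun n => by ring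
  have ed : ∀ x : M.carrier, ((M.shift k).shift (-k)).d x = M.d x := fun x => by
    rw [shift_d, shift_d, smul_smul, ← Units.val_mul, ← Int.negOnePow_add]
    simp
  refine h2.of_retract
    (mkHom (N := (M.shift k).shift (-k)) (ContinuousLinearMap.id 𝕜 M.carrier) ?_ ?_ ?_)
    (mkHom (M := (M.shift k).shift (-k)) (ContinuousLinearMap.id 𝕜 M.carrier) ?_ ?_ ?_) ?_
  · intro n x
    change M.proj n x = M.proj (n + -k + k) x
    rw [e]
  · intro x b; rfl
  · exact fun x => (ed x).symm
  · intro n x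
    change M.proj (n + -k + k) x = M.proj n x
    rw [e]
  · intro x b; rfl
  · exact fun x => (ed x)
  · exact fun x => rfl

/-- Rotation of the triangle: `N[1]` is a strict retract of the cone of the projection `cone f →
M[1]`. -/
theorem isContraacyclic_target_of_cone {f : M.Hom N} (hf : (cone f).IsContraacyclic)
    (hM : M.IsContraacyclic) : N.IsContraacyclic := by
  let δ : (cone f).Hom (M.shift 1) := mkHom (ContinuousLinearMap.snd 𝕜 N.carrier M.carrier)
    (fun _ _ => rfl) (fun _ _ => rfl) (fun _ => rfl)
  refine isContraacyclic_unshift (k := 1) ?_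
  refine (IsContraacyclic.cone δ hf (.shift 1 hM)).of_retract
    (mkHom ((0 : N.carrier →L[𝕜] M.carrier).prod
      ((ContinuousLinearMap.id 𝕜 _).prod (0 : N.carrier →L[𝕜] M.carrier))) ?_ ?_ ?_)
    -- The retraction is `(m, (y, x)) ↦ y + f m`; the term `f m` makes it commute with the
    -- differentials.
    (mkHom ((ContinuousLinearMap.fst 𝕜 _ _) ∘L (ContinuousLinearMap.snd 𝕜 _ _) +
      f.toCLM ∘L ContinuousLinearMap.fst 𝕜 M.carrier (N.carrier × M.carrier)) ?_ ?_ ?_) ?_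
  · exact fun n x => Prod.ext (map_zero (M.proj (n + 1))).symm
      (Prod.ext rfl (map_zero (M.proj (n + 1 + 1))).symm)
  · exact fun x b => Prod.ext (LinearMap.map_zero₂ M.ract b).symm
      (Prod.ext rfl (LinearMap.map_zero₂ M.ract b).symm)
  · intro x
    change (0, ((N.shift 1).d x, 0)) = (cone δ).d (0, (x, 0))
    rw [cone_d, cone_d, shift_one_d]
    refine Prod.ext ?_ (Prod.ext ?_ ?_)
    · change (0 : M.carrier) = (M.shift 1).d 0 + 0
      rw [map_zero, add_zero]
    · change -N.d x = -(N.d x + f.toCLM 0)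
      rw [map_zero, add_zero]
    · change (0 : M.carrier) = - -M.d 0
      simp
  · intro n x
    change N.proj (n + 1) x.2.1 + f.toCLM (M.proj (n + 1) x.1) =
      N.proj (n + 1) (x.2.1 + f.toCLM x.1)
    rw [map_add, f.map_proj]
  · intro x b
    change N.ract x.2.1 b + f.toCLM (M.ract x.1 b) = N.ract (x.2.1 + f.toCLM x.1) b
    rw [LinearMap.map_add₂, f.map_ract]
  · rintro ⟨m, y, x⟩
    rw [cone_d, cone_d, shift_one_d, shift_one_d]
    change -(N.d y + f.toCLM x) + f.toCLM (-M.d m + x) = -N.d (y + f.toCLM m)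
    rw [map_add, map_add, map_neg, f.map_d]
    abel
  · intro x
    change x + f.toCLM 0 = x
    rw [map_zero, add_zero]

/-- Rotation in the other direction: `M[1]` is a strict retract of the cone of the inclusion `N →
cone f`, through `x ↦ ((0, x), -f x)`. -/
theorem isContraacyclic_source_of_cone {f : M.Hom N} (hf : (cone f).IsContraacyclic)
    (hN : N.IsContraacyclic) : M.IsContraacyclic := by
  let j : N.Hom (cone f) := mkHom
    ((ContinuousLinearMap.id 𝕜 N.carrier).prod (0 : N.carrier →L[𝕜] M.carrier))
    (fun n x => Prod.ext rfl (map_zero (M.proj (n + 1))).symm)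
    (fun x b => Prod.ext rfl (LinearMap.map_zero₂ M.ract b).symm)
    (fun x => by
      change (N.d x, 0) = (cone f).d (x, 0)
      rw [cone_d]; simp)
  refine isContraacyclic_unshift (k := 1) ?_
  refine (IsContraacyclic.cone j hN hf).of_retract
    (mkHom (((0 : M.carrier →L[𝕜] N.carrier).prod
      (ContinuousLinearMap.id 𝕜 M.carrier)).prod (-f.toCLM)) ?_ ?_ ?_)
    (mkHom (ContinuousLinearMap.snd 𝕜 N.carrier M.carrier ∘L ContinuousLinearMap.fst 𝕜 _ _)
      ?_ ?_ ?_) ?_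
  · intro n x
    refine Prod.ext (Prod.ext (map_zero (N.proj n)).symm rfl) ?_
    change -f.toCLM (M.proj (n + 1) x) = N.proj (n + 1) (-f.toCLM x)
    rw [map_neg, f.map_proj]
  · intro x b
    refine Prod.ext (Prod.ext (LinearMap.map_zero₂ N.ract b).symm rfl) ?_
    change -f.toCLM (M.ract x b) = N.ract (-f.toCLM x) b
    rw [LinearMap.map_neg₂, f.map_ract]
  · intro x
    change ((0, (M.shift 1).d x), -f.toCLM ((M.shift 1).d x)) =
      (cone j).d ((0, x), -f.toCLM x)
    rw [cone_d, cone_d, shift_one_d]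
    refine Prod.ext (Prod.ext ?_ ?_) ?_
    · change (0 : N.carrier) = N.d 0 + f.toCLM x + -f.toCLM x
      rw [map_zero]; abel
    · change -M.d x = -M.d x + 0
      rw [add_zero]
    · change -f.toCLM (-M.d x) = -N.d (-f.toCLM x)
      rw [map_neg, map_neg, f.map_d]
  · exact fun n x => rfl
  · exact fun x b => rfl
  · rintro ⟨⟨y, x⟩, z⟩
    rw [cone_d, cone_d, shift_one_d]
    change -M.d x + 0 = -M.d x
    rw [add_zero]
  · exact fun x => rfl

/-- The totalization is the cone of `cone i → L`, so two-out-of-three is applied first to this map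
and then to `i`. -/
theorem isContraacyclic_middle {i : M.Hom N} {p : N.Hom L} (h : ShortExact i p)
    (hM : M.IsContraacyclic) (hL : L.IsContraacyclic) : N.IsContraacyclic :=
  isContraacyclic_target_of_cone (isContraacyclic_source_of_cone (.tot h) hL) hM

theorem isContraacyclic_left {i : M.Hom N} {p : N.Hom L} (h : ShortExact i p)
    (hN : N.IsContraacyclic) (hL : L.IsContraacyclic) : M.IsContraacyclic :=
  isContraacyclic_source_of_cone (isContraacyclic_source_of_cone (.tot h) hL) hN

section ConeMap

variable {M' N' : RightDGMod.{w, v, u} A} {f : M.Hom N} {f' : M'.Hom N'} {a : M.Hom M'}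
  {b : N.Hom N'}

/-- The morphism of cones induced by a commutative square. -/
noncomputable abbrev coneMap (h : ∀ x, f'.toCLM (a.toCLM x) = b.toCLM (f.toCLM x)) :
    (cone f).Hom (cone f') :=
  mkHom (b.toCLM.prodMap a.toCLM)
    (fun n x => Prod.ext (b.map_proj n x.1) (a.map_proj (n + 1) x.2))
    (fun x c => Prod.ext (b.map_ract x.1 c) (a.map_ract x.2 c))
    (fun x => by
      obtain ⟨y, x⟩ := x
      change _ = (cone f').d (b.toCLM y, a.toCLM x)
      rw [cone_d, cone_d]
      refine Prod.ext ?_ ?_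
      · change b.toCLM (N.d y + f.toCLM x) = N'.d (b.toCLM y) + f'.toCLM (a.toCLM x)
        rw [map_add, b.map_d, h]
      · change a.toCLM (-M.d x) = -M'.d (a.toCLM x)
        rw [map_neg, a.map_d])

/-- A commutative square has the same total cone whether its rows or its columns are taken first.
The isomorphism exchanges the two middle summands and changes the sign of the last one. -/
theorem isContraacyclic_cone_coneMap (h : ∀ x, f'.toCLM (a.toCLM x) = b.toCLM (f.toCLM x))
    (ha : (cone a).IsContraacyclic) (hb : (cone b).IsContraacyclic) :
    (cone (coneMap h)).IsContraacyclic := by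
  let e : (cone a).Hom (cone b) := coneMap (f := a) (f' := b) (a := f) (b := f') fun x => (h x).symm
  refine (IsContraacyclic.cone e ha hb).of_retract
    (mkHom (((ContinuousLinearMap.fst 𝕜 _ _ ∘L ContinuousLinearMap.fst 𝕜 _ _).prod
      (ContinuousLinearMap.fst 𝕜 _ _ ∘L ContinuousLinearMap.snd 𝕜 _ _)).prod
      ((ContinuousLinearMap.snd 𝕜 _ _ ∘L ContinuousLinearMap.fst 𝕜 _ _).prod
      (-(ContinuousLinearMap.snd 𝕜 _ _ ∘L ContinuousLinearMap.snd 𝕜 _ _)) :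
        (N'.carrier × M'.carrier) × (N.carrier × M.carrier) →L[𝕜] _)) ?_ ?_ ?_)
    (mkHom (((ContinuousLinearMap.fst 𝕜 _ _ ∘L ContinuousLinearMap.fst 𝕜 _ _).prod
      (ContinuousLinearMap.fst 𝕜 _ _ ∘L ContinuousLinearMap.snd 𝕜 _ _)).prod
      ((ContinuousLinearMap.snd 𝕜 _ _ ∘L ContinuousLinearMap.fst 𝕜 _ _).prod
      (-(ContinuousLinearMap.snd 𝕜 _ _ ∘L ContinuousLinearMap.snd 𝕜 _ _)) :
        (N'.carrier × N.carrier) × (M'.carrier × M.carrier) →L[𝕜] _)) ?_ ?_ ?_) ?_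
  · exact fun n x => Prod.ext rfl (Prod.ext rfl (map_neg (M.proj (n + 1 + 1)) x.2.2).symm)
  · exact fun x c => Prod.ext rfl (Prod.ext rfl (LinearMap.map_neg₂ M.ract x.2.2 c).symm)
  · rintro ⟨⟨n', m'⟩, n, m⟩
    change _ = (cone e).d ((n', n), (m', -m))
    rw [cone_d, cone_d, cone_d, cone_d, cone_d, cone_d]
    refine Prod.ext (Prod.ext ?_ ?_) (Prod.ext ?_ ?_)
    · change N'.d n' + f'.toCLM m' + b.toCLM n = N'.d n' + b.toCLM n + f'.toCLM m'
      abel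
    · change -(N.d n + f.toCLM m) = -N.d n + f.toCLM (-m)
      rw [map_neg]; abel
    · change -M'.d m' + a.toCLM m = -(M'.d m' + a.toCLM (-m))
      rw [map_neg]; abel
    · change - - -M.d m = - -M.d (-m)
      rw [map_neg]
  · exact fun n x => Prod.ext rfl (Prod.ext rfl (map_neg (M.proj (n + 1 + 1)) x.2.2).symm)
  · exact fun x c => Prod.ext rfl (Prod.ext rfl (LinearMap.map_neg₂ M.ract x.2.2 c).symm)
  · rintro ⟨⟨n', n⟩, m', m⟩
    change _ = (cone (coneMap h)).d ((n', m'), (n, -m))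
    rw [cone_d, cone_d, cone_d, cone_d, cone_d, cone_d]
    refine Prod.ext (Prod.ext ?_ ?_) (Prod.ext ?_ ?_)
    · change N'.d n' + b.toCLM n + f'.toCLM m' = N'.d n' + f'.toCLM m' + b.toCLM n
      abel
    · change -(M'.d m' + a.toCLM m) = -M'.d m' + a.toCLM (-m)
      rw [map_neg]; abel
    · change -N.d n + f.toCLM m = -(N.d n + f.toCLM (-m))
      rw [map_neg]; abel
    · change - - -M.d m = - -M.d (-m)
      rw [map_neg]
  · rintro ⟨⟨n', m'⟩, n, m⟩
    exact Prod.ext rfl (Prod.ext rfl (neg_neg m))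

end ConeMap

end RightDGMod

end DGModules

/-! ### Morphisms from a graded-projective module to a contraacyclic one. -/

section DGModules

variable {𝕜 : Type w} [RCLike 𝕜]

open GrSpace

namespace RightDGMod

open DGBimod

variable {A : DGAlg.{w, v} 𝕜}

/-- Homogeneous morphisms of degree `k` of graded right modules. -/
def IsGrMap (M N : GrBimod.{w, w, v, u} (DGAlg.ground 𝕜).toGrAlg A.toGrAlg) (k : ℤ)
    (φ : M.carrier →L[𝕜] N.carrier) : Prop :=
  IsDeg M.toGrSpace N.toGrSpace k φ ∧ ∀ x b, φ (M.ract x b) = N.ract (φ x) b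

section

variable {M N L : GrBimod.{w, w, v, u} (DGAlg.ground 𝕜).toGrAlg A.toGrAlg} {k l m : ℤ}

theorem IsGrMap.comp {ψ : N.carrier →L[𝕜] L.carrier} {φ : M.carrier →L[𝕜] N.carrier}
    (hψ : IsGrMap N L l ψ) (hφ : IsGrMap M N k φ) (hm : m = k + l := by ring) :
    IsGrMap M L m (ψ ∘L φ) :=
  ⟨hψ.1.comp hφ.1 hm, fun x b => by simp only [ContinuousLinearMap.comp_apply, hφ.2, hψ.2]⟩

theorem IsGrMap.add {φ ψ : M.carrier →L[𝕜] N.carrier} (hφ : IsGrMap M N k φ)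
    (hψ : IsGrMap M N k ψ) : IsGrMap M N k (φ + ψ) :=
  ⟨hφ.1.add hψ.1, fun x b => by simp [hφ.2, hψ.2]⟩

theorem IsGrMap.sub {φ ψ : M.carrier →L[𝕜] N.carrier} (hφ : IsGrMap M N k φ)
    (hψ : IsGrMap M N k ψ) : IsGrMap M N k (φ - ψ) :=
  ⟨hφ.1.sub hψ.1, fun x b => by simp [hφ.2, hψ.2]⟩

theorem IsGrMap.zsmul {φ : M.carrier →L[𝕜] N.carrier} (hφ : IsGrMap M N k φ) (c : ℤ) :
    IsGrMap M N k (c • φ) :=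
  ⟨hφ.1.zsmul c, fun x b => by
    change c • φ _ = N.ract (c • φ x) b
    rw [hφ.2, map_zsmul, LinearMap.smul_apply]⟩

theorem _root_.ClctDG.GrBimod.Hom.isGrMap (f : M.Hom N) : IsGrMap M N 0 f.toCLM :=
  ⟨f.isDeg, f.map_ract⟩

/-- A morphism of degree `k` into `L` is one of degree `0` into `L[k]`, where projectivity applies.
-/
theorem exists_lift_of_isProjective (hM : M.IsProjective) (p : N.Hom L)
    (s : L.carrier →L[𝕜] N.carrier) (hs : ∀ n z, s (L.proj n z) = N.proj n (s z))
    (hps : ∀ z, p.toCLM (s z) = z) {φ : M.carrier →L[𝕜] L.carrier} (hφ : IsGrMap M L k φ) :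
    ∃ ψ, IsGrMap M N k ψ ∧ ∀ x, p.toCLM (ψ x) = φ x := by
  obtain ⟨g, hg⟩ := hM (N.shift k) (L.shift k)
    (mkGrHom (M := N.shift k) (N := L.shift k) p.toCLM (fun n x => p.map_proj (n + k) x) p.map_ract)
    s (fun n y => hs (n + k) y) hps
    (mkGrHom (N := L.shift k) φ hφ.1 hφ.2)
  exact ⟨g.toCLM, ⟨g.map_proj, g.map_ract⟩, hg⟩

end

variable {P C D : RightDGMod.{w, v, u} A}

/-- This is the differential of the morphism complex. Neither `d φ` nor `φ d` is linear over the
action, but the two terms in which the algebra element is differentiated cancel. -/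
theorem isGrMap_d_comp {k m : ℤ} {φ : P.carrier →L[𝕜] C.carrier}
    (hφ : IsGrMap P.toGrBimod C.toGrBimod k φ) (hm : m = k + 1 := by ring) :
    IsGrMap P.toGrBimod C.toGrBimod m
      (C.d ∘L φ + (-(k.negOnePow : ℤ)) • (φ ∘L P.d)) := by
  refine ⟨(C.isDeg_d.comp hφ.1 hm).add ((hφ.1.comp P.isDeg_d (by rw [hm]; ring)).zsmul _),
    fun x b => ?_⟩
  change C.d (φ (P.ract x b)) + (-(k.negOnePow : ℤ)) • φ (P.d (P.ract x b)) =
    C.ract (C.d (φ x) + (-(k.negOnePow : ℤ)) • φ (P.d x)) b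
  rw [P.d_ract', map_add, hφ.2, hφ.2, hφ.2, hφ.1.map_koszul, C.d_ract', LinearMap.map_add₂]
  simp only [map_zsmul, LinearMap.smul_apply, smul_add, smul_smul, one_mul]
  have : -(k.negOnePow : ℤ) * (k.negOnePow : ℤ) = -1 := by
    rw [neg_mul, ← Units.val_mul, Int.units_mul_self]; rfl
  rw [this]
  simp only [neg_smul, one_smul]
  abel

/-- The complex of morphisms from `P` to `C` is exact. -/
def IsHomAcyclic (P C : RightDGMod.{w, v, u} A) : Prop :=
  ∀ (k : ℤ) (φ : P.carrier →L[𝕜] C.carrier), IsGrMap P.toGrBimod C.toGrBimod k φ →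
    (∀ x, C.d (φ x) = (k.negOnePow : ℤ) • φ (P.d x)) →
    ∃ ψ : P.carrier →L[𝕜] C.carrier, IsGrMap P.toGrBimod C.toGrBimod (k - 1) ψ ∧
      ∀ x, C.d (ψ x) + (k.negOnePow : ℤ) • ψ (P.d x) = φ x

theorem eps_mul_self (k : ℤ) : (k.negOnePow : ℤ) * (k.negOnePow : ℤ) = 1 := by
  rw [← Units.val_mul, Int.units_mul_self]; rfl

theorem IsHomAcyclic.shift (h : IsHomAcyclic P C) (j : ℤ) : IsHomAcyclic P (C.shift j) := by
  intro k φ hφ hd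
  obtain ⟨ψ, hψ, hψd⟩ := h (k + j) φ
    ⟨fun n x => (hφ.1 n x).trans (by change C.proj (n + k + j) _ = _; rw [add_assoc]), hφ.2⟩
    fun x => by
      have := hd x
      rw [shift_d] at this
      rw [Int.negOnePow_add, Units.val_mul, mul_comm, mul_smul, ← this, smul_smul, eps_mul_self,
        one_smul]
  refine ⟨(j.negOnePow : ℤ) • ψ, IsGrMap.zsmul (N := (C.shift j).toGrBimod) ⟨fun n x => ?_, hψ.2⟩ _,
    fun x => ?_⟩
  · refine (hψ.1 n x).trans ?_
    change _ = C.proj (n + (k - 1) + j) (ψ x)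
    congr 2; ring
  · rw [shift_d]
    change (j.negOnePow : ℤ) • C.d ((j.negOnePow : ℤ) • ψ x) +
      (k.negOnePow : ℤ) • (j.negOnePow : ℤ) • ψ (P.d x) = φ x
    rw [map_zsmul, smul_smul, eps_mul_self, one_smul, smul_smul, ← Units.val_mul,
      ← Int.negOnePow_add, hψd]

theorem IsHomAcyclic.pi {ι : Type u} {C : ι → RightDGMod.{w, v, u} A}
    (h : ∀ i, IsHomAcyclic P (C i)) : IsHomAcyclic P (DGBimod.pi C) := by
  intro k φ hφ hd
  have h1 := fun i => h i k (ContinuousLinearMap.proj (φ := fun i => (C i).carrier) i ∘L φ)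
    ⟨fun n x => congrFun (hφ.1 n x) i, fun x b => congrFun (hφ.2 x b) i⟩
    fun x => congrFun (hd x) i
  choose ψ hψ hψd using h1
  exact ⟨ContinuousLinearMap.pi ψ, ⟨fun n x => funext fun i => (hψ i).1 n x,
    fun x b => funext fun i => (hψ i).2 x b⟩, fun x => funext fun i => hψd i x⟩

theorem IsHomAcyclic.retract (h : IsHomAcyclic P D) (i : C.Hom D) (r : D.Hom C)
    (hir : Homotopic (r.comp i) (Hom.id C)) : IsHomAcyclic P C := by
  intro k φ hφ hd
  obtain ⟨η, hη, -, hηr, hηd⟩ := hir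
  have hη' : IsGrMap C.toGrBimod C.toGrBimod (-1) η := ⟨isDeg_of_homog hη, hηr⟩
  obtain ⟨ψ, hψ, hψd⟩ := h k (i.toCLM ∘L φ) (i.isGrMap.comp hφ) fun x => by
    simp only [ContinuousLinearMap.comp_apply]
    rw [← i.map_d, hd, map_zsmul]
  -- The map `r ∘ ψ` bounds `r ∘ i ∘ φ`, which exceeds `φ` by the boundary of `η ∘ φ`; subtracting
  -- `η ∘ φ` corrects this.
  refine ⟨r.toCLM ∘L ψ - η ∘L φ, (r.isGrMap.comp hψ).sub (hη'.comp hφ), fun x => ?_⟩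
  change C.d (r.toCLM (ψ x) - η (φ x)) +
    (k.negOnePow : ℤ) • (r.toCLM (ψ (P.d x)) - η (φ (P.d x))) = φ x
  have e1 := congrArg r.toCLM (hψd x)
  rw [map_add, map_zsmul, r.map_d] at e1
  have e2 : r.toCLM (i.toCLM (φ x)) - φ x = C.d (η (φ x)) + η (C.d (φ x)) := hηd (φ x)
  rw [hd, map_zsmul] at e2
  rw [map_sub, smul_sub]
  calc _ = (C.d (r.toCLM (ψ x)) + (k.negOnePow : ℤ) • r.toCLM (ψ (P.d x))) -
        (C.d (η (φ x)) + (k.negOnePow : ℤ) • η (φ (P.d x))) := by abel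
    _ = φ x := by rw [e1, ← e2]; exact sub_sub_cancel _ _

theorem IsHomAcyclic.cone (hC : IsHomAcyclic P C) (hD : IsHomAcyclic P D) (f : C.Hom D) :
    IsHomAcyclic P (cone f) := by
  intro k φ hφ hd
  let φ₁ : P.carrier →L[𝕜] D.carrier := ContinuousLinearMap.fst 𝕜 D.carrier C.carrier ∘L φ
  let φ₂ : P.carrier →L[𝕜] C.carrier := ContinuousLinearMap.snd 𝕜 D.carrier C.carrier ∘L φ
  have hd' : ∀ x, (D.d (φ₁ x) + f.toCLM (φ₂ x), -C.d (φ₂ x)) =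
      (k.negOnePow : ℤ) • φ (P.d x) := fun x => (cone_d f _ _).symm.trans (hd x)
  have hd1 : ∀ x, D.d (φ₁ x) + f.toCLM (φ₂ x) = (k.negOnePow : ℤ) • φ₁ (P.d x) := fun x =>
    congrArg Prod.fst (hd' x)
  have hd2 : ∀ x, -C.d (φ₂ x) = (k.negOnePow : ℤ) • φ₂ (P.d x) := fun x =>
    congrArg Prod.snd (hd' x)
  have hφ₁ : IsGrMap P.toGrBimod D.toGrBimod k φ₁ :=
    ⟨fun n x => congrArg Prod.fst (hφ.1 n x), fun x b => congrArg Prod.fst (hφ.2 x b)⟩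
  have hφ₂ : IsGrMap P.toGrBimod C.toGrBimod (k + 1) φ₂ :=
    ⟨fun n x => (congrArg Prod.snd (hφ.1 n x)).trans (by
      change C.proj (n + k + 1) _ = _; rw [add_assoc]; rfl),
      fun x b => congrArg Prod.snd (hφ.2 x b)⟩
  -- The component in the source of `f` is a cocycle up to sign and is bounded first. Its primitive
  -- then corrects the component in the target to a cocycle.
  obtain ⟨ψ₂, hψ₂, hψ₂d⟩ := hC (k + 1) φ₂ hφ₂ fun x => by
    rw [Int.negOnePow_succ, Units.val_neg, neg_smul, ← hd2, neg_neg]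
  rw [add_sub_cancel_right] at hψ₂
  simp only [Int.negOnePow_succ, Units.val_neg, neg_smul] at hψ₂d
  obtain ⟨ψ₁, hψ₁, hψ₁d⟩ := hD k (φ₁ + f.toCLM ∘L ψ₂) (hφ₁.add (f.isGrMap.comp hψ₂)) fun x => by
    change D.d (φ₁ x + f.toCLM (ψ₂ x)) =
      (k.negOnePow : ℤ) • (φ₁ (P.d x) + f.toCLM (ψ₂ (P.d x)))
    have e := congrArg f.toCLM (hψ₂d x)
    rw [map_add, map_neg, map_zsmul, f.map_d] at e
    rw [map_add, smul_add, ← hd1, ← e]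
    abel
  refine ⟨ψ₁.prod (-ψ₂), ⟨fun n x => Prod.ext (hψ₁.1 n x) ?_, fun x b =>
    Prod.ext (hψ₁.2 x b) ?_⟩, fun x => ?_⟩
  · change -ψ₂ (P.proj n x) = C.proj (n + (k - 1) + 1) (-ψ₂ x)
    rw [map_neg, hψ₂.1]; congr 3; ring
  · change -ψ₂ (P.ract x b) = C.ract (-ψ₂ x) b
    rw [LinearMap.map_neg₂, hψ₂.2]
  · change (DGBimod.cone f).d (ψ₁ x, -ψ₂ x) + (k.negOnePow : ℤ) • (ψ₁ (P.d x), -ψ₂ (P.d x)) = φ x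
    rw [cone_d]
    refine Prod.ext ?_ ?_
    · change D.d (ψ₁ x) + f.toCLM (-ψ₂ x) + (k.negOnePow : ℤ) • ψ₁ (P.d x) = φ₁ x
      rw [map_neg, add_right_comm, hψ₁d]
      exact add_neg_cancel_right _ _
    · change -C.d (-ψ₂ x) + (k.negOnePow : ℤ) • -ψ₂ (P.d x) = φ₂ x
      rw [map_neg, neg_neg, smul_neg, hψ₂d]

/-- This is the case in which projectivity is used. In `L ⊕ N[1] ⊕ M[2]` a lift to `N` of the
`L`-component of a cocycle removes that component. What then remains in `N` is annihilated by `p`,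
so it comes from `M` and can be removed as well. -/
theorem isHomAcyclic_tot (hP : P.toGrBimod.IsProjective) {M N L : RightDGMod.{w, v, u} A}
    {i : M.Hom N} {p : N.Hom L} (h : ShortExact i p) : IsHomAcyclic P (tot h) := by
  intro k φ hφ hd
  let φ₀ : P.carrier →L[𝕜] L.carrier :=
    ContinuousLinearMap.fst 𝕜 L.carrier (N.carrier × M.carrier) ∘L φ
  let φ₁ : P.carrier →L[𝕜] N.carrier := ContinuousLinearMap.fst 𝕜 _ _ ∘L
    ContinuousLinearMap.snd 𝕜 L.carrier (N.carrier × M.carrier) ∘L φ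
  let φ₂ : P.carrier →L[𝕜] M.carrier := ContinuousLinearMap.snd 𝕜 _ _ ∘L
    ContinuousLinearMap.snd 𝕜 L.carrier (N.carrier × M.carrier) ∘L φ
  have totd : ∀ l n m, (tot h).d (l, (n, m)) = (L.d l + p.toCLM n, (-(N.d n + i.toCLM m), M.d m)) :=
    fun l n m => by
      rw [cone_d, cone_d]
      exact Prod.ext rfl (Prod.ext rfl (neg_neg _))
  have hd' : ∀ x, (L.d (φ₀ x) + p.toCLM (φ₁ x), (-(N.d (φ₁ x) + i.toCLM (φ₂ x)), M.d (φ₂ x))) =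
      (k.negOnePow : ℤ) • φ (P.d x) := fun x => (totd _ _ _).symm.trans (hd x)
  have hd0 : ∀ x, L.d (φ₀ x) + p.toCLM (φ₁ x) = (k.negOnePow : ℤ) • φ₀ (P.d x) := fun x =>
    congrArg Prod.fst (hd' x)
  have hd1 : ∀ x, -(N.d (φ₁ x) + i.toCLM (φ₂ x)) = (k.negOnePow : ℤ) • φ₁ (P.d x) := fun x =>
    congrArg (fun y => y.2.1) (hd' x)
  have hφ₀ : IsGrMap P.toGrBimod L.toGrBimod k φ₀ :=
    ⟨fun n x => congrArg Prod.fst (hφ.1 n x), fun x b => congrArg Prod.fst (hφ.2 x b)⟩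
  have hφ₁ : IsGrMap P.toGrBimod N.toGrBimod (k + 1) φ₁ :=
    ⟨fun n x => (congrArg (fun y => y.2.1) (hφ.1 n x)).trans (by
      change N.proj (n + k + 1) _ = _; rw [add_assoc]; rfl),
      fun x b => congrArg (fun y => y.2.1) (hφ.2 x b)⟩
  obtain ⟨lam, hlam, hlamφ⟩ := exists_lift_of_isProjective hP p.toHom h.s h.s_proj h.p_s hφ₀
  have hδ := isGrMap_d_comp (m := k + 1) hlam
  -- The `N`-component left after the coboundary of the lift `lam` is taken out. The first component
  -- of the cocycle equation says that `p` kills it.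
  let χ : P.carrier →L[𝕜] N.carrier := φ₁ + (N.d ∘L lam + (-(k.negOnePow : ℤ)) • (lam ∘L P.d))
  have hχ : IsGrMap P.toGrBimod N.toGrBimod (k + 1) χ := hφ₁.add hδ
  have χ_apply : ∀ x, χ x = φ₁ x + (N.d (lam x) + (-(k.negOnePow : ℤ)) • lam (P.d x)) :=
    fun x => rfl
  have hpχ : ∀ x, p.toCLM (χ x) = 0 := fun x => by
    rw [χ_apply, map_add, map_add, p.map_d, map_zsmul, hlamφ, hlamφ, neg_smul, ← hd0]
    abel
  have hir : ∀ x, i.toCLM (h.r (χ x)) = χ x := fun x => by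
    have := h.i_r_add_s_p (χ x)
    rwa [hpχ, map_zero, add_zero] at this
  have hinj : ∀ m m', i.toCLM m = i.toCLM m' → m = m' := fun m m' e => by
    rw [← h.r_i m, e, h.r_i]
  have hμ : IsGrMap P.toGrBimod M.toGrBimod (k + 1) (h.r ∘L χ) := by
    refine ⟨fun n x => ?_, fun x b => hinj _ _ ?_⟩
    · change h.r (χ _) = M.proj _ (h.r (χ x))
      rw [hχ.1, h.r_proj]
    · change i.toCLM (h.r (χ (P.ract x b))) = i.toCLM (M.ract (h.r (χ x)) b)
      rw [hir, i.map_ract, hir, hχ.2]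
  refine ⟨(0 : P.carrier →L[𝕜] L.carrier).prod (lam.prod (-(h.r ∘L χ))),
    ⟨fun n x => ?_, fun x b => ?_⟩, fun x => ?_⟩
  · refine Prod.ext (map_zero (L.proj _)).symm (Prod.ext ?_ ?_)
    · refine (hlam.1 n x).trans ?_
      change _ = N.proj (n + (k - 1) + 1) (lam x)
      congr 2; ring
    · change -h.r (χ (P.proj n x)) = M.proj (n + (k - 1) + 1 + 1) (-h.r (χ x))
      rw [map_neg, hχ.1, h.r_proj]; congr 3; ring
  · refine Prod.ext (LinearMap.map_zero₂ L.ract b).symm (Prod.ext (hlam.2 x b) ?_)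
    change -(h.r ∘L χ) (P.ract x b) = M.ract (-h.r (χ x)) b
    rw [LinearMap.map_neg₂, hμ.2]; rfl
  · change (tot h).d (0, (lam x, -h.r (χ x))) +
      (k.negOnePow : ℤ) • (0, (lam (P.d x), -h.r (χ (P.d x)))) = φ x
    rw [totd]
    refine Prod.ext ?_ (Prod.ext ?_ ?_)
    · change L.d 0 + p.toCLM (lam x) + (k.negOnePow : ℤ) • (0 : L.carrier) = φ₀ x
      rw [map_zero, zero_add, smul_zero, add_zero, hlamφ]
    · change -(N.d (lam x) + i.toCLM (-h.r (χ x))) + (k.negOnePow : ℤ) • lam (P.d x) = φ₁ x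
      rw [map_neg, hir, χ_apply, neg_smul]
      abel
    · change M.d (-h.r (χ x)) + (k.negOnePow : ℤ) • -h.r (χ (P.d x)) = φ₂ x
      -- The `M`-component is compared after the injection into `N`, where `i ∘ r` acts as the
      -- identity on `χ` and the second component of the cocycle equation applies.
      refine hinj _ _ ?_
      rw [map_add, i.map_d, map_neg i.toCLM, map_neg N.d, map_zsmul, map_neg i.toCLM, hir, hir,
        χ_apply, χ_apply, P.d_d,
        map_zero, smul_zero, add_zero, map_add, map_add, N.d_d, zero_add, map_zsmul,
        smul_neg, smul_add, ← hd1, neg_smul]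
      abel

/-- Closed morphisms from a graded-projective module to a contraacyclic one are null-homotopic. -/
theorem isHomAcyclic_of_isContraacyclic (hP : P.toGrBimod.IsProjective)
    (hC : C.IsContraacyclic) : IsHomAcyclic P C := by
  induction hC with
  | tot h => exact isHomAcyclic_tot hP h
  | shift k _ ih => exact ih.shift k
  | cone f _ _ h1 h2 => exact h1.cone h2 f
  | retract i r h _ ih => exact ih.retract i r h
  | pi M _ ih => exact IsHomAcyclic.pi ih

end RightDGMod

end DGModules

/-! ### Functoriality of the tensor product: homotopies, shifts, cones and products. -/

section DGModules

variable {𝕜 : Type w} [RCLike 𝕜]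

open GrSpace

namespace IsTens

open RightDGMod DGBimod

section Functor

variable {A : DGAlg.{w, v} 𝕜} {B : DGAlg.{w, v₂} 𝕜} {P P' : RightDGMod.{w, v, u} A}
    {N N' : DGBimod.{w, v, v₂, u} A B} {T T' : RightDGMod.{w, v₂, u} B}
    {β : P.carrier →ₗ[𝕜] N.carrier →ₗ[𝕜] T.carrier}
    {β' : P'.carrier →ₗ[𝕜] N'.carrier →ₗ[𝕜] T'.carrier}

theorem exists_grMap (h : IsTens P N T β)
    {V : GrBimod.{w, w, v₂, u} (DGAlg.ground 𝕜).toGrAlg B.toGrAlg} (j : ℤ)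
    (γ : P.carrier →ₗ[𝕜] N.carrier →ₗ[𝕜] V.carrier)
    (hγ : Continuous fun p : P.carrier × N.carrier => γ p.1 p.2)
    (hb : ∀ x a y, γ (P.ract x a) y = γ x (N.lact a y))
    (hdeg : ∀ m n x y, P.proj m x = x → N.proj n y = y → V.proj (m + n + j) (γ x y) = γ x y)
    (hr : ∀ x y b, γ x (N.ract y b) = V.ract (γ x y) b) :
    ∃ φ : T.carrier →L[𝕜] V.carrier, IsGrMap T.toGrBimod V j φ ∧ ∀ x y, φ (β x y) = γ x y := by
  obtain ⟨φ, hφ⟩ := h.exists_lift V.carrier γ hγ hb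
  refine ⟨φ, ⟨h.isDeg_of fun k l x y hx hy => ?_, fun t b => ?_⟩, hφ⟩
  · rw [hφ, hdeg k l x y hx hy]
  · let ρ : V.carrier →L[𝕜] V.carrier :=
      ⟨V.ract.flip b, V.continuous_ract.comp (continuous_id.prodMk continuous_const)⟩
    have e : φ ∘L T.ractCLM b = ρ ∘L φ := h.ext _ _ _ fun x y => by
      change φ (T.ract (β x y) b) = V.ract (φ (β x y)) b
      rw [h.ract, hφ, hφ, hr]
    exact DFunLike.congr_fun e t

theorem exists_hom (h : IsTens P N T β) {V : RightDGMod.{w, v₂, u} B}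
    (γ : P.carrier →ₗ[𝕜] N.carrier →ₗ[𝕜] V.carrier)
    (hγ : Continuous fun p : P.carrier × N.carrier => γ p.1 p.2)
    (hb : ∀ x a y, γ (P.ract x a) y = γ x (N.lact a y))
    (hdeg : ∀ m n x y, P.proj m x = x → N.proj n y = y → V.proj (m + n) (γ x y) = γ x y)
    (hr : ∀ x y b, γ x (N.ract y b) = V.ract (γ x y) b)
    (hd : ∀ x y, V.d (γ x y) = γ (P.d x) y + γ (P.koszul 1 x) (N.d y)) :
    ∃ f : T.Hom V, ∀ x y, f.toCLM (β x y) = γ x y := by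
  obtain ⟨φ, hφ, hφβ⟩ := h.exists_grMap 0 γ hγ hb
    (fun m n x y hx hy => by rw [add_zero, hdeg m n x y hx hy]) hr
  have e : φ ∘L T.d = V.d ∘L φ := h.ext _ _ _ fun x y => by
    rw [ContinuousLinearMap.comp_apply, ContinuousLinearMap.comp_apply, h.d, map_add, hφβ, hφβ,
      hφβ, hd]
  exact ⟨mkHom φ (fun n x => by rw [hφ.1, add_zero]) hφ.2 (DFunLike.congr_fun e), hφβ⟩

theorem exists_map (h : IsTens P N T β) (h' : IsTens P' N' T' β') (f : P.Hom P') (g : N.Hom N') :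
    ∃ F : T.Hom T', ∀ x y, F.toCLM (β x y) = β' (f.toCLM x) (g.toCLM y) := by
  refine h.exists_hom (β'.compl₁₂ f.toCLM.toLinearMap g.toCLM.toLinearMap)
    (h'.continuous.comp (f.toCLM.continuous.prodMap g.toCLM.continuous)) ?_ ?_ ?_ ?_
  · intro x a y
    change β' (f.toCLM (P.ract x a)) (g.toCLM y) = β' (f.toCLM x) (g.toCLM (N.lact a y))
    rw [f.map_ract, h'.balanced, g.map_lact]
  · intro m n x y hx hy
    refine h'.proj m n _ _ ?_ ?_
    · change P'.proj m (f.toCLM x) = f.toCLM x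
      rw [← f.map_proj, hx]
    · change N'.proj n (g.toCLM y) = g.toCLM y
      rw [← g.map_proj, hy]
  · intro x y b
    change β' (f.toCLM x) (g.toCLM (N.ract y b)) = T'.ract (β' (f.toCLM x) (g.toCLM y)) b
    rw [g.map_ract, h'.ract]
  · intro x y
    change T'.d (β' (f.toCLM x) (g.toCLM y)) = β' (f.toCLM (P.d x)) (g.toCLM y) +
      β' (f.toCLM (P.koszul 1 x)) (g.toCLM (N.d y))
    rw [h'.d, f.map_d, f.map_koszul, g.map_d]

/-- A homotopy `η` on the first factor induces the homotopy `η ⊗ id`, without a sign. -/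
theorem isContraacyclic_of_retract_left {β' : P'.carrier →ₗ[𝕜] N.carrier →ₗ[𝕜] T'.carrier}
    (h : IsTens P N T β) (h' : IsTens P' N T' β') (f : P.Hom P') (g : P'.Hom P)
    (hfg : Homotopic (g.comp f) (Hom.id P)) (hT' : T'.IsContraacyclic) : T.IsContraacyclic := by
  obtain ⟨F, hF⟩ := h.exists_map h' f (Hom.id N)
  obtain ⟨G, hG⟩ := h'.exists_map h g (Hom.id N)
  obtain ⟨η, hη, -, hηr, hηd⟩ := hfg
  have hη' : IsDeg P.toGrSpace P.toGrSpace (-1) η := isDeg_of_homog hη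
  obtain ⟨φ, hφ, hφβ⟩ := h.exists_grMap (V := T.toGrBimod) (-1) (β ∘ₗ η.toLinearMap)
    (h.continuous.comp (η.continuous.prodMap continuous_id))
    (fun x a y => by
      change β (η (P.ract x a)) y = β (η x) (N.lact a y)
      rw [hηr, h.balanced])
    (fun m n x y hx hy => by
      rw [add_right_comm]
      exact h.proj (m + -1) n _ _ (hη'.homog hx) hy)
    (fun x y b => (h.ract _ _ _).symm)
  refine .retract F G (homotopic_of φ hφ.1 hφ.2 fun t => ?_) hT'
  have e : G.toCLM ∘L F.toCLM - ContinuousLinearMap.id 𝕜 _ = T.d ∘L φ + φ ∘L T.d :=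
    h.ext _ _ _ fun x y => by
      change G.toCLM (F.toCLM (β x y)) - β x y = T.d (φ (β x y)) + φ (T.d (β x y))
      rw [hF, hG, hφβ, h.d, map_add, hφβ, hφβ]
      change β (g.toCLM (f.toCLM x)) y - β x y = T.d (β (η x) y) +
        (β (η (P.d x)) y + β (η (P.koszul 1 x)) (N.d y))
      have e2 : g.toCLM (f.toCLM x) - x = P.d (η x) + η (P.d x) := hηd x
      rw [h.d, hη'.map_koszul, ← LinearMap.map_sub₂, e2, LinearMap.map_add₂]
      simp
      abel
  exact DFunLike.congr_fun e t

/-- A homotopy of degree `-1` on the second factor has to pass `x`, so the induced one is `x ⊗ y ↦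
(-1)^|x| x ⊗ η y`. The same sign compensates the Koszul sign in the left linearity of `η`, which
makes the pairing balanced. -/
theorem isContraacyclic_of_retract_right {β' : P.carrier →ₗ[𝕜] N'.carrier →ₗ[𝕜] T'.carrier}
    (h : IsTens P N T β) (h' : IsTens P N' T' β') (f : N.Hom N') (g : N'.Hom N)
    (hfg : Homotopic (g.comp f) (Hom.id N)) (hT' : T'.IsContraacyclic) : T.IsContraacyclic := by
  obtain ⟨F, hF⟩ := h.exists_map h' (Hom.id P) f
  obtain ⟨G, hG⟩ := h'.exists_map h (Hom.id P) g
  obtain ⟨η, hη, hηl, hηr, hηd⟩ := hfg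
  have hη' : IsDeg N.toGrSpace N.toGrSpace (-1) η := isDeg_of_homog hη
  have hηl' : ∀ a y, η (N.lact a y) = N.lact (A.koszul 1 a) (η y) := fun a y => by
    have : η.toLinearMap ∘ₗ N.lact.flip y = N.lact.flip (η y) ∘ₗ (A.koszul 1).toLinearMap :=
      A.linear_ext (η.continuous.comp (N.continuous_lact_left y))
        ((N.continuous_lact_left (η y)).comp (A.koszul 1).continuous) fun n a ha => by
          refine (hηl n a y ha).trans ?_
          change _ = N.lact (A.koszul 1 a) (η y)
          rw [A.koszul_of_homog 1 n a ha, one_mul, map_zsmul, LinearMap.smul_apply]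
    exact LinearMap.congr_fun this a
  obtain ⟨φ, hφ, hφβ⟩ := h.exists_grMap (V := T.toGrBimod) (-1)
    (β.compl₁₂ (P.koszul 1).toLinearMap η.toLinearMap)
    (h.continuous.comp ((P.koszul 1).continuous.prodMap η.continuous))
    (fun x a y => by
      change β (P.koszul 1 (P.ract x a)) (η y) = β (P.koszul 1 x) (η (N.lact a y))
      rw [P.koszul_ract, h.balanced, hηl'])
    (fun m n x y hx hy => by
      rw [add_assoc]
      exact h.proj m (n + -1) _ _ (P.proj_koszul_homog 1 m x hx) (hη'.homog hy))
    (fun x y b => by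
      change β (P.koszul 1 x) (η (N.ract y b)) = T.ract (β (P.koszul 1 x) (η y)) b
      rw [hηr, h.ract])
  refine .retract F G (homotopic_of φ hφ.1 hφ.2 fun t => ?_) hT'
  have e : G.toCLM ∘L F.toCLM - ContinuousLinearMap.id 𝕜 _ = T.d ∘L φ + φ ∘L T.d :=
    h.ext _ _ _ fun x y => by
      change G.toCLM (F.toCLM (β x y)) - β x y = T.d (φ (β x y)) + φ (T.d (β x y))
      rw [hF, hG, hφβ, h.d, map_add, hφβ, hφβ]
      change β x (g.toCLM (f.toCLM y)) - β x y = T.d (β (P.koszul 1 x) (η y)) +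
        (β (P.koszul 1 (P.d x)) (η y) + β (P.koszul 1 (P.koszul 1 x)) (η (N.d y)))
      have e2 : g.toCLM (f.toCLM y) - y = N.d (η y) + η (N.d y) := hηd y
      rw [h.d, P.koszul_one_one, P.d_koszul, ← map_sub, e2, map_add]
      simp
      abel
  exact DFunLike.congr_fun e t

/-- Any model of the tensor product may be replaced by the constructed one. Each is a retract of the
other by the maps that the universal properties induce from the identities. -/
theorem isContraacyclic_iff (h : IsTens P N T β) :
    T.IsContraacyclic ↔ (tens P N).IsContraacyclic :=
  have e : Homotopic ((Hom.id P).comp (Hom.id P)) (Hom.id P) :=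
    homotopic_of 0 (fun _ _ => by simp) (fun _ _ => by simp) (fun _ => by simp)
  ⟨isTens_tens.isContraacyclic_of_retract_left h _ _ e,
    h.isContraacyclic_of_retract_left isTens_tens _ _ e⟩

/-- The left action on the shift carries a Koszul sign, which is absorbed by twisting the pairing
with `(-1)^(k|x|)`. This twist is its own inverse, so the universal property carries over. -/
theorem shift (h : IsTens P N T β) (k : ℤ) :
    IsTens P (N.shift k) (T.shift k) (β ∘ₗ (P.koszul k).toLinearMap) where
  continuous := h.continuous.comp ((P.koszul k).continuous.prodMap continuous_id)
  balanced x a y := by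
    change β (P.koszul k (P.ract x a)) y = β (P.koszul k x) (N.lact (A.koszul k a) y)
    rw [P.koszul_ract, h.balanced]
  proj m n x y hx hy := by
    have := h.proj m (n + k) _ y (P.proj_koszul_homog k m x hx) hy
    rwa [← add_assoc] at this
  d x y := by
    rw [shift_d, shift_d]
    change (k.negOnePow : ℤ) • T.d (β (P.koszul k x) y) = β (P.koszul k (P.d x)) y +
      β (P.koszul k (P.koszul 1 x)) ((k.negOnePow : ℤ) • N.d y)
    rw [h.d, P.isDeg_d.map_koszul, smul_add, map_zsmul, map_zsmul, LinearMap.smul_apply,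
      smul_smul, mul_one,
      eps_mul_self, one_smul, P.koszul_koszul, P.koszul_koszul, add_comm 1 k]
  ract x y b := h.ract _ y b
  exists_lift Z := by
    intro _ _ _ _ _ _ _ _ γ hγ hb
    obtain ⟨φ, hφ⟩ := h.exists_lift Z (γ ∘ₗ (P.koszul k).toLinearMap)
      (hγ.comp ((P.koszul k).continuous.prodMap continuous_id)) fun x a y => by
        change γ (P.koszul k (P.ract x a)) y = γ (P.koszul k x) (N.lact a y)
        rw [P.koszul_ract, hb]
        change γ _ (N.lact (A.koszul k (A.koszul k a)) y) = _
        rw [A.koszul_koszul, A.koszul_of_even ⟨k, rfl⟩]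
    refine ⟨φ, fun x y => ?_⟩
    change φ (β (P.koszul k x) y) = _
    rw [hφ]
    change γ (P.koszul k (P.koszul k x)) y = _
    rw [P.koszul_koszul, P.koszul_of_even ⟨k, rfl⟩]
  ext Z := by
    intro _ _ _ _ _ _ _ _ φ ψ e
    refine h.ext Z φ ψ fun x y => ?_
    have := e (P.koszul k x) y
    change φ (β (P.koszul k (P.koszul k x)) y) = ψ (β (P.koszul k (P.koszul k x)) y) at this
    rwa [P.koszul_koszul, P.koszul_of_even ⟨k, rfl⟩] at this

end Functor

section Cone

variable {A : DGAlg.{w, v} 𝕜} {B : DGAlg.{w, v₂} 𝕜} {P : RightDGMod.{w, v, u} A}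
    {M N : DGBimod.{w, v, v₂, u} A B} {S T : RightDGMod.{w, v₂, u} B}
    {α : P.carrier →ₗ[𝕜] M.carrier →ₗ[𝕜] S.carrier}
    {β : P.carrier →ₗ[𝕜] N.carrier →ₗ[𝕜] T.carrier}

/-- The pairing `x ⊗ (y, z) ↦ (x ⊗ y, (-1)^|x| x ⊗ z)`. -/
noncomputable def coneMk (P : RightDGMod.{w, v, u} A) {M N : DGBimod.{w, v, v₂, u} A B}
    {S T : RightDGMod.{w, v₂, u} B} (α : P.carrier →ₗ[𝕜] M.carrier →ₗ[𝕜] S.carrier)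
    (β : P.carrier →ₗ[𝕜] N.carrier →ₗ[𝕜] T.carrier) :
    P.carrier →ₗ[𝕜] N.carrier × M.carrier →ₗ[𝕜] T.carrier × S.carrier :=
  LinearMap.mk₂ 𝕜 (fun x y => (β x y.1, α (P.koszul 1 x) y.2)) (fun _ _ _ => by simp)
    (fun _ _ _ => by simp) (fun _ _ _ => by simp) (fun _ _ _ => by simp)

theorem cone (hS : IsTens P M S α) (hT : IsTens P N T β) (f : M.Hom N) (F : S.Hom T)
    (hF : ∀ x y, F.toCLM (α x y) = β x (f.toCLM y)) :
    IsTens P (DGBimod.cone f) (DGBimod.cone F) (coneMk P α β) := by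
  have hS' := hS.shift 1
  have hd : ∀ x y, (DGBimod.cone F).d (coneMk P α β x y) =
      coneMk P α β (P.d x) y + coneMk P α β (P.koszul 1 x) ((DGBimod.cone f).d y) := by
    rintro x ⟨y, z⟩
    refine Prod.ext ?_ (hS'.d x z)
    change T.d (β x y) + F.toCLM (α (P.koszul 1 x) z) =
      β (P.d x) y + β (P.koszul 1 x) (N.d y + f.toCLM z)
    rw [hT.d, hF, map_add, add_assoc]
  refine ⟨?_, ?_, ?_, hd, ?_, ?_, ?_⟩
  · exact (hT.continuous.comp (continuous_fst.prodMk (continuous_fst.comp continuous_snd))).prodMk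
      (hS'.continuous.comp (continuous_fst.prodMk (continuous_snd.comp continuous_snd)))
  · exact fun x a y => Prod.ext (hT.balanced x a y.1) (hS'.balanced x a y.2)
  · exact fun m n x y hx hy => Prod.ext (hT.proj m n x y.1 hx (congrArg Prod.fst hy))
      (hS'.proj m n x y.2 hx (congrArg Prod.snd hy))
  · exact fun x y b => Prod.ext (hT.ract x y.1 b) (hS'.ract x y.2 b)
  · intro Z _ _ _ _ _ _ _ _ γ hγ hb
    obtain ⟨φ₁, h1⟩ := hT.exists_lift Z (γ.compl₂ (LinearMap.inl 𝕜 N.carrier M.carrier))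
      (hγ.comp (continuous_fst.prodMk (continuous_snd.prodMk continuous_const)))
      fun x a y => (hb x a (y, 0)).trans (by
        refine congrArg (γ x) (Prod.ext rfl ?_)
        exact map_zero (M.lact (A.koszul 1 a)))
    obtain ⟨φ₂, h2⟩ := hS'.exists_lift Z (γ.compl₂ (LinearMap.inr 𝕜 N.carrier M.carrier))
      (hγ.comp (continuous_fst.prodMk (continuous_const.prodMk continuous_snd)))
      fun x a y => (hb x a (0, y)).trans (by
        refine congrArg (γ x) (Prod.ext ?_ rfl)
        exact map_zero (N.lact a))
    refine ⟨φ₁.coprod φ₂, fun x y => ?_⟩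
    change φ₁ (β x y.1) + φ₂ ((α ∘ₗ (P.koszul 1).toLinearMap) x y.2) = γ x y
    rw [h1, h2]
    change γ x (y.1, 0) + γ x (0, y.2) = γ x y
    rw [← map_add]
    refine congrArg (γ x) (Prod.ext (add_zero y.1) (zero_add y.2))
  · intro Z _ _ _ _ _ _ _ _ φ ψ e
    have e1 := hT.ext Z (φ ∘L ContinuousLinearMap.inl 𝕜 T.carrier S.carrier)
      (ψ ∘L ContinuousLinearMap.inl 𝕜 T.carrier S.carrier) fun x y => by
        have := e x (y, 0)
        change φ (β x y, α (P.koszul 1 x) 0) = ψ (β x y, α (P.koszul 1 x) 0) at this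
        rw [map_zero] at this
        exact this
    have e2 := hS'.ext Z (φ ∘L ContinuousLinearMap.inr 𝕜 T.carrier S.carrier)
      (ψ ∘L ContinuousLinearMap.inr 𝕜 T.carrier S.carrier) fun x y => by
        have := e x (0, y)
        change φ (β x 0, α (P.koszul 1 x) y) = ψ (β x 0, α (P.koszul 1 x) y) at this
        rw [map_zero] at this
        exact this
    exact ContinuousLinearMap.prod_ext e1 e2

end Cone

section Pi

variable {A : DGAlg.{w, v} 𝕜} {B : DGAlg.{w, v₂} 𝕜} {P : RightDGMod.{w, v, u} A} {ι : Type u}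
    {N : ι → DGBimod.{w, v, v₂, u} A B} {T : ι → RightDGMod.{w, v₂, u} B}
    {β : ∀ i, P.carrier →ₗ[𝕜] (N i).carrier →ₗ[𝕜] (T i).carrier}

/-- The pairing `x ⊗ (yᵢ) ↦ (x ⊗ yᵢ)`. -/
noncomputable def piMk {P : RightDGMod.{w, v, u} A} {N : ι → DGBimod.{w, v, v₂, u} A B}
    {T : ι → RightDGMod.{w, v₂, u} B}
    (β : ∀ i, P.carrier →ₗ[𝕜] (N i).carrier →ₗ[𝕜] (T i).carrier) :
    P.carrier →ₗ[𝕜] (∀ i, (N i).carrier) →ₗ[𝕜] ∀ i, (T i).carrier :=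
  LinearMap.mk₂ 𝕜 (fun x y i => β i x (y i)) (fun _ _ _ => by ext; simp)
    (fun _ _ _ => by ext; simp) (fun _ _ _ => by ext; simp) (fun _ _ _ => by ext; simp)

theorem hasSum_single {V : ι → Type*} [DecidableEq ι] [∀ i, AddCommMonoid (V i)]
    [∀ i, TopologicalSpace (V i)] (y : ∀ i, V i) : HasSum (fun i => Pi.single i (y i)) y := by
  refine Pi.hasSum.2 fun j => ?_
  have : (fun i => (Pi.single i (y i) : ∀ i, V i) j) = fun i => if i = j then y j else 0 := by
    funext i
    split_ifs with h
    · subst h; simp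
    · simp [Pi.single_eq_of_ne (Ne.symm h)]
  rw [this]
  exact hasSum_ite_eq j (y j)

/-- Completed tensor products commute with arbitrary products. A continuous seminorm composed with a
continuous pairing out of `P × ∏ Nᵢ` vanishes on all but finitely many factors, so the lifts on the
factors have a continuous sum. Uniqueness holds because an element of the product is the sum of its
components. -/
theorem pi (h : ∀ i, IsTens P (N i) (T i) (β i)) :
    IsTens P (DGBimod.pi N) (DGBimod.pi T) (piMk β) where
  continuous := continuous_pi fun i => (h i).continuous.comp
    (continuous_fst.prodMk ((continuous_apply i).comp continuous_snd))
  balanced x a y := funext fun i => (h i).balanced x a (y i)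
  proj m n x y hx hy := funext fun i => (h i).proj m n x (y i) hx (congrFun hy i)
  d x y := funext fun i => (h i).d x (y i)
  ract x y b := funext fun i => (h i).ract x (y i) b
  exists_lift Z := by
    classical
    intro _ _ _ _ _ _ _ _ γ hγ hb
    have hγ' : ∀ i, Continuous fun p : P.carrier × (N i).carrier =>
        (γ.compl₂ (LinearMap.single 𝕜 (fun i => (N i).carrier) i)) p.1 p.2 := fun i =>
      hγ.comp (continuous_id.prodMap
        (ContinuousLinearMap.single 𝕜 (fun i => (N i).carrier) i).continuous)
    have h1 := fun i => (h i).exists_lift Z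
      (γ.compl₂ (LinearMap.single 𝕜 (fun i => (N i).carrier) i)) (hγ' i)
      fun x a y => (hb x a _).trans (by
        refine congrArg (γ x) (funext fun j => ?_)
        change (N j).lact a (Pi.single (M := fun i => (N i).carrier) i y j) =
          Pi.single (M := fun i => (N i).carrier) i ((N i).lact a y) j
        by_cases hj : j = i
        · subst hj; simp
        · simp [Pi.single_eq_of_ne hj])
    choose φ hφ using h1
    -- Smallness is known for pure tensors only. It is extended to all of `T i` by composing with
    -- the completion for `q` and using uniqueness of lifts.
    obtain ⟨Φ, hΦ⟩ := exists_clm_hasSum (fun i => φ i ∘L ContinuousLinearMap.proj i) fun q hq => by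
      obtain ⟨S, hS⟩ := (isSmallFamily_single (𝕜 := 𝕜) (V := fun i => (N i).carrier)).bilinear γ
        hγ q hq
      refine ⟨S, fun i hi t => ?_⟩
      let Q : Z →L[𝕜] UniformSpace.Completion (WithSeminorm q) :=
        ⟨toSeminormCompletion q, continuous_toSeminormCompletion q hq⟩
      have e : Q ∘L φ i = 0 := (h i).ext _ _ _ fun x y => by
        refine norm_eq_zero.1 ((norm_toSeminormCompletion q _).trans ?_)
        change q (φ i (β i x y)) = 0
        rw [hφ]
        exact hS i hi x y
      change q (φ i (t i)) = 0
      rw [← norm_toSeminormCompletion q]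
      exact norm_eq_zero.2 (DFunLike.congr_fun e (t i))
    refine ⟨Φ, fun x y => (hΦ _).unique ?_⟩
    have := (hasSum_single y).map (γ x) (hγ.comp (continuous_const.prodMk continuous_id))
    convert this using 2 with i
    exact hφ i x (y i)
  ext Z := by
    classical
    intro _ _ _ _ _ _ _ _ φ ψ e
    have e1 : ∀ i, φ ∘L ContinuousLinearMap.single 𝕜 (fun i => (T i).carrier) i =
        ψ ∘L ContinuousLinearMap.single 𝕜 (fun i => (T i).carrier) i := fun i =>
      (h i).ext Z _ _ fun x y => by
        have := e x (Pi.single i y)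
        have e3 : piMk β x (Pi.single i y) =
            ContinuousLinearMap.single 𝕜 (fun i => (T i).carrier) i (β i x y) := by
          funext j
          change β j x (Pi.single (M := fun i => (N i).carrier) i y j) =
            Pi.single (M := fun i => (T i).carrier) i (β i x y) j
          by_cases hj : j = i
          · subst hj; simp
          · simp [Pi.single_eq_of_ne hj]
        rwa [e3] at this
    refine ContinuousLinearMap.ext fun t => ?_
    refine ((hasSum_single t).map φ φ.continuous).unique ?_
    convert (hasSum_single t).map ψ ψ.continuous using 1
    funext i
    exact DFunLike.congr_fun (e1 i) (t i)

end Pi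

section Regular

variable {A B : DGAlg.{w, u} 𝕜} {P : RightDGMod.{w, u, u} A} {T : RightDGMod.{w, u, u} B}
  {f : A.Hom B}

theorem regular (P : RightDGMod.{w, u, u} A) : IsTens P (DGBimod.regular A) P P.ract where
  continuous := P.continuous_ract
  balanced x a y := (P.ract_mul x a y).symm
  proj := P.proj_ract
  d := P.d_ract'
  ract x y b := (P.ract_mul x y b).symm
  exists_lift Z := by
    intro _ _ _ _ _ _ _ _ γ hγ hb
    refine ⟨⟨γ.flip A.one, hγ.comp (continuous_id.prodMk continuous_const)⟩, fun x y => ?_⟩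
    refine (hb x y A.one).trans (congrArg (γ x) (A.mul_one y))
  ext Z := by
    intro _ _ _ _ _ _ _ _ φ ψ e
    refine ContinuousLinearMap.ext fun x => ?_
    have := e x A.one
    rwa [P.ract_one] at this

/-- The universal property does not mention the right action, so restricting that action on both
sides preserves the tensor product. This exhibits the restriction of `P ⊗ B` to `A` as the tensor
product with the bimodule that occurs in the Čech complex. -/
theorem restrict {β : P.carrier →ₗ[𝕜] B.carrier →ₗ[𝕜] T.carrier}
    (h : IsTens P ((DGBimod.regular B).restrict f (DGAlg.Hom.id B)) T β) :
    IsTens P ((DGBimod.regular B).restrict f f) (T.restrict (DGAlg.Hom.id _) f) β where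
  continuous := h.continuous
  balanced := h.balanced
  proj := h.proj
  d := h.d
  ract x y b := h.ract x y (f.toCLM b)
  exists_lift := h.exists_lift
  ext := h.ext

end Regular

end IsTens

end DGModules

/-! ### Free modules and graded projectivity. -/

section DGModules

variable {𝕜 : Type w} [RCLike 𝕜]

open GrSpace

namespace RightDGMod

open DGBimod

section Free

variable {A : DGAlg.{w, u} 𝕜}

/-- The underlying complex of a dg-module. -/
noncomputable def overGround (M : RightDGMod.{w, u, u} A) :
    RightDGMod.{w, w, u} (DGAlg.ground 𝕜) :=
  ofRight M.toGrSpace (LinearMap.lsmul 𝕜 M.carrier).flip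
    (continuous_snd.smul continuous_fst : Continuous fun p : M.carrier × 𝕜 => p.2 • p.1)
    (fun x => one_smul 𝕜 x) (fun x a b => by
      change (scalar a * scalar b) • x = scalar b • scalar a • x
      rw [mul_comm, mul_smul])
    (fun m n x b hx hb => by
      change M.proj (m + n) (scalar b • x) = scalar b • x
      by_cases hn : n = 0
      · rw [hn, add_zero, map_smul, hx]
      · rw [scalar_eq_zero hn hb, zero_smul, map_zero])
    M.d M.proj_d M.d_d (fun n x b _ => by
      change M.d (scalar b • x) = scalar b • M.d x + (n.negOnePow : ℤ) • (0 : 𝕜) • x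
      rw [zero_smul, smul_zero, add_zero, map_smul])

/-- A dg-algebra as a right module over itself. -/
noncomputable def ofSelf (A : DGAlg.{w, u} 𝕜) : RightDGMod.{w, u, u} A :=
  ofRight A.toGrSpace A.mul A.continuous_mul A.mul_one (fun x a b => (A.mul_assoc x a b).symm)
    A.proj_mul A.d A.proj_d A.d_d A.d_mul

/-- The free dg-module `M ⊗ A` on the underlying complex of `M`. -/
noncomputable def free (M : RightDGMod.{w, u, u} A) : RightDGMod.{w, u, u} A :=
  tens (overGround M) (ofSelf A)

noncomputable def freeMk (M : RightDGMod.{w, u, u} A) :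
    M.carrier →ₗ[𝕜] A.carrier →ₗ[𝕜] (free M).carrier :=
  tensMk (overGround M) (ofSelf A)

variable (M : RightDGMod.{w, u, u} A)

theorem isTens_free : IsTens (overGround M) (ofSelf A) (free M) (freeMk M) := isTens_tens

theorem continuous_freeMk : Continuous fun p : M.carrier × A.carrier => freeMk M p.1 p.2 :=
  (isTens_free M).continuous

theorem free_ract (x : M.carrier) (a b : A.carrier) :
    (free M).ract (freeMk M x a) b = freeMk M x (A.mul a b) := (isTens_free M).ract x a b

theorem free_proj {m n : ℤ} {x : M.carrier} {a : A.carrier} (hx : M.proj m x = x)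
    (ha : A.proj n a = a) : (free M).proj (m + n) (freeMk M x a) = freeMk M x a :=
  (isTens_free M).proj m n x a hx ha

variable {M}

theorem free_ext {Z : Type u} [AddCommGroup Z] [Module 𝕜 Z] [UniformSpace Z]
    [IsUniformAddGroup Z] [ContinuousSMul 𝕜 Z] [PolynormableSpace 𝕜 Z] [T2Space Z]
    [CompleteSpace Z] {φ ψ : (free M).carrier →L[𝕜] Z}
    (h : ∀ x a, φ (freeMk M x a) = ψ (freeMk M x a)) : φ = ψ := (isTens_free M).ext Z φ ψ h

/-- Graded linear maps extend to morphisms out of the free module. -/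
theorem exists_free_lift {V : GrBimod.{w, w, u, u} (DGAlg.ground 𝕜).toGrAlg A.toGrAlg} {j : ℤ}
    (f : M.carrier →L[𝕜] V.carrier) (hf : IsDeg M.toGrSpace V.toGrSpace j f) :
    ∃ φ : (free M).carrier →L[𝕜] V.carrier, IsGrMap (free M).toGrBimod V j φ ∧
      ∀ x a, φ (freeMk M x a) = V.ract (f x) a := by
  refine (isTens_free M).exists_grMap j (V.ract ∘ₗ f.toLinearMap)
    (V.continuous_ract.comp (f.continuous.prodMap continuous_id)) ?_ ?_ ?_
  · intro (x : M.carrier) a (y : A.carrier)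
    change V.ract (f (scalar a • x)) y = V.ract (f x) (scalar a • y)
    rw [map_smul, map_smul, map_smul, LinearMap.smul_apply]
  · intro m n x y hx hy
    rw [add_right_comm]
    exact V.proj_ract (m + j) n _ _ (hf.homog hx) hy
  · intro x y b
    exact V.ract_mul _ _ _

/-- To lift a morphism out of a free module only a graded linear map on the generators `x ⊗ 1` has
to be lifted. The linear section does this. -/
theorem free_isProjective (M : RightDGMod.{w, u, u} A) : (free M).toGrBimod.IsProjective := by
  intro X Y p s hs hps f
  let i : M.carrier →L[𝕜] (free M).carrier :=
    ⟨(freeMk M).flip A.one, (continuous_freeMk M).comp (continuous_id.prodMk continuous_const)⟩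
  have hi : IsDeg M.toGrSpace (free M).toGrSpace 0 i := isDeg_of_homog fun n x hx => by
    rw [add_zero]
    have := free_proj M hx A.proj_one
    rwa [add_zero] at this
  have hs' : IsDeg Y.toGrSpace X.toGrSpace 0 s := fun n y => by rw [hs, add_zero]
  obtain ⟨φ, hφ, h⟩ := exists_free_lift (V := X) (s ∘L f.toCLM ∘L i)
    (hs'.comp (f.isDeg.comp hi (m := 0)) (m := 0))
  refine ⟨mkGrHom φ (fun n x => by rw [hφ.1, add_zero]) hφ.2, fun t => ?_⟩
  have : p.toCLM ∘L φ = f.toCLM := free_ext fun x a => by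
    change p.toCLM (φ (freeMk M x a)) = f.toCLM (freeMk M x a)
    rw [h, p.map_ract]
    change Y.ract (p.toCLM (s (f.toCLM (freeMk M x A.one)))) a = _
    rw [hps, ← f.map_ract, free_ract, A.one_mul]
  exact DFunLike.congr_fun this t

theorem exists_freeCounit (M : RightDGMod.{w, u, u} A) :
    ∃ f : (free M).Hom M, ∀ x a, f.toCLM (freeMk M x a) = M.ract x a := by
  obtain ⟨φ, hφ, h⟩ := exists_free_lift (M := M) (V := M.toGrBimod) (j := 0)
    (ContinuousLinearMap.id 𝕜 _) (fun n x => by rw [add_zero]; rfl)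
  have : φ ∘L (free M).d = M.d ∘L φ := free_ext fun x a => by
    refine (congrArg φ ((isTens_free M).d x a)).trans ?_
    change φ (freeMk M (M.d x) a + freeMk M (M.koszul 1 x) (A.d a)) = M.d (φ (freeMk M x a))
    rw [map_add, h, h, h]
    exact (M.d_ract' x a).symm
  exact ⟨mkHom φ (fun n x => by rw [hφ.1, add_zero]) hφ.2 (DFunLike.congr_fun this), h⟩

noncomputable def freeCounit (M : RightDGMod.{w, u, u} A) : (free M).Hom M :=
  (exists_freeCounit M).choose

theorem freeCounit_mk (x : M.carrier) (a : A.carrier) :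
    (freeCounit M).toCLM (freeMk M x a) = M.ract x a := (exists_freeCounit M).choose_spec x a

/-- The section `x ↦ x ⊗ 1` of the counit. -/
noncomputable def freeUnit (M : RightDGMod.{w, u, u} A) : M.carrier →L[𝕜] (free M).carrier :=
  ⟨(freeMk M).flip A.one, (continuous_freeMk M).comp (continuous_id.prodMk continuous_const)⟩

theorem freeUnit_apply (x : M.carrier) : freeUnit M x = freeMk M x A.one := rfl

theorem freeUnit_proj (n : ℤ) (x : M.carrier) :
    freeUnit M (M.proj n x) = (free M).proj n (freeUnit M x) := by
  have : IsDeg M.toGrSpace (free M).toGrSpace 0 (freeUnit M) := isDeg_of_homog fun n x hx => by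
    rw [add_zero]
    have := free_proj M hx A.proj_one
    rwa [add_zero] at this
  rw [this, add_zero]

theorem freeCounit_freeUnit (x : M.carrier) : (freeCounit M).toCLM (freeUnit M x) = x := by
  rw [freeUnit_apply, freeCounit_mk, M.ract_one]

theorem isProjective_of_retract
    {P Q : GrBimod.{w, w, u, u} (DGAlg.ground 𝕜).toGrAlg A.toGrAlg} (hQ : Q.IsProjective)
    (i : P.Hom Q) (r : Q.Hom P) (h : ∀ x, r.toCLM (i.toCLM x) = x) : P.IsProjective := by
  intro X Y p s hs hps f
  obtain ⟨g, hg⟩ := hQ X Y p s hs hps (mkGrHom (f.toCLM ∘L r.toCLM)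
    (fun n x => by simp [r.map_proj, f.map_proj]) (fun x b => by simp [r.map_ract, f.map_ract]))
  refine ⟨mkGrHom (g.toCLM ∘L i.toCLM)
    (fun n x => by simp [i.map_proj, g.map_proj]) (fun x b => by simp [i.map_ract, g.map_ract]),
    fun x => (hg (i.toCLM x)).trans ?_⟩
  change f.toCLM (r.toCLM (i.toCLM x)) = _
  rw [h]

/-- A module is graded-projective exactly when the counit of its free cover splits. -/
theorem isProjective_iff_exists_section {P : RightDGMod.{w, u, u} A} :
    P.toGrBimod.IsProjective ↔ ∃ σ : P.carrier →L[𝕜] (free P).carrier,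
      IsGrMap P.toGrBimod (free P).toGrBimod 0 σ ∧ ∀ x, (freeCounit P).toCLM (σ x) = x := by
  constructor
  · intro hP
    obtain ⟨g, hg⟩ := hP (free P).toGrBimod P.toGrBimod (freeCounit P).toHom (freeUnit P)
      freeUnit_proj freeCounit_freeUnit (mkGrHom (ContinuousLinearMap.id 𝕜 _) (fun _ _ => rfl)
        (fun _ _ => rfl))
    exact ⟨g.toCLM, g.isGrMap, hg⟩
  · rintro ⟨σ, hσ, h⟩
    exact isProjective_of_retract (free_isProjective P)
      (mkGrHom σ (fun n x => by rw [hσ.1, add_zero]) hσ.2) (freeCounit P).toHom h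

theorem isProjective_shift {P : RightDGMod.{w, u, u} A} (hP : P.toGrBimod.IsProjective) (k : ℤ) :
    (P.shift k).toGrBimod.IsProjective := by
  intro X Y p s hs hps f
  obtain ⟨ψ, hψ, h⟩ := exists_lift_of_isProjective (k := -k) hP p s hs hps
    (φ := f.toCLM) ⟨fun n x => by
      have := f.map_proj (n + -k) x
      rw [← this]
      change f.toCLM _ = f.toCLM (P.proj (n + -k + k) x)
      rw [neg_add_cancel_right], f.map_ract⟩
  refine ⟨mkGrHom (M := (P.shift k).toGrBimod) ψ (fun n x => ?_) hψ.2, h⟩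
  refine (hψ.1 (n + k) x).trans ?_
  rw [add_neg_cancel_right]

/-- Unlike for modules over a general ring, products of projectives remain projective here. Sections
`σᵢ` of the free covers of the factors are pushed into the free cover of the product and added. The
sum converges because a continuous seminorm on that free module sees only finitely many coordinates.
-/
theorem isProjective_pi {ι : Type u} {P : ι → RightDGMod.{w, u, u} A}
    (hP : ∀ i, (P i).toGrBimod.IsProjective) : (DGBimod.pi P).toGrBimod.IsProjective := by
  classical
  choose σ hσ h using fun i => isProjective_iff_exists_section.1 (hP i)
  let e : ∀ i, (P i).carrier →L[𝕜] (DGBimod.pi P).carrier := fun i =>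
    ContinuousLinearMap.single 𝕜 (fun i => (P i).carrier) i
  have e_apply : ∀ i x j, e i x j = if hj : j = i then hj ▸ x else 0 := fun i x j => by
    change Pi.single (M := fun i => (P i).carrier) i x j = _
    split_ifs with hj
    · subst hj; simp
    · simp [Pi.single_eq_of_ne hj]
  have he : ∀ i, IsGrMap (P i).toGrBimod (DGBimod.pi P).toGrBimod 0 (e i) := fun i => by
    refine ⟨fun n x => funext fun j => ?_, fun x b => funext fun j => ?_⟩
    · change e i ((P i).proj n x) j = (P j).proj (n + 0) (e i x j)
      rw [e_apply, e_apply, add_zero]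
      split_ifs with hj
      · subst hj; rfl
      · rw [map_zero]
    · change e i ((P i).ract x b) j = (P j).ract (e i x j) b
      rw [e_apply, e_apply]
      split_ifs with hj
      · subst hj; rfl
      · rw [LinearMap.map_zero₂]
  let F := free (DGBimod.pi P)
  have hlift := fun i => exists_free_lift (M := P i) (V := F.toGrBimod) (j := 0)
    (freeUnit (DGBimod.pi P) ∘L e i) (by
      have : IsDeg (DGBimod.pi P).toGrSpace F.toGrSpace 0 (freeUnit (DGBimod.pi P)) := fun n x => by
        rw [freeUnit_proj, add_zero]
      exact this.comp (he i).1 (m := 0))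
  choose φ hφ hφmk using hlift
  have hφmk' : ∀ i x a, φ i (freeMk (P i) x a) = freeMk (DGBimod.pi P) (e i x) a := fun i x a => by
    rw [hφmk]
    change F.ract (freeMk (DGBimod.pi P) (e i x) A.one) a = _
    exact (free_ract _ _ _ _).trans (by rw [A.one_mul])
  -- The candidate section is `t ↦ ∑ᵢ φᵢ (σᵢ (tᵢ))`. Vanishing of `q ∘ φᵢ` for almost all `i` is
  -- checked on pure tensors, where it is smallness of the coordinate inclusions.
  obtain ⟨Φ, hΦ⟩ := exists_clm_hasSum
    (fun i => (φ i ∘L σ i) ∘L ContinuousLinearMap.proj (φ := fun i => (P i).carrier) i)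
    fun q hq => by
      obtain ⟨S, hS⟩ := (isSmallFamily_single (𝕜 := 𝕜) (V := fun i => (P i).carrier)).bilinear
        (freeMk (DGBimod.pi P)).flip ((continuous_freeMk (DGBimod.pi P)).comp continuous_swap) q hq
      refine ⟨S, fun i hi t => ?_⟩
      let Q : F.carrier →L[𝕜] UniformSpace.Completion (WithSeminorm q) :=
        ⟨toSeminormCompletion q, continuous_toSeminormCompletion q hq⟩
      have e0 : Q ∘L φ i = 0 := free_ext fun x a => by
        refine norm_eq_zero.1 ((norm_toSeminormCompletion q _).trans ?_)
        change q (φ i (freeMk (P i) x a)) = 0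
        rw [hφmk']
        exact hS i hi a x
      change q (φ i (σ i (t i))) = 0
      rw [← norm_toSeminormCompletion q]
      exact norm_eq_zero.2 (DFunLike.congr_fun e0 (σ i (t i)))
  have hΨ : ∀ i, IsGrMap (P i).toGrBimod F.toGrBimod 0 (φ i ∘L σ i) := fun i =>
    (hφ i).comp (hσ i) (m := 0)
  refine isProjective_iff_exists_section.2 ⟨Φ, ⟨fun n t => ?_, fun t b => ?_⟩, fun t => ?_⟩
  · refine (hΦ _).unique ?_
    convert (hΦ t).map (F.proj (n + 0)) (F.proj (n + 0)).continuous using 1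
    funext i
    exact (hΨ i).1 n (t i)
  · refine (hΦ _).unique ?_
    convert (hΦ t).map (F.ractCLM b) (F.ractCLM b).continuous using 1
    · funext i
      exact (hΨ i).2 (t i) b
    · rfl
  -- The counit sends the `i`-th summand to the `i`-th component of `t`, and these components add up
  -- to `t`.
  · have hs : HasSum (fun i => e i (t i)) t := IsTens.hasSum_single t
    have h2 := (hΦ t).map (freeCounit (DGBimod.pi P)).toCLM
      (freeCounit (DGBimod.pi P)).toCLM.continuous
    have e2 : ((freeCounit (DGBimod.pi P)).toCLM ∘ fun i => ((φ i ∘L σ i) ∘L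
        ContinuousLinearMap.proj (φ := fun i => (P i).carrier) i) t) = fun i => e i (t i) := by
      funext i
      have e1 : (freeCounit (DGBimod.pi P)).toCLM ∘L φ i = e i ∘L (freeCounit (P i)).toCLM :=
        free_ext fun x a => by
          change (freeCounit (DGBimod.pi P)).toCLM (φ i (freeMk (P i) x a)) =
            e i ((freeCounit (P i)).toCLM (freeMk (P i) x a))
          rw [hφmk', freeCounit_mk, freeCounit_mk, (he i).2]
      refine (DFunLike.congr_fun e1 (σ i (t i))).trans ?_
      change e i ((freeCounit (P i)).toCLM (σ i (t i))) = e i (t i)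
      rw [h]
    rw [e2] at h2
    exact h2.unique hs

end Free

end RightDGMod

end DGModules

/-! ### Exactness of tensoring with a graded-projective module. -/

section DGModules

variable {𝕜 : Type w} [RCLike 𝕜]

open GrSpace

namespace RightDGMod

open DGBimod

section Exact

variable {A : DGAlg.{w, u} 𝕜} {B : DGAlg.{w, v₂} 𝕜} {P : RightDGMod.{w, u, u} A}
  {L M N : DGBimod.{w, u, v₂, u} A B}

/-- The universal pairing into the tensor product. -/
noncomputable def tensPair (P : RightDGMod.{w, u, u} A) (N : DGBimod.{w, u, v₂, u} A B) :
    P.carrier →ₗ[𝕜] N.carrier →ₗ[𝕜] (tens P N).carrier := tensMk P N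

theorem isTens_tensPair : IsTens P N (tens P N) (tensPair P N) := isTens_tens

/-- A linear map `f` induces a pairing `(x ⊗ a, y) ↦ x ⊗ f (a y)` on the free cover of `P`. -/
theorem exists_freePairing (P : RightDGMod.{w, u, u} A) (f : L.carrier →L[𝕜] N.carrier) :
    ∃ Θ : (free P).carrier →ₗ[𝕜] L.carrier →ₗ[𝕜] (tens P N).carrier,
      (Continuous fun z : (free P).carrier × L.carrier => Θ z.1 z.2) ∧
      ∀ x a y, Θ (freeMk P x a) y = tensPair P N x (f (L.lact a y)) := by
  let τ : L.carrier →ₗ[𝕜] P.carrier →ₗ[𝕜] A.carrier →ₗ[𝕜] (tens P N).carrier :=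
    LinearMap.mk₂ 𝕜 (fun y x => tensPair P N x ∘ₗ f.toLinearMap ∘ₗ L.lact.flip y)
      (fun _ _ _ => by ext; simp) (fun _ _ _ => by ext; simp) (fun _ _ _ => by ext; simp)
      (fun _ _ _ => by ext; simp)
  refine tensMk_lift_trilinear (Z := (tens P N).carrier) (P := overGround P) (N := ofSelf A) τ ?_ ?_
  · exact isTens_tensPair.continuous.comp ((continuous_fst.comp continuous_snd).prodMk
      (f.continuous.comp (L.continuous_lact.comp
        ((continuous_snd.comp continuous_snd).prodMk continuous_fst))))
  · intro l (x : P.carrier) c (a : A.carrier)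
    change tensPair P N (scalar c • x) (f (L.lact a l)) =
      tensPair P N x (f (L.lact (scalar c • a) l))
    rw [map_smul, map_smul, LinearMap.smul_apply, LinearMap.smul_apply, map_smul, map_smul]

variable (P) in
noncomputable def freePairing (f : L.carrier →L[𝕜] N.carrier) :
    (free P).carrier →ₗ[𝕜] L.carrier →ₗ[𝕜] (tens P N).carrier := (exists_freePairing P f).choose

theorem continuous_freePairing (f : L.carrier →L[𝕜] N.carrier) :
    Continuous fun z : (free P).carrier × L.carrier => freePairing P f z.1 z.2 :=
  (exists_freePairing P f).choose_spec.1

theorem freePairing_mk (f : L.carrier →L[𝕜] N.carrier) (x : P.carrier) (a : A.carrier)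
    (y : L.carrier) : freePairing P f (freeMk P x a) y = tensPair P N x (f (L.lact a y)) :=
  (exists_freePairing P f).choose_spec.2 x a y

noncomputable def freePairingCLM (f : L.carrier →L[𝕜] N.carrier) (y : L.carrier) :
    (free P).carrier →L[𝕜] (tens P N).carrier :=
  ⟨(freePairing P f).flip y,
    (continuous_freePairing f).comp (continuous_id.prodMk continuous_const)⟩

/-- The pairing is balanced although `f` is only linear over the field. The algebra acts on the free
module through its second factor, whose element is applied to `y` before `f` is. Pulling back along
a section `P → free P` therefore makes sense of "`id ⊗ f`" over the algebra. -/
theorem freePairing_ract (f : L.carrier →L[𝕜] N.carrier) (t : (free P).carrier) (a : A.carrier)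
    (y : L.carrier) : freePairing P f ((free P).ract t a) y = freePairing P f t (L.lact a y) := by
  have : freePairingCLM f y ∘L (free P).ractCLM a = freePairingCLM f (L.lact a y) :=
    free_ext fun x b => by
      change freePairing P f ((free P).ract (freeMk P x b) a) y =
        freePairing P f (freeMk P x b) (L.lact a y)
      rw [free_ract, freePairing_mk, freePairing_mk, L.mul_lact]
  exact DFunLike.congr_fun this t

theorem freePairing_proj {f : L.carrier →L[𝕜] N.carrier}
    (hf : IsDeg L.toGrSpace N.toGrSpace 0 f) {m n : ℤ} {t : (free P).carrier} {y : L.carrier}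
    (ht : (free P).proj m t = t) (hy : L.proj n y = y) :
    (tens P N).proj (m + n) (freePairing P f t y) = freePairing P f t y := by
  have : IsDeg (free P).toGrSpace (tens P N).toGrSpace n (freePairingCLM f y) :=
    (isTens_free P).isDeg_of fun k l (x : P.carrier) (a : A.carrier) hx ha => by
      change (tens P N).proj _ (freePairing P f (freeMk P x a) y) =
        freePairing P f (freeMk P x a) y
      rw [freePairing_mk, add_assoc]
      refine isTens_tensPair.proj k (l + n) x _ hx (hf.homog (L.proj_lact _ _ _ _ ha hy))
  exact this.homog ht

/-- The map on tensor products induced by a linear map, for a section `σ` of the free cover. -/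
theorem exists_tensLinear {σ : P.carrier →L[𝕜] (free P).carrier}
    (hσ : IsGrMap P.toGrBimod (free P).toGrBimod 0 σ) {f : L.carrier →L[𝕜] N.carrier}
    (hf : ∀ n y, f (L.proj n y) = N.proj n (f y)) :
    ∃ φ : (tens P L).carrier →L[𝕜] (tens P N).carrier,
      (∀ n t, φ ((tens P L).proj n t) = (tens P N).proj n (φ t)) ∧
      ∀ x y, φ (tensPair P L x y) = freePairing P f (σ x) y := by
  obtain ⟨φ, hφ⟩ := isTens_tensPair.exists_lift (tens P N).carrier
    (freePairing P f ∘ₗ σ.toLinearMap)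
    ((continuous_freePairing f).comp (σ.continuous.prodMap continuous_id)) fun x a y => by
      change freePairing P f (σ (P.ract x a)) y = freePairing P f (σ x) (L.lact a y)
      rw [hσ.2, freePairing_ract]
  have : IsDeg (tens P L).toGrSpace (tens P N).toGrSpace 0 φ :=
    isTens_tensPair.isDeg_of fun k l x y hx hy => by
      rw [hφ, add_zero]
      refine freePairing_proj (fun n y => by rw [add_zero, hf]) ?_ hy
      exact hσ.1.homog hx
  exact ⟨φ, fun n t => by rw [this, add_zero], hφ⟩

/-- Tensoring with a graded-projective module preserves short exact sequences. -/
theorem exists_shortExact_tens (hP : P.toGrBimod.IsProjective) {i : M.Hom N} {p : N.Hom L}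
    (h : ShortExact i p) : ∃ (i' : (tens P M).Hom (tens P N)) (p' : (tens P N).Hom (tens P L))
      (_ : ShortExact i' p'), (∀ x y, i'.toCLM (tensPair P M x y) = tensPair P N x (i.toCLM y)) ∧
      ∀ x y, p'.toCLM (tensPair P N x y) = tensPair P L x (p.toCLM y) := by
  obtain ⟨σ, hσ, hεσ⟩ := isProjective_iff_exists_section.1 hP
  obtain ⟨i', hi'⟩ := (isTens_tensPair (P := P)).exists_map isTens_tensPair (Hom.id P) i
  obtain ⟨p', hp'⟩ := (isTens_tensPair (P := P)).exists_map isTens_tensPair (Hom.id P) p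
  obtain ⟨r', hr', hr'mk⟩ := exists_tensLinear hσ h.r_proj
  obtain ⟨s', hs', hs'mk⟩ := exists_tensLinear hσ h.s_proj
  have hi : ∀ x y, i'.toCLM (tensPair P M x y) = tensPair P N x (i.toCLM y) := hi'
  have hp : ∀ x y, p'.toCLM (tensPair P N x y) = tensPair P L x (p.toCLM y) := hp'
  -- `μ y` sends `x ⊗ a` to `x ⊗ ay`, and composed with the section `σ` it gives back `x ⊗ y`. The
  -- splitting identities below are therefore proved on the free cover, where they reduce to those
  -- of `r` and `s`, and then evaluated at `σ x`.
  let μ : ∀ {K : DGBimod.{w, u, v₂, u} A B} (y : K.carrier),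
      (free P).carrier →L[𝕜] (tens P K).carrier :=
    fun {K} y => ⟨(tensPair P K).flip y ∘ₗ (freeCounit P).toCLM.toLinearMap,
      isTens_tensPair.continuous.comp ((freeCounit P).toCLM.continuous.prodMk continuous_const)⟩
  have hμ : ∀ {K : DGBimod.{w, u, v₂, u} A B} (y : K.carrier) (x : P.carrier) (a : A.carrier),
      μ y (freeMk P x a) = tensPair P K x (K.lact a y) := fun {K} y x a => by
    change tensPair P K ((freeCounit P).toCLM (freeMk P x a)) y = _
    rw [freeCounit_mk, isTens_tensPair.balanced]
  have hμσ : ∀ {K : DGBimod.{w, u, v₂, u} A B} (y : K.carrier) (x : P.carrier),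
      μ y (σ x) = tensPair P K x y := fun {K} y x =>
    congrArg (fun z => tensPair P K z y) (hεσ x)
  refine ⟨i', p', ⟨r', s', hr', hs', fun t => ?_, fun t => ?_, fun t => ?_, fun t => ?_⟩, hi, hp⟩
  · have : p'.toCLM ∘L i'.toCLM = 0 := isTens_tensPair.ext _ _ _ fun x y => by
      change p'.toCLM (i'.toCLM (tensPair P M x y)) = 0
      rw [hi, hp, h.p_i, map_zero]
    exact DFunLike.congr_fun this t
  · have : r' ∘L i'.toCLM = ContinuousLinearMap.id 𝕜 _ := isTens_tensPair.ext _ _ _ fun x y => by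
      change r' (i'.toCLM (tensPair P M x y)) = tensPair P M x y
      rw [hi, hr'mk, ← hμσ]
      have e : freePairingCLM h.r (i.toCLM y) = μ y := free_ext fun x a => by
        rw [hμ]
        change freePairing P h.r (freeMk P x a) (i.toCLM y) = _
        rw [freePairing_mk, ← i.map_lact, h.r_i]
      exact DFunLike.congr_fun e (σ x)
    exact DFunLike.congr_fun this t
  · have : p'.toCLM ∘L s' = ContinuousLinearMap.id 𝕜 _ := isTens_tensPair.ext _ _ _ fun x y => by
      change p'.toCLM (s' (tensPair P L x y)) = tensPair P L x y
      rw [hs'mk, ← hμσ]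
      have e : p'.toCLM ∘L freePairingCLM h.s y = μ y := free_ext fun x a => by
        rw [hμ]
        change p'.toCLM (freePairing P h.s (freeMk P x a) y) = _
        rw [freePairing_mk, hp, h.p_s]
      exact DFunLike.congr_fun e (σ x)
    exact DFunLike.congr_fun this t
  · have : i'.toCLM ∘L r' + s' ∘L p'.toCLM = ContinuousLinearMap.id 𝕜 _ :=
      isTens_tensPair.ext _ _ _ fun x y => by
        change i'.toCLM (r' (tensPair P N x y)) + s' (p'.toCLM (tensPair P N x y)) =
          tensPair P N x y
        rw [hp, hr'mk, hs'mk, ← hμσ]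
        have e : i'.toCLM ∘L freePairingCLM h.r y + freePairingCLM h.s (p.toCLM y) = μ y :=
          free_ext fun x a => by
            rw [hμ]
            change i'.toCLM (freePairing P h.r (freeMk P x a) y) +
              freePairing P h.s (freeMk P x a) (p.toCLM y) = _
            rw [freePairing_mk, freePairing_mk, hi, ← p.map_lact, ← map_add, h.i_r_add_s_p]
        exact DFunLike.congr_fun e (σ x)
    exact DFunLike.congr_fun this t

/-- Tensoring a graded-projective module with a contraacyclic bimodule gives a contraacyclic
module. -/
theorem isContraacyclic_tens (hP : P.toGrBimod.IsProjective) (hN : N.IsContraacyclic) :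
    (tens P N).IsContraacyclic := by
  induction hN with
  | @tot M N L i p h =>
    -- A totalization is a twofold cone, so compatibility with cones identifies its tensor product
    -- with the totalization of the tensored sequence.
    obtain ⟨i', p', h', hi, hp⟩ := exists_shortExact_tens hP h
    refine (IsTens.isContraacyclic_iff (IsTens.cone
      (IsTens.cone isTens_tensPair isTens_tensPair i i' hi)
      isTens_tensPair (coneDesc h) (coneDesc h') ?_)).1 (.tot h')
    intro x y
    exact hp x y.1
  | shift k _ ih => exact (isTens_tensPair.shift k).isContraacyclic_iff.1 (.shift k ih)
  | cone f _ _ h1 h2 =>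
    obtain ⟨F, hF⟩ := (isTens_tensPair (P := P)).exists_map isTens_tensPair (Hom.id P) f
    exact (isTens_tensPair.cone isTens_tensPair f F hF).isContraacyclic_iff.1 (.cone F h1 h2)
  | retract i r h _ ih =>
    exact isTens_tensPair.isContraacyclic_of_retract_right isTens_tensPair i r h ih
  | pi M _ ih => exact (IsTens.pi fun i => isTens_tensPair).isContraacyclic_iff.1 (.pi _ ih)

theorem isContraacyclic_tens_middle (hP : P.toGrBimod.IsProjective) {i : M.Hom N} {p : N.Hom L}
    (h : ShortExact i p) (hM : (tens P M).IsContraacyclic) (hL : (tens P L).IsContraacyclic) :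
    (tens P N).IsContraacyclic := by
  obtain ⟨i', p', h', -, -⟩ := exists_shortExact_tens hP h
  exact isContraacyclic_middle h' hM hL

theorem isContraacyclic_tens_of_subsingleton [Subsingleton N.carrier] :
    (tens P N).IsContraacyclic := by
  have : Subsingleton (tens P N).carrier := by
    have e : ContinuousLinearMap.id 𝕜 (tens P N).carrier = 0 :=
      isTens_tensPair.ext _ _ _ fun x y => by
        rw [Subsingleton.elim y 0]; simp
    exact ⟨fun a b => (DFunLike.congr_fun e a).trans (DFunLike.congr_fun e b).symm⟩
  exact (isContractible_of_subsingleton _).isContraacyclic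

end Exact

end RightDGMod

end DGModules

/-! ### Closed subbimodules, kernels and limits of towers. -/

section DGModules

variable {𝕜 : Type w} [RCLike 𝕜]

/-- A closed graded subspace. -/
noncomputable abbrev GrSpace.sub (V : GrSpace.{w, u} 𝕜) (S : Submodule 𝕜 V.carrier)
    (hS : IsClosed (S : Set V.carrier)) (hproj : ∀ n, ∀ x ∈ S, V.proj n x ∈ S) :
    GrSpace.{w, u} 𝕜 where
  carrier := S
  isUniformAddGroup := inferInstanceAs (IsUniformAddGroup S.toAddSubgroup)
  complete := hS.completeSpace_coe
  proj n := (V.proj n).restrict (hproj n)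
  proj_self n x := Subtype.ext (V.proj_self n x)
  proj_of_ne m n x h := Subtype.ext (V.proj_of_ne m n x h)
  isInducing_proj := by
    have h1 : Topology.IsInducing fun (x : S) (n : ℤ) => V.proj n x :=
      V.isInducing_proj.comp Topology.IsInducing.subtypeVal
    refine Topology.IsInducing.of_comp (g := fun (f : ℤ → S) (n : ℤ) => (f n : V.carrier))
      ?_ (by fun_prop) h1
    exact continuous_pi fun n => ((V.proj n).continuous.comp continuous_subtype_val).subtype_mk _
  exists_of_proj f hf := by
    obtain ⟨x, hx⟩ := V.exists_of_proj (fun n => (f n : V.carrier))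
      fun n => congrArg Subtype.val (hf n)
    -- The element with the given components is the limit of their finite sums, which lie in the
    -- closed subspace.
    have hxS : x ∈ S := hS.mem_of_tendsto (V.hasSum_proj x) (.of_forall fun s =>
      S.sum_mem fun n _ => by rw [hx]; exact (f n).2)
    exact ⟨⟨x, hxS⟩, fun n => Subtype.ext (hx n)⟩

namespace DGBimod

variable {A : DGAlg.{w, v} 𝕜} {B : DGAlg.{w, v₂} 𝕜} {M N L : DGBimod.{w, v, v₂, u} A B}

/-- A closed dg-subbimodule. -/
structure ClosedSub (N : DGBimod.{w, v, v₂, u} A B) extends Submodule 𝕜 N.carrier where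
  isClosed : IsClosed (toSubmodule : Set N.carrier)
  proj_mem : ∀ n, ∀ x ∈ toSubmodule, N.proj n x ∈ toSubmodule
  lact_mem : ∀ a, ∀ x ∈ toSubmodule, N.lact a x ∈ toSubmodule
  ract_mem : ∀ b, ∀ x ∈ toSubmodule, N.ract x b ∈ toSubmodule
  d_mem : ∀ x ∈ toSubmodule, N.d x ∈ toSubmodule

noncomputable abbrev sub (N : DGBimod.{w, v, v₂, u} A B) (S : ClosedSub N) :
    DGBimod.{w, v, v₂, u} A B where
  toGrSpace := N.toGrSpace.sub S.toSubmodule S.isClosed S.proj_mem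
  lact := LinearMap.mk₂ 𝕜 (fun a (x : S.toSubmodule) => ⟨N.lact a x, S.lact_mem a x x.2⟩)
    (fun _ _ _ => Subtype.ext (by simp)) (fun _ _ _ => Subtype.ext (by simp))
    (fun _ _ _ => Subtype.ext (by simp)) (fun _ _ _ => Subtype.ext (by simp))
  ract := LinearMap.mk₂ 𝕜 (fun (x : S.toSubmodule) b => ⟨N.ract x b, S.ract_mem b x x.2⟩)
    (fun _ _ _ => Subtype.ext (by simp)) (fun _ _ _ => Subtype.ext (by simp))
    (fun _ _ _ => Subtype.ext (by simp)) (fun _ _ _ => Subtype.ext (by simp))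
  continuous_lact := (N.continuous_lact.comp
    (continuous_fst.prodMk (continuous_subtype_val.comp continuous_snd))).subtype_mk _
  continuous_ract := (N.continuous_ract.comp
    ((continuous_subtype_val.comp continuous_fst).prodMk continuous_snd)).subtype_mk _
  one_lact x := Subtype.ext (N.one_lact x)
  ract_one x := Subtype.ext (N.ract_one x)
  mul_lact a b x := Subtype.ext (N.mul_lact a b x)
  ract_mul x a b := Subtype.ext (N.ract_mul x a b)
  lact_ract a x b := Subtype.ext (N.lact_ract a x b)
  proj_lact m n a x ha hx := Subtype.ext (N.proj_lact m n a x ha (congrArg Subtype.val hx))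
  proj_ract m n x b hx hb := Subtype.ext (N.proj_ract m n x b (congrArg Subtype.val hx) hb)
  d := N.d.restrict S.d_mem
  proj_d n x hx := Subtype.ext (N.proj_d n x (congrArg Subtype.val hx))
  d_d x := Subtype.ext (N.d_d x)
  d_lact n a x ha := Subtype.ext (N.d_lact n a x ha)
  d_ract n x b hx := Subtype.ext (N.d_ract n x b (congrArg Subtype.val hx))

noncomputable abbrev subHom (S : ClosedSub N) : (N.sub S).Hom N where
  toCLM := S.toSubmodule.subtypeL
  map_proj _ _ := rfl
  map_lact _ _ := rfl
  map_ract _ _ := rfl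
  map_d _ := rfl

/-- The kernel of a closed morphism. -/
def ker (f : N.Hom L) : ClosedSub N where
  toSubmodule := LinearMap.ker f.toCLM.toLinearMap
  isClosed := f.toCLM.isClosed_ker
  proj_mem n x hx := by
    have hx : f.toCLM x = 0 := hx
    change f.toCLM _ = 0
    rw [f.map_proj, hx, map_zero]
  lact_mem a x hx := by
    have hx : f.toCLM x = 0 := hx
    change f.toCLM _ = 0
    rw [f.map_lact, hx, map_zero]
  ract_mem b x hx := by
    have hx : f.toCLM x = 0 := hx
    change f.toCLM _ = 0
    rw [f.map_ract, hx, LinearMap.map_zero₂]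
  d_mem x hx := by
    have hx : f.toCLM x = 0 := hx
    change f.toCLM _ = 0
    rw [f.map_d, hx, map_zero]

/-- A sequence with graded sections `s` of `p` and `r` of `i`, exact in the middle, is split. -/
noncomputable def ShortExact.of {i : M.Hom N} {p : N.Hom L} (r : N.carrier →L[𝕜] M.carrier)
    (s : L.carrier →L[𝕜] N.carrier) (r_proj : ∀ n y, r (N.proj n y) = M.proj n (r y))
    (s_proj : ∀ n z, s (L.proj n z) = N.proj n (s z)) (p_i : ∀ x, p.toCLM (i.toCLM x) = 0)
    (r_i : ∀ x, r (i.toCLM x) = x) (p_s : ∀ z, p.toCLM (s z) = z)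
    (i_r : ∀ y, p.toCLM y = 0 → i.toCLM (r y) = y) : ShortExact i p where
  -- Precomposition with `id - s ∘ p` makes the retraction vanish on the image of `s`, as the
  -- splitting identity requires.
  r := r ∘L (ContinuousLinearMap.id 𝕜 _ - s ∘L p.toCLM)
  s := s
  r_proj n y := by
    change r (N.proj n y - s (p.toCLM (N.proj n y))) = M.proj n (r (y - s (p.toCLM y)))
    rw [p.map_proj, s_proj, ← map_sub, r_proj]
  s_proj := s_proj
  p_i := p_i
  r_i x := by
    change r (i.toCLM x - s (p.toCLM (i.toCLM x))) = x
    rw [p_i, map_zero, sub_zero, r_i]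
  p_s := p_s
  i_r_add_s_p y := by
    change i.toCLM (r (y - s (p.toCLM y))) + s (p.toCLM y) = y
    rw [i_r _ (by rw [map_sub, p_s, sub_self]), sub_add_cancel]

/-- The kernel of a morphism with a graded section. -/
noncomputable def shortExactKer (f : N.Hom L) (s : L.carrier →L[𝕜] N.carrier)
    (s_proj : ∀ n z, s (L.proj n z) = N.proj n (s z)) (p_s : ∀ z, f.toCLM (s z) = z) :
    ShortExact (subHom (ker f)) f where
  r := (ContinuousLinearMap.id 𝕜 _ - s ∘L f.toCLM).codRestrict (ker f).toSubmodule fun y => by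
    change f.toCLM (y - s (f.toCLM y)) = 0
    rw [map_sub, p_s, sub_self]
  s := s
  r_proj n y := Subtype.ext (by
    change N.proj n y - s (f.toCLM (N.proj n y)) = N.proj n (y - s (f.toCLM y))
    rw [f.map_proj, s_proj, map_sub])
  s_proj := s_proj
  p_i x := x.2
  r_i x := Subtype.ext (by
    change (x : N.carrier) - s (f.toCLM x) = x
    rw [show f.toCLM (x : N.carrier) = 0 from x.2, map_zero, sub_zero])
  p_s := p_s
  i_r_add_s_p y := sub_add_cancel y _

end DGBimod

namespace RightDGMod

open DGBimod

variable {A : DGAlg.{w, v} 𝕜}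

/-- The limit of a tower of contraacyclic modules with split transition maps is contraacyclic. -/
theorem isContraacyclic_of_tower {X : ℕ → RightDGMod.{w, v, u} A} (hX : ∀ n, (X n).IsContraacyclic)
    (π : ∀ n, (X (n + 1)).Hom (X n)) (σ : ∀ n, (X n).carrier →L[𝕜] (X (n + 1)).carrier)
    (hσ : ∀ n k x, σ n ((X n).proj k x) = (X (n + 1)).proj k (σ n x))
    (hπσ : ∀ n x, (π n).toCLM (σ n x) = x) {L : RightDGMod.{w, v, u} A}
    (l : ∀ n, L.Hom (X n)) (hl : ∀ n x, (π n).toCLM ((l (n + 1)).toCLM x) = (l n).toCLM x)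
    (r : (∀ i : ULift.{u} ℕ, (X i.down).carrier) →L[𝕜] L.carrier)
    (hr : ∀ k y, r (fun i => (X i.down).proj k (y i)) = L.proj k (r y))
    (hrl : ∀ x, r (fun i => (l i.down).toCLM x) = x)
    (hlr : ∀ y : ∀ i : ULift.{u} ℕ, (X i.down).carrier,
      (∀ n, (π n).toCLM (y ⟨n + 1⟩) = y ⟨n⟩) → ∀ n, (l n).toCLM (r y) = y ⟨n⟩) :
    L.IsContraacyclic := by
  let Q : RightDGMod.{w, v, u} A := DGBimod.pi fun i : ULift.{u} ℕ => X i.down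
  have hQ : Q.IsContraacyclic := .pi _ fun i => hX i.down
  let pr : ∀ n, Q.carrier →L[𝕜] (X n).carrier := fun n =>
    ContinuousLinearMap.proj (φ := fun i : ULift.{u} ℕ => (X i.down).carrier) ⟨n⟩
  -- The recursive solution of `yₙ - π yₙ₊₁ = zₙ` with `y₀ = 0`, namely `yₙ₊₁ = σ (yₙ - zₙ)`. It
  -- shows that `id - π` on the product has a graded linear section.
  let S : ∀ n, Q.carrier →L[𝕜] (X n).carrier := fun n => Nat.rec (motive := fun n =>
    Q.carrier →L[𝕜] (X n).carrier) 0 (fun n S => σ n ∘L (S - pr n)) n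
  have S_succ : ∀ n z, S (n + 1) z = σ n (S n z - z ⟨n⟩) := fun n z => rfl
  have S_proj : ∀ n k z, S n (Q.proj k z) = (X n).proj k (S n z) := by
    intro n
    induction n with
    | zero => exact fun k z => (map_zero ((X 0).proj k)).symm
    | succ n ih =>
      intro k z
      rw [S_succ, S_succ, ih, ← hσ, map_sub ((X n).proj k)]
      rfl
  let i : L.Hom Q := mkHom (ContinuousLinearMap.pi fun i : ULift.{u} ℕ => (l i.down).toCLM)
    (fun n x => funext fun i => (l i.down).map_proj n x)
    (fun x b => funext fun i => (l i.down).map_ract x b)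
    (fun x => funext fun i => (l i.down).map_d x)
  let p : Q.Hom Q := mkHom
    (ContinuousLinearMap.pi fun i : ULift.{u} ℕ => pr i.down - (π i.down).toCLM ∘L pr (i.down + 1))
    (fun n x => funext fun i => by
      change (X i.down).proj n (x i) - (π i.down).toCLM ((X (i.down + 1)).proj n (x ⟨i.down + 1⟩)) =
        (X i.down).proj n (x i - (π i.down).toCLM (x ⟨i.down + 1⟩))
      rw [map_sub, (π i.down).map_proj])
    (fun x b => funext fun i => by
      change (X i.down).ract (x i) b - (π i.down).toCLM ((X (i.down + 1)).ract (x ⟨i.down + 1⟩) b) =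
        (X i.down).ract (x i - (π i.down).toCLM (x ⟨i.down + 1⟩)) b
      rw [LinearMap.map_sub₂, (π i.down).map_ract])
    (fun x => funext fun i => by
      change (X i.down).d (x i) - (π i.down).toCLM ((X (i.down + 1)).d (x ⟨i.down + 1⟩)) =
        (X i.down).d (x i - (π i.down).toCLM (x ⟨i.down + 1⟩))
      rw [map_sub, (π i.down).map_d])
  have p_apply : ∀ y n, p.toCLM y ⟨n⟩ = y ⟨n⟩ - (π n).toCLM (y ⟨n + 1⟩) := fun y n => rfl
  -- The Milnor sequence `L → ∏ Xₙ → ∏ Xₙ` is split exact. Both products are contraacyclic, hence so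
  -- is `L`.
  have h : ShortExact i p := by
    refine ShortExact.of r (ContinuousLinearMap.pi fun i : ULift.{u} ℕ => S i.down)
      ?_ ?_ ?_ ?_ ?_ ?_
    · exact fun n y => hr n y
    · exact fun n z => funext fun i => S_proj i.down n z
    · intro x
      funext j
      change (l j.down).toCLM x - (π j.down).toCLM ((l (j.down + 1)).toCLM x) = 0
      rw [hl, sub_self]
    · exact hrl
    · intro z
      funext j
      change S j.down z - (π j.down).toCLM (S (j.down + 1) z) = z j
      rw [S_succ, hπσ, sub_sub_cancel]
    · intro y hy
      funext j
      refine hlr y (fun n => ?_) j.down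
      have := congrFun hy ⟨n⟩
      rw [p_apply] at this
      exact (sub_eq_zero.1 this).symm
  exact isContraacyclic_left h hQ hQ

end RightDGMod

end DGModules

/-! ### The total free resolution and its truncations. -/

section DGModules

variable {𝕜 : Type w} [RCLike 𝕜]

namespace RightDGMod

open DGBimod

section Resolution

variable {A : DGAlg.{w, u} 𝕜}

/-- A differential on a graded right module. -/
noncomputable abbrev ofGrBimod (M : GrBimod.{w, w, u, u} (DGAlg.ground 𝕜).toGrAlg A.toGrAlg)
    (d : M.carrier →L[𝕜] M.carrier) (proj_d : ∀ n x, M.proj n x = x → M.proj (n + 1) (d x) = d x)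
    (d_d : ∀ x, d (d x) = 0) (d_ract : ∀ n x b, M.proj n x = x →
      d (M.ract x b) = M.ract (d x) b + (n.negOnePow : ℤ) • M.ract x (A.d b)) :
    RightDGMod.{w, u, u} A where
  toGrBimod := M
  d := d
  proj_d := proj_d
  d_d := d_d
  d_lact n a x ha := by
    have e : scalar ((DGAlg.ground 𝕜).d a) = 0 := rfl
    rw [lact_eq_smul, lact_eq_smul, lact_eq_smul, map_smul, e, zero_smul, zero_add]
    by_cases hm : n = 0
    · rw [hm, Int.negOnePow_zero, Units.val_one, one_smul]
    · rw [scalar_eq_zero hm ha, zero_smul, smul_zero]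
  d_ract := d_ract

/-- The kernel of the free cover. -/
noncomputable def syzygy (M : RightDGMod.{w, u, u} A) : RightDGMod.{w, u, u} A :=
  (free M).sub (ker (freeCounit M))

noncomputable def syzygyHom (M : RightDGMod.{w, u, u} A) : (syzygy M).Hom (free M) :=
  subHom (ker (freeCounit M))

noncomputable def shortExactSyzygy (M : RightDGMod.{w, u, u} A) :
    ShortExact (syzygyHom M) (freeCounit M) :=
  shortExactKer (freeCounit M) (freeUnit M) freeUnit_proj freeCounit_freeUnit

theorem freeCounit_syzygyHom (M : RightDGMod.{w, u, u} A) (x : (syzygy M).carrier) :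
    (freeCounit M).toCLM ((syzygyHom M).toCLM x) = 0 := (shortExactSyzygy M).p_i x

/-- The truncated resolutions `Ωⁿ M → Fₙ₋₁ → ⋯ → F₀` of `M`, with their augmentations. -/
noncomputable def truncAug : ℕ → ∀ M : RightDGMod.{w, u, u} A,
    Σ Y : RightDGMod.{w, u, u} A, Y.Hom M
  | 0, M => ⟨M, Hom.id M⟩
  | n + 1, M => ⟨cone ((syzygyHom M).comp (truncAug n (syzygy M)).2),
      mkHom ((freeCounit M).toCLM ∘L ContinuousLinearMap.fst 𝕜 _ _)
        (fun n x => (freeCounit M).map_proj n x.1) (fun x b => (freeCounit M).map_ract x.1 b)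
        (fun x => by
          change (freeCounit M).toCLM ((free M).d x.1 + (syzygyHom M).toCLM _) =
            M.d ((freeCounit M).toCLM x.1)
          rw [map_add, freeCounit_syzygyHom, add_zero, (freeCounit M).map_d])⟩

noncomputable abbrev trunc (n : ℕ) (M : RightDGMod.{w, u, u} A) : RightDGMod.{w, u, u} A :=
  (truncAug n M).1

noncomputable abbrev aug (n : ℕ) (M : RightDGMod.{w, u, u} A) : (trunc n M).Hom M :=
  (truncAug n M).2

/-- The induction replaces the truncated resolution of the syzygy by the syzygy itself, which
changes cones only by contraacyclic objects. What remains is the map `cone (syzygy → free) → M`,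
whose cone is the totalization of a short exact sequence. -/
theorem isContraacyclic_cone_aug (n : ℕ) (M : RightDGMod.{w, u, u} A) :
    (cone (aug n M)).IsContraacyclic := by
  induction n generalizing M with
  | zero => exact (isContractible_cone_id M).isContraacyclic
  | succ n ih =>
    have hid : ∀ N : RightDGMod.{w, u, u} A, (cone (Hom.id N)).IsContraacyclic := fun N =>
      (isContractible_cone_id N).isContraacyclic
    have h1 : ∀ x, (syzygyHom M).toCLM ((aug n (syzygy M)).toCLM x) =
        (Hom.id (free M)).toCLM (((syzygyHom M).comp (aug n (syzygy M))).toCLM x) := fun x => rfl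
    have h2 := isContraacyclic_cone_coneMap h1 (ih (syzygy M)) (hid _)
    have h3 : ∀ x, (coneDesc (shortExactSyzygy M)).toCLM ((coneMap h1).toCLM x) =
        (Hom.id M).toCLM ((aug (n + 1) M).toCLM x) := fun x => rfl
    exact isContraacyclic_source_of_cone (isContraacyclic_cone_coneMap h3 h2 (hid M))
      (.tot (shortExactSyzygy M))

/-- The transition maps of the tower of truncated resolutions. -/
noncomputable def truncMap : ∀ (n : ℕ) (M : RightDGMod.{w, u, u} A),
    {f : (trunc (n + 1) M).Hom (trunc n M) //
      ∀ x, (aug n M).toCLM (f.toCLM x) = (aug (n + 1) M).toCLM x}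
  | 0, M => ⟨aug 1 M, fun _ => rfl⟩
  | n + 1, M => ⟨coneMap (f := (syzygyHom M).comp (aug (n + 1) (syzygy M)))
      (f' := (syzygyHom M).comp (aug n (syzygy M))) (a := (truncMap n (syzygy M)).1)
      (b := Hom.id (free M)) fun x => congrArg (syzygyHom M).toCLM ((truncMap n (syzygy M)).2 x),
      fun _ => rfl⟩

/-- Graded sections of the transition maps. -/
noncomputable def truncSection : ∀ (n : ℕ) (M : RightDGMod.{w, u, u} A),
    (trunc n M).carrier →L[𝕜] (trunc (n + 1) M).carrier
  | 0, M => (freeUnit M).prod (0 : M.carrier →L[𝕜] (syzygy M).carrier)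
  | n + 1, M => (ContinuousLinearMap.id 𝕜 (free M).carrier).prodMap (truncSection n (syzygy M))

theorem truncSection_proj (n : ℕ) (M : RightDGMod.{w, u, u} A) (k : ℤ) (x : (trunc n M).carrier) :
    truncSection n M ((trunc n M).proj k x) = (trunc (n + 1) M).proj k (truncSection n M x) := by
  induction n generalizing M k with
  | zero => exact Prod.ext (freeUnit_proj k x) (map_zero ((syzygy M).proj (k + 1))).symm
  | succ n ih => exact Prod.ext rfl (ih (syzygy M) (k + 1) x.2)

theorem truncMap_truncSection (n : ℕ) (M : RightDGMod.{w, u, u} A) (x : (trunc n M).carrier) :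
    (truncMap n M).1.toCLM (truncSection n M x) = x := by
  induction n generalizing M with
  | zero => exact freeCounit_freeUnit (M := M) x
  | succ n ih => exact Prod.ext rfl (ih (syzygy M) x.2)

/-- The recursion replaces `M` by its syzygy, as for the truncations. Thus the components of
positive index in the resolution of `M` are definitionally the components of the resolution of the
syzygy. -/
noncomputable def iterSyzygy : ℕ → RightDGMod.{w, u, u} A → RightDGMod.{w, u, u} A
  | 0, M => M
  | n + 1, M => iterSyzygy n (syzygy M)

/-- The differentials of the free resolution. -/
noncomputable def resolutionδ : ∀ (n : ℕ) (M : RightDGMod.{w, u, u} A),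
    (free (iterSyzygy (n + 1) M)).Hom (free (iterSyzygy n M))
  | 0, M => (syzygyHom M).comp (freeCounit (syzygy M))
  | n + 1, M => resolutionδ n (syzygy M)

theorem resolutionδ_δ (n : ℕ) (M : RightDGMod.{w, u, u} A)
    (x : (free (iterSyzygy (n + 2) M)).carrier) :
    (resolutionδ n M).toCLM ((resolutionδ (n + 1) M).toCLM x) = 0 := by
  induction n generalizing M with
  | zero =>
    change (syzygyHom M).toCLM ((freeCounit (syzygy M)).toCLM
      ((syzygyHom (syzygy M)).toCLM ((freeCounit (syzygy (syzygy M))).toCLM x))) = 0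
    rw [freeCounit_syzygyHom, map_zero]
  | succ n ih => exact ih (syzygy M) x

/-- The underlying graded module `∏ₙ Fₙ[n]` of the total resolution. -/
noncomputable abbrev resolutionGr (M : RightDGMod.{w, u, u} A) :
    GrBimod.{w, w, u, u} (DGAlg.ground 𝕜).toGrAlg A.toGrAlg :=
  (DGBimod.pi fun i : ULift.{u} ℕ => (free (iterSyzygy i.down M)).shift (i.down : ℤ)).toGrBimod

/-- The sign `(-1)ⁱ` belongs to the shift of the `i`-th component. Putting it on the resolution
differential too makes the mixed terms cancel, since neighbouring components have opposite signs. -/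
noncomputable def resolutionD (M : RightDGMod.{w, u, u} A) :
    (resolutionGr M).carrier →L[𝕜] (resolutionGr M).carrier :=
  ContinuousLinearMap.pi fun i : ULift.{u} ℕ => (((i.down : ℤ)).negOnePow : ℤ) •
    ((free (iterSyzygy i.down M)).d ∘L ContinuousLinearMap.proj
        (φ := fun i : ULift.{u} ℕ => (free (iterSyzygy i.down M)).carrier) i +
      (resolutionδ i.down M).toCLM ∘L ContinuousLinearMap.proj
        (φ := fun i : ULift.{u} ℕ => (free (iterSyzygy i.down M)).carrier) ⟨i.down + 1⟩)

theorem resolutionD_apply (M : RightDGMod.{w, u, u} A) (x : (resolutionGr M).carrier) (i : ℕ) :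
    resolutionD M x ⟨i⟩ = ((i : ℤ).negOnePow : ℤ) • ((free (iterSyzygy i M)).d (x ⟨i⟩) +
      (resolutionδ i M).toCLM (x ⟨i + 1⟩)) := rfl

/-- The total free resolution of a dg-module. -/
noncomputable def resolution (M : RightDGMod.{w, u, u} A) : RightDGMod.{w, u, u} A :=
  ofGrBimod (resolutionGr M) (resolutionD M)
    (fun n x hx => funext fun ⟨i⟩ => by
      have h1 : (free (iterSyzygy i M)).proj (n + i) (x ⟨i⟩) = x ⟨i⟩ := congrFun hx ⟨i⟩
      have h2 : (free (iterSyzygy (i + 1) M)).proj (n + ((i + 1 : ℕ) : ℤ)) (x ⟨i + 1⟩) =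
          x ⟨i + 1⟩ :=
        congrFun hx ⟨i + 1⟩
      change (free (iterSyzygy i M)).proj (n + 1 + i) (resolutionD M x ⟨i⟩) = _
      rw [resolutionD_apply, map_zsmul, map_add, ← (resolutionδ i M).map_proj, add_right_comm,
        (free (iterSyzygy i M)).proj_d _ _ h1]
      have e : n + (i : ℤ) + 1 = n + ((i + 1 : ℕ) : ℤ) := by push_cast; ring
      rw [e, h2])
    (fun x => funext fun ⟨i⟩ => by
      rw [resolutionD_apply, resolutionD_apply, resolutionD_apply]
      change _ = (0 : (free (iterSyzygy i M)).carrier)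
      rw [map_zsmul, map_add, (free (iterSyzygy i M)).d_d, map_zsmul, map_add, resolutionδ_δ,
        (resolutionδ i M).map_d]
      push_cast
      rw [Int.negOnePow_succ, Units.val_neg, neg_smul, zero_add, add_zero, add_neg_cancel,
        smul_zero])
    (fun n x b hx => funext fun ⟨i⟩ => by
      have h1 : (free (iterSyzygy i M)).proj (n + i) (x ⟨i⟩) = x ⟨i⟩ := congrFun hx ⟨i⟩
      rw [resolutionD_apply]
      change ((i : ℤ).negOnePow : ℤ) • ((free (iterSyzygy i M)).d
          ((free (iterSyzygy i M)).ract (x ⟨i⟩) b) +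
        (resolutionδ i M).toCLM ((free (iterSyzygy (i + 1) M)).ract (x ⟨i + 1⟩) b)) =
        (free (iterSyzygy i M)).ract (resolutionD M x ⟨i⟩) b +
          (n.negOnePow : ℤ) • (free (iterSyzygy i M)).ract (x ⟨i⟩) (A.d b)
      rw [(free (iterSyzygy i M)).d_ract _ _ b h1, (resolutionδ i M).map_ract, resolutionD_apply,
        map_zsmul, LinearMap.smul_apply, LinearMap.map_add₂, smul_add, smul_add, smul_add,
        smul_smul, Int.negOnePow_add, Units.val_mul, mul_left_comm, eps_mul_self, mul_one]
      abel)

theorem resolution_isProjective (M : RightDGMod.{w, u, u} A) :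
    (resolution M).toGrBimod.IsProjective :=
  isProjective_pi fun _ => isProjective_shift (free_isProjective _) _

/-- Forgetting the first component of the resolution. -/
noncomputable def resolutionTail (M : RightDGMod.{w, u, u} A) :
    (resolution M).carrier →L[𝕜] (resolution (syzygy M)).carrier :=
  ContinuousLinearMap.pi fun i : ULift.{u} ℕ => ContinuousLinearMap.proj
    (φ := fun i : ULift.{u} ℕ => (free (iterSyzygy i.down M)).carrier) ⟨i.down + 1⟩

/-- As a graded module the resolution is the free cover together with the resolution of the syzygy
shifted by one. The sign is that of the shift, and it matches the mapping cones that define the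
truncations. -/
theorem resolutionTail_d (M : RightDGMod.{w, u, u} A) (x : (resolution M).carrier) :
    resolutionTail M ((resolution M).d x) = -(resolution (syzygy M)).d (resolutionTail M x) :=
  funext fun ⟨i⟩ => by
    change resolutionD M x ⟨i + 1⟩ = -resolutionD (syzygy M) (resolutionTail M x) ⟨i⟩
    refine (resolutionD_apply M x (i + 1)).trans (Eq.trans ?_ (congrArg Neg.neg
      (resolutionD_apply (syzygy M) (resolutionTail M x) i).symm))
    push_cast
    rw [Int.negOnePow_succ, Units.val_neg, neg_smul]
    rfl

theorem resolutionTail_proj (M : RightDGMod.{w, u, u} A) (n : ℤ) (x : (resolution M).carrier) :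
    resolutionTail M ((resolution M).proj n x) =
      (resolution (syzygy M)).proj (n + 1) (resolutionTail M x) :=
  funext fun ⟨i⟩ => by
    change (free (iterSyzygy (i + 1) M)).proj (n + ((i + 1 : ℕ) : ℤ)) (x ⟨i + 1⟩) =
      (free (iterSyzygy (i + 1) M)).proj (n + 1 + (i : ℤ)) (x ⟨i + 1⟩)
    congr 2
    push_cast; ring

noncomputable def resolutionHead (M : RightDGMod.{w, u, u} A) :
    (resolution M).carrier →L[𝕜] (free M).carrier :=
  ContinuousLinearMap.proj (φ := fun i : ULift.{u} ℕ => (free (iterSyzygy i.down M)).carrier) ⟨0⟩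

theorem resolutionHead_proj (M : RightDGMod.{w, u, u} A) (n : ℤ) (x : (resolution M).carrier) :
    resolutionHead M ((resolution M).proj n x) = (free M).proj n (resolutionHead M x) := by
  change (free M).proj (n + ((0 : ℕ) : ℤ)) _ = _
  rw [Nat.cast_zero, add_zero]
  rfl

theorem resolutionHead_d (M : RightDGMod.{w, u, u} A) (x : (resolution M).carrier) :
    resolutionHead M ((resolution M).d x) = (free M).d (resolutionHead M x) +
      (syzygyHom M).toCLM ((freeCounit (syzygy M)).toCLM
        (resolutionHead (syzygy M) (resolutionTail M x))) := by
  refine (resolutionD_apply M x 0).trans ?_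
  rw [Nat.cast_zero, Int.negOnePow_zero, Units.val_one, one_smul]
  rfl

noncomputable def resolutionAug (M : RightDGMod.{w, u, u} A) : (resolution M).Hom M :=
  mkHom ((freeCounit M).toCLM ∘L resolutionHead M)
    (fun n x => by
      change (freeCounit M).toCLM (resolutionHead M _) = M.proj n ((freeCounit M).toCLM _)
      rw [resolutionHead_proj, (freeCounit M).map_proj]; rfl)
    (fun x b => (freeCounit M).map_ract _ b)
    (fun x => by
      change (freeCounit M).toCLM (resolutionHead M _) = M.d ((freeCounit M).toCLM _)
      rw [resolutionHead_d, map_add, freeCounit_syzygyHom, add_zero, (freeCounit M).map_d]; rfl)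

/-- The maps from the total resolution to its truncations. -/
noncomputable def toTrunc : ∀ (n : ℕ) (M : RightDGMod.{w, u, u} A),
    {f : (resolution M).Hom (trunc n M) // ∀ x, (aug n M).toCLM (f.toCLM x) =
      (freeCounit M).toCLM (resolutionHead M x)}
  | 0, M => ⟨resolutionAug M, fun _ => rfl⟩
  | n + 1, M => ⟨mkHom
      ((resolutionHead M).prod ((toTrunc n (syzygy M)).1.toCLM ∘L resolutionTail M))
      (fun k x => Prod.ext (resolutionHead_proj M k x) (by
        change (toTrunc n (syzygy M)).1.toCLM (resolutionTail M ((resolution M).proj k x)) =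
          (trunc n (syzygy M)).proj (k + 1) ((toTrunc n (syzygy M)).1.toCLM (resolutionTail M x))
        rw [resolutionTail_proj, (toTrunc n (syzygy M)).1.map_proj]))
      (fun x b => Prod.ext rfl ((toTrunc n (syzygy M)).1.map_ract (resolutionTail M x) b))
      (fun x => by
        refine Eq.trans ?_ (cone_d ((syzygyHom M).comp (aug n (syzygy M))) (resolutionHead M x)
          ((toTrunc n (syzygy M)).1.toCLM (resolutionTail M x))).symm
        refine Prod.ext ?_ ?_
        · change resolutionHead M ((resolution M).d x) = (free M).d (resolutionHead M x) +
            (syzygyHom M).toCLM ((aug n (syzygy M)).toCLM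
              ((toTrunc n (syzygy M)).1.toCLM (resolutionTail M x)))
          rw [resolutionHead_d, (toTrunc n (syzygy M)).2]
        · change (toTrunc n (syzygy M)).1.toCLM (resolutionTail M ((resolution M).d x)) =
            -(trunc n (syzygy M)).d ((toTrunc n (syzygy M)).1.toCLM (resolutionTail M x))
          rw [resolutionTail_d, map_neg, (toTrunc n (syzygy M)).1.map_d]),
      fun _ => rfl⟩

theorem truncMap_toTrunc (n : ℕ) (M : RightDGMod.{w, u, u} A) (x : (resolution M).carrier) :
    (truncMap n M).1.toCLM ((toTrunc (n + 1) M).1.toCLM x) = (toTrunc n M).1.toCLM x := by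
  induction n generalizing M with
  | zero => rfl
  | succ n ih => exact Prod.ext rfl (ih (syzygy M) (resolutionTail M x))

/-- The last free component of a truncation. -/
noncomputable def truncLast : ∀ (n : ℕ) (M : RightDGMod.{w, u, u} A),
    (trunc (n + 1) M).carrier →L[𝕜] (free (iterSyzygy n M)).carrier
  | 0, M => ContinuousLinearMap.fst 𝕜 (free M).carrier (syzygy M).carrier
  | n + 1, M => truncLast n (syzygy M) ∘L
      ContinuousLinearMap.snd 𝕜 (free M).carrier (trunc (n + 1) (syzygy M)).carrier

theorem truncLast_proj (n : ℕ) (M : RightDGMod.{w, u, u} A) (k : ℤ)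
    (x : (trunc (n + 1) M).carrier) : truncLast n M ((trunc (n + 1) M).proj k x) =
      (free (iterSyzygy n M)).proj (k + n) (truncLast n M x) := by
  induction n generalizing M k with
  | zero =>
    rw [Nat.cast_zero, add_zero]; rfl
  | succ n ih =>
    refine (ih (syzygy M) (k + 1) x.2).trans ?_
    have e : k + 1 + (n : ℤ) = k + ((n + 1 : ℕ) : ℤ) := by push_cast; ring
    rw [e]; rfl

theorem truncLast_toTrunc (n : ℕ) (M : RightDGMod.{w, u, u} A) (x : (resolution M).carrier) :
    truncLast n M ((toTrunc (n + 1) M).1.toCLM x) = x ⟨n⟩ := by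
  induction n generalizing M with
  | zero => rfl
  | succ n ih => exact ih (syzygy M) (resolutionTail M x)

/-- The resolution is the limit of its truncations. The `i`-th free component appears at stage `i +
1` and is unchanged by later transition maps, so a compatible family is recovered from its last free
components. -/
theorem toTrunc_of_compatible (n : ℕ) (M : RightDGMod.{w, u, u} A)
    (y : ∀ n, (trunc n M).carrier) (hy : ∀ n, (truncMap n M).1.toCLM (y (n + 1)) = y n) :
    (toTrunc n M).1.toCLM (fun i => truncLast i.down M (y (i.down + 1))) = y n := by
  induction n generalizing M with
  | zero => exact hy 0
  | succ n ih =>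
    refine Prod.ext ?_ ?_
    · change (y 1).1 = (y (n + 1)).1
      clear ih
      induction n with
      | zero => rfl
      | succ n ih => exact ih.trans (congrArg Prod.fst (hy (n + 1))).symm
    · exact ih (syzygy M) (fun k => (y (k + 1)).2) fun k => congrArg Prod.snd (hy (k + 1))

/-- The resolution is a contraderived equivalence. -/
theorem isContraIso_resolutionAug (M : RightDGMod.{w, u, u} A) :
    IsContraIso (resolutionAug M) := by
  -- The tower consists of the cones of the truncated augmentations; its limit is the cone of the
  -- full augmentation.
  refine isContraacyclic_of_tower (X := fun n => cone (aug n M))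
    (fun n => isContraacyclic_cone_aug n M)
    (fun n => coneMap (f := aug (n + 1) M) (f' := aug n M) (a := (truncMap n M).1)
      (b := Hom.id M) (truncMap n M).2)
    (fun n => (ContinuousLinearMap.id 𝕜 M.carrier).prodMap (truncSection n M))
    (fun n k x => Prod.ext rfl (truncSection_proj n M (k + 1) x.2))
    (fun n x => Prod.ext rfl (truncMap_truncSection n M x.2))
    (fun n => coneMap (f := resolutionAug M) (f' := aug n M) (a := (toTrunc n M).1)
      (b := Hom.id M) (toTrunc n M).2)
    (fun n x => Prod.ext rfl (truncMap_toTrunc n M x.2))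
    -- The reconstruction map reads the component in `M` at stage `0` and the `i`-th free component
    -- at stage `i + 1`, where it first occurs.
    ((ContinuousLinearMap.fst 𝕜 M.carrier (trunc 0 M).carrier ∘L ContinuousLinearMap.proj
        (φ := fun i : ULift.{u} ℕ => M.carrier × (trunc i.down M).carrier) ⟨0⟩).prod
      (ContinuousLinearMap.pi fun i : ULift.{u} ℕ => truncLast i.down M ∘L
        ContinuousLinearMap.snd 𝕜 M.carrier (trunc (i.down + 1) M).carrier ∘L
          ContinuousLinearMap.proj
            (φ := fun i : ULift.{u} ℕ => M.carrier × (trunc i.down M).carrier) ⟨i.down + 1⟩))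
    ?_ ?_ ?_
  · refine fun k y => Prod.ext rfl (funext fun i => ?_)
    refine (truncLast_proj i.down M (k + 1) _).trans ?_
    rfl
  · exact fun x => Prod.ext rfl (funext fun i => truncLast_toTrunc i.down M x.2)
  · intro y hy n
    refine Prod.ext ?_ (toTrunc_of_compatible n M (fun n => (y ⟨n⟩).2)
      fun n => congrArg Prod.snd (hy n))
    change (y ⟨0⟩).1 = (y ⟨n⟩).1
    induction n with
    | zero => rfl
    | succ n ih => exact ih.trans (congrArg Prod.fst (hy n)).symm

end Resolution

end RightDGMod

end DGModules

/-! ### Sections over the empty set and the filtration of the Čech complex. -/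

section DGModules

variable {𝕜 : Type w} [RCLike 𝕜]

open CategoryTheory TopologicalSpace Opposite RightDGMod DGBimod

/-- The zero dg-algebra. -/
noncomputable def DGAlg.zero (𝕜 : Type w) [RCLike 𝕜] : DGAlg.{w, u} 𝕜 where
  carrier := PUnit.{u + 1}
  proj _ := 0
  proj_self _ _ := rfl
  proj_of_ne _ _ _ _ := rfl
  isInducing_proj := ⟨Subsingleton.elim _ _⟩
  exists_of_proj _ _ := ⟨0, fun _ => rfl⟩
  mul := 0
  one := 0
  continuous_mul := continuous_const
  mul_assoc _ _ _ := rfl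
  one_mul _ := rfl
  mul_one _ := rfl
  proj_one := rfl
  proj_mul _ _ _ _ _ _ := rfl
  d := 0
  proj_d _ _ _ := rfl
  d_d _ := rfl
  d_mul _ _ _ _ := rfl

/-- A unital morphism out of the zero algebra forces `1 = 0` in its target. Applied to the value of
the sheaf on the empty set, this kills the Čech components of high degree. -/
theorem subsingleton_of_isTerminal {T : DGAlg.{w, u} 𝕜} (hT : Limits.IsTerminal T) :
    Subsingleton T.carrier := by
  let f : (DGAlg.zero 𝕜).Hom T := hT.from (DGAlg.zero 𝕜)
  have h1 : T.one = 0 := by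
    rw [← f.map_one]
    exact map_zero f.toCLM
  refine ⟨fun a b => ?_⟩
  rw [← T.one_mul a, ← T.one_mul b, h1, LinearMap.map_zero₂, LinearMap.map_zero₂]

variable {X : TopCat.{u}} (𝒜 : TopCat.Sheaf (DGAlg.{w, u} 𝕜) X)

theorem subsingleton_sections_bot : Subsingleton (dgSections 𝒜 ⊥).carrier :=
  subsingleton_of_isTerminal (TopCat.Sheaf.isTerminalOfEmpty 𝒜)

section Filtration

variable {I : Type u} [LinearOrder I] {U : I → Opens X} {V : Opens X}

theorem cechInter_eq_bot {n k : ℕ} (h : FamilyDimLE U n) (hk : n < k) (s : Fin (k + 1) ↪o I) :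
    cechInter U s = ⊥ := by
  refine eq_bot_iff.2 fun x hx => ?_
  -- Since `n < k`, the `k + 1` indices include `n + 2` distinct ones; the first `n + 2` are taken.
  let t : Finset I := (Finset.univ : Finset (Fin (n + 2))).map
    ((Fin.castLEOrderEmb (by omega : n + 2 ≤ k + 1)).trans s).toEmbedding
  obtain ⟨i, hi, hxi⟩ := h t (by simp [t]) x
  obtain ⟨j, -, rfl⟩ := Finset.mem_map.1 hi
  exact absurd ((iInf_le (fun j => U (s j)) (Fin.castLE (by omega) j) : cechInter U s ≤ _) hx) hxi

theorem cechδ_eq_zero (hU : ∀ i, U i ≤ V) {k : ℕ} {c : (cechGr 𝒜 hU).carrier}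
    (hc : ∀ σ : Σ k : ℕ, Fin (k + 1) ↪o I, σ.1 < k → c σ = 0)
    {σ : Σ k : ℕ, Fin (k + 1) ↪o I} (hσ : σ.1 ≤ k) : cechδ 𝒜 hU σ c = 0 := by
  obtain ⟨j, s⟩ := σ
  match j, s with
  | 0, _ => rfl
  | j + 1, s =>
    rw [cechδ_succ]
    refine Finset.sum_eq_zero fun i _ => ?_
    rw [hc ⟨j, cechFace s i⟩ hσ, map_zero, smul_zero]

theorem cech_d_apply (hU : ∀ i, U i ≤ V) (c : (cechGr 𝒜 hU).carrier)
    (σ : Σ k : ℕ, Fin (k + 1) ↪o I) : (cech 𝒜 hU).d c σ = cechδ 𝒜 hU σ c +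
      ((sectionsBimod 𝒜 (cechInter_le hU σ.2)).shift (-(σ.1 : ℤ))).d (c σ) := rfl

/-- The cochains that vanish in degrees less than `k`. -/
def cechFiltration (hU : ∀ i, U i ≤ V) (k : ℕ) : ClosedSub (cech 𝒜 hU) where
  carrier := {c | ∀ σ : Σ k : ℕ, Fin (k + 1) ↪o I, σ.1 < k → c σ = 0}
  add_mem' ha hb σ hσ := by
    refine (congrArg₂ (· + ·) (ha σ hσ) (hb σ hσ)).trans (add_zero _)
  zero_mem' _ _ := rfl
  smul_mem' c x hx σ hσ := (congrArg (c • ·) (hx σ hσ)).trans (smul_zero c)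
  isClosed := by
    change IsClosed {c : (cechGr 𝒜 hU).carrier |
      ∀ σ : Σ k : ℕ, Fin (k + 1) ↪o I, σ.1 < k → c σ = 0}
    simp only [Set.ofPred_forall]
    exact isClosed_iInter fun σ => isClosed_iInter fun _ =>
      isClosed_eq (continuous_apply σ) continuous_const
  proj_mem n x hx σ hσ := (congrArg (((sectionsBimod 𝒜 (cechInter_le hU σ.2)).shift
    (-(σ.1 : ℤ))).proj n) (hx σ hσ)).trans (map_zero _)
  lact_mem a x hx σ hσ := (congrArg (((sectionsBimod 𝒜 (cechInter_le hU σ.2)).shift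
    (-(σ.1 : ℤ))).lact a) (hx σ hσ)).trans (map_zero _)
  ract_mem b x hx σ hσ := (congrArg (fun y => ((sectionsBimod 𝒜 (cechInter_le hU σ.2)).shift
    (-(σ.1 : ℤ))).ract y b) (hx σ hσ)).trans (LinearMap.map_zero₂ _ _)
  d_mem x hx σ hσ := by
    refine (cech_d_apply 𝒜 hU x σ).trans ?_
    rw [cechδ_eq_zero 𝒜 hU hx hσ.le, hx σ hσ, map_zero, add_zero]

/-- The cochains of Čech degree `k`. -/
noncomputable abbrev cechLevel (hU : ∀ i, U i ≤ V) (k : ℕ) :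
    DGBimod.{w, u, u, u} (dgSections 𝒜 V) (dgSections 𝒜 V) :=
  DGBimod.pi fun s : Fin (k + 1) ↪o I =>
    (sectionsBimod 𝒜 (cechInter_le hU s)).shift (-(k : ℤ))

/-- The Čech differential of a cochain vanishing below degree `k` has no component of degree `k`. So
the projection to that level sees only the internal differential and is a closed morphism. -/
noncomputable def cechLevelHom (hU : ∀ i, U i ≤ V) (k : ℕ) :
    ((cech 𝒜 hU).sub (cechFiltration 𝒜 hU k)).Hom (cechLevel 𝒜 hU k) where
  toCLM := (ContinuousLinearMap.pi fun s : Fin (k + 1) ↪o I => ContinuousLinearMap.proj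
    (φ := fun σ : (Σ k : ℕ, Fin (k + 1) ↪o I) =>
      (dgSections 𝒜 (cechInter U σ.2)).carrier) ⟨k, s⟩) ∘L
    (cechFiltration 𝒜 hU k).toSubmodule.subtypeL
  map_proj _ _ := rfl
  map_lact _ _ := rfl
  map_ract _ _ := rfl
  map_d c := funext fun s => by
    refine (cech_d_apply 𝒜 hU c.1 ⟨k, s⟩).trans ?_
    rw [cechδ_eq_zero 𝒜 hU c.2 le_rfl, zero_add]
    rfl

theorem cechFiltration_le (hU : ∀ i, U i ≤ V) (k : ℕ) {c : (cech 𝒜 hU).carrier}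
    (hc : c ∈ (cechFiltration 𝒜 hU (k + 1)).toSubmodule) :
    c ∈ (cechFiltration 𝒜 hU k).toSubmodule := fun σ hσ => hc σ (hσ.trans (Nat.lt_succ_self k))

noncomputable def cechFiltrationHom (hU : ∀ i, U i ≤ V) (k : ℕ) :
    ((cech 𝒜 hU).sub (cechFiltration 𝒜 hU (k + 1))).Hom
      ((cech 𝒜 hU).sub (cechFiltration 𝒜 hU k)) where
  toCLM := ((cechFiltration 𝒜 hU (k + 1)).toSubmodule.subtypeL).codRestrict _
    fun c => cechFiltration_le 𝒜 hU k c.2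
  map_proj _ _ := rfl
  map_lact _ _ := rfl
  map_ract _ _ := rfl
  map_d _ := rfl

/-- Extension by zero of cochains of degree `k`. -/
noncomputable def cechExtend (hU : ∀ i, U i ≤ V) (k : ℕ) : ∀ σ : (Σ k : ℕ, Fin (k + 1) ↪o I),
    (cechLevel 𝒜 hU k).carrier →L[𝕜] (dgSections 𝒜 (cechInter U σ.2)).carrier
  | ⟨j, s⟩ => if h : j = k then by
      subst h
      exact ContinuousLinearMap.proj
        (φ := fun s : Fin (j + 1) ↪o I => (dgSections 𝒜 (cechInter U s)).carrier) s
    else 0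

theorem cechExtend_self (hU : ∀ i, U i ≤ V) {k : ℕ} (s : Fin (k + 1) ↪o I)
    (g : (cechLevel 𝒜 hU k).carrier) : cechExtend 𝒜 hU k ⟨k, s⟩ g = g s := by
  rw [cechExtend, dif_pos rfl]
  rfl

theorem cechExtend_of_ne (hU : ∀ i, U i ≤ V) {k : ℕ} {σ : Σ k : ℕ, Fin (k + 1) ↪o I}
    (h : σ.1 ≠ k) (g : (cechLevel 𝒜 hU k).carrier) : cechExtend 𝒜 hU k σ g = 0 := by
  obtain ⟨j, s⟩ := σ
  rw [cechExtend, dif_neg h]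
  rfl

theorem cechExtend_proj (hU : ∀ i, U i ≤ V) (k : ℕ) (n : ℤ) (σ : Σ k : ℕ, Fin (k + 1) ↪o I)
    (g : (cechLevel 𝒜 hU k).carrier) : cechExtend 𝒜 hU k σ ((cechLevel 𝒜 hU k).proj n g) =
      (dgSections 𝒜 (cechInter U σ.2)).proj (n + -(σ.1 : ℤ)) (cechExtend 𝒜 hU k σ g) := by
  obtain ⟨j, s⟩ := σ
  by_cases h : j = k
  · subst h
    rw [cechExtend_self, cechExtend_self]
    rfl
  · rw [cechExtend_of_ne 𝒜 hU (σ := ⟨j, s⟩) h, cechExtend_of_ne 𝒜 hU (σ := ⟨j, s⟩) h, map_zero]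

/-- Truncation of cochains to degrees at least `k`. -/
noncomputable def cechTruncate (hU : ∀ i, U i ≤ V) (k : ℕ) :
    (cechGr 𝒜 hU).carrier →L[𝕜] (cechGr 𝒜 hU).carrier :=
  ContinuousLinearMap.pi fun σ : (Σ k : ℕ, Fin (k + 1) ↪o I) => if σ.1 < k then 0 else
    ContinuousLinearMap.proj (φ := fun σ : (Σ k : ℕ, Fin (k + 1) ↪o I) =>
      (dgSections 𝒜 (cechInter U σ.2)).carrier) σ

theorem cechTruncate_of_lt (hU : ∀ i, U i ≤ V) {k : ℕ} {σ : Σ k : ℕ, Fin (k + 1) ↪o I}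
    (h : σ.1 < k) (c : (cechGr 𝒜 hU).carrier) : cechTruncate 𝒜 hU k c σ = 0 := by
  change (ite _ _ _ : (cechGr 𝒜 hU).carrier →L[𝕜] (dgSections 𝒜 (cechInter U σ.2)).carrier) c = 0
  rw [if_pos h]; rfl

theorem cechTruncate_of_ge (hU : ∀ i, U i ≤ V) {k : ℕ} {σ : Σ k : ℕ, Fin (k + 1) ↪o I}
    (h : ¬ σ.1 < k) (c : (cechGr 𝒜 hU).carrier) : cechTruncate 𝒜 hU k c σ = c σ := by
  change (ite _ _ _ : (cechGr 𝒜 hU).carrier →L[𝕜] (dgSections 𝒜 (cechInter U σ.2)).carrier) c = _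
  rw [if_neg h]; rfl

theorem cechTruncate_of_mem (hU : ∀ i, U i ≤ V) {k : ℕ} {c : (cech 𝒜 hU).carrier}
    (hc : c ∈ (cechFiltration 𝒜 hU k).toSubmodule) : cechTruncate 𝒜 hU k c = c :=
  funext fun σ => by
    by_cases h : σ.1 < k
    · exact (cechTruncate_of_lt 𝒜 hU h c).trans (hc σ h).symm
    · exact cechTruncate_of_ge 𝒜 hU h c

/-- Extension by zero and truncation are continuous, linear and of degree `0`. They need not commute
with the differential, and a splitting need not. -/
noncomputable def cechFiltrationExact (hU : ∀ i, U i ≤ V) (k : ℕ) :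
    ShortExact (cechFiltrationHom 𝒜 hU k) (cechLevelHom 𝒜 hU k) := by
  refine ShortExact.of
    ((cechTruncate 𝒜 hU (k + 1) ∘L (cechFiltration 𝒜 hU k).toSubmodule.subtypeL).codRestrict _
      fun c σ hσ => cechTruncate_of_lt 𝒜 hU hσ c.1)
    ((ContinuousLinearMap.pi (cechExtend 𝒜 hU k) :
        (cechLevel 𝒜 hU k).carrier →L[𝕜] (cech 𝒜 hU).carrier).codRestrict _
      fun g σ hσ => cechExtend_of_ne 𝒜 hU hσ.ne g) ?_ ?_ ?_ ?_ ?_ ?_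
  · refine fun n c => Subtype.ext (funext fun σ => ?_)
    change cechTruncate 𝒜 hU (k + 1) ((cech 𝒜 hU).proj n c.1) σ =
      (dgSections 𝒜 (cechInter U σ.2)).proj (n + -(σ.1 : ℤ)) (cechTruncate 𝒜 hU (k + 1) c.1 σ)
    by_cases h : σ.1 < k + 1
    · exact (cechTruncate_of_lt 𝒜 hU h _).trans ((map_zero _).symm.trans
        (congrArg _ (cechTruncate_of_lt 𝒜 hU h c.1).symm))
    · exact (cechTruncate_of_ge 𝒜 hU h _).trans
        (congrArg ((dgSections 𝒜 (cechInter U σ.2)).proj (n + -(σ.1 : ℤ)))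
          (cechTruncate_of_ge 𝒜 hU h c.1).symm)
  · exact fun n g => Subtype.ext (funext fun σ => cechExtend_proj 𝒜 hU k n σ g)
  · exact fun c => funext fun s => c.2 ⟨k, s⟩ (Nat.lt_succ_self k)
  · exact fun c => Subtype.ext (cechTruncate_of_mem 𝒜 hU c.2)
  · exact fun g => funext fun s => cechExtend_self 𝒜 hU s g
  · intro c hc
    refine Subtype.ext (cechTruncate_of_mem 𝒜 hU (c := c.1) fun σ hσ => ?_)
    rcases Nat.lt_succ_iff_lt_or_eq.1 hσ with h | h
    · exact c.2 σ h
    · obtain ⟨j, s⟩ := σ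
      subst h
      exact congrFun hc s

/-- A graded-projective module whose tensor products with the sections over the intersections of
a finite-dimensional family are contraacyclic has a contraacyclic tensor product with the
Čech complex. -/
theorem isContraacyclic_tens_cech (hU : ∀ i, U i ≤ V) {n : ℕ} (hn : FamilyDimLE U n)
    {P : RightDGMod.{w, u, u} (dgSections 𝒜 V)} (hP : P.toGrBimod.IsProjective)
    (h : ∀ (k : ℕ) (s : Fin (k + 1) ↪o I),
      (tens P (sectionsBimod 𝒜 (cechInter_le hU s))).IsContraacyclic) :
    (tens P (cech 𝒜 hU)).IsContraacyclic := by
  -- Each level is a product of shifts of sections over intersections, and tensoring with `P`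
  -- commutes with both operations.
  have hlevel : ∀ k, (tens P (cechLevel 𝒜 hU k)).IsContraacyclic := fun k =>
    (IsTens.pi fun s => isTens_tens.shift _).isContraacyclic_iff.1
      (.pi _ fun s => .shift _ (h k s))
  -- Descending induction on the filtration step `k`, started at `k = n + 1`: from there on all
  -- intersections are empty and the filtration step is zero.
  have hF : ∀ j k, k + j = n + 1 →
      (tens P ((cech 𝒜 hU).sub (cechFiltration 𝒜 hU k))).IsContraacyclic := by
    intro j
    induction j with
    | zero =>
      rintro k rfl
      have : Subsingleton ((cech 𝒜 hU).sub (cechFiltration 𝒜 hU (n + 1))).carrier := by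
        refine ⟨fun a b => Subtype.ext (funext fun σ => ?_)⟩
        by_cases hσ : σ.1 < n + 1
        · exact (a.2 σ hσ).trans (b.2 σ hσ).symm
        · have hb := cechInter_eq_bot (k := σ.1) hn (by omega) σ.2
          have : Subsingleton (dgSections 𝒜 (cechInter U σ.2)).carrier := by
            rw [hb]
            exact subsingleton_sections_bot 𝒜
          exact this.elim _ _
      exact isContraacyclic_tens_of_subsingleton
    | succ j ih =>
      intro k hk
      exact isContraacyclic_tens_middle hP (cechFiltrationExact 𝒜 hU k) (ih (k + 1) (by omega))
        (hlevel k)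
  -- Step `0` of the filtration imposes no condition, so it is the whole Čech complex.
  let i : (cech 𝒜 hU).Hom ((cech 𝒜 hU).sub (cechFiltration 𝒜 hU 0)) :=
    { toCLM := (ContinuousLinearMap.id 𝕜 _).codRestrict _
        fun c σ hσ => absurd hσ (Nat.not_lt_zero _)
      map_proj := fun _ _ => rfl
      map_lact := fun _ _ => rfl
      map_ract := fun _ _ => rfl
      map_d := fun _ => rfl }
  refine isTens_tens.isContraacyclic_of_retract_right isTens_tens i (subHom _) ?_
    (hF (n + 1) 0 (zero_add _))
  refine ⟨0, fun _ _ _ => map_zero _, fun _ _ _ _ => ?_, fun _ _ => ?_, fun x => ?_⟩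
  · change (0 : (cech 𝒜 hU).carrier) = _ • (cech 𝒜 hU).lact _ 0
    rw [map_zero, smul_zero]
  · exact (LinearMap.map_zero₂ _ _).symm
  · change x - x = (cech 𝒜 hU).d 0 + 0
    rw [sub_self, map_zero, add_zero]

end Filtration

end DGModules

/-! ### Restriction and extension of scalars, and comparison of replacements. -/

section DGModules

variable {𝕜 : Type w} [RCLike 𝕜]

open GrSpace RightDGMod DGBimod

namespace RightDGMod

section Restrict

variable {A : DGAlg.{w, u} 𝕜} {B : DGAlg.{w, u} 𝕜}

/-- Restriction of scalars of right modules. -/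
noncomputable abbrev restrictScalars (f : A.Hom B) (M : RightDGMod.{w, u, u} B) :
    RightDGMod.{w, u, u} A := DGBimod.restrict M (DGAlg.Hom.id _) f

noncomputable def restrictHom (f : A.Hom B) {M N : RightDGMod.{w, u, u} B} (g : M.Hom N) :
    (restrictScalars f M).Hom (restrictScalars f N) :=
  mkHom g.toCLM g.map_proj (fun x b => g.map_ract x (f.toCLM b)) g.map_d

/-- Restriction of scalars preserves contraacyclicity. -/
theorem isContraacyclic_restrictScalars (f : A.Hom B) {M : RightDGMod.{w, u, u} B}
    (hM : M.IsContraacyclic) : (restrictScalars f M).IsContraacyclic := by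
  induction hM with
  | @tot M N L i p h =>
    have h' : ShortExact (restrictHom f i) (restrictHom f p) :=
      ⟨h.r, h.s, h.r_proj, h.s_proj, h.p_i, h.r_i, h.p_s, h.i_r_add_s_p⟩
    -- Restriction leaves the underlying space, grading and differential unchanged, so identity maps
    -- exhibit the retracts here and in the following cases.
    exact IsContraacyclic.of_retract (N := DGBimod.tot h')
      (mkHom (ContinuousLinearMap.id 𝕜 _) (fun _ _ => rfl) (fun _ _ => rfl) (fun _ => rfl))
      (mkHom (ContinuousLinearMap.id 𝕜 _) (fun _ _ => rfl) (fun _ _ => rfl) (fun _ => rfl))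
      (fun _ => rfl) (.tot h')
  | @shift M k _ ih =>
    exact IsContraacyclic.of_retract (N := (restrictScalars f M).shift k)
      (mkHom (ContinuousLinearMap.id 𝕜 _) (fun _ _ => rfl) (fun _ _ => rfl) (fun _ => rfl))
      (mkHom (ContinuousLinearMap.id 𝕜 _) (fun _ _ => rfl) (fun _ _ => rfl) (fun _ => rfl))
      (fun _ => rfl) (.shift k ih)
  | @cone M N g _ _ h1 h2 =>
    exact IsContraacyclic.of_retract (N := DGBimod.cone (restrictHom f g))
      (mkHom (ContinuousLinearMap.id 𝕜 _) (fun _ _ => rfl) (fun _ _ => rfl) (fun _ => rfl))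
      (mkHom (ContinuousLinearMap.id 𝕜 _) (fun _ _ => rfl) (fun _ _ => rfl) (fun _ => rfl))
      (fun _ => rfl) (.cone (restrictHom f g) h1 h2)
  | retract i r h _ ih =>
    obtain ⟨η, h1, h2, h3, h4⟩ := h
    exact .retract (restrictHom f i) (restrictHom f r)
      ⟨η, h1, h2, fun x b => h3 x (f.toCLM b), h4⟩ ih
  | pi M _ ih =>
    exact IsContraacyclic.of_retract (N := DGBimod.pi fun i => restrictScalars f (M i))
      (mkHom (ContinuousLinearMap.id 𝕜 _) (fun _ _ => rfl) (fun _ _ => rfl) (fun _ => rfl))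
      (mkHom (ContinuousLinearMap.id 𝕜 _) (fun _ _ => rfl) (fun _ _ => rfl) (fun _ => rfl))
      (fun _ => rfl) (.pi _ ih)

end Restrict

section Replacement

variable {A : DGAlg.{w, u} 𝕜} {P P' M : RightDGMod.{w, u, u} A}

/-- Closed morphisms from a graded-projective module lift, up to homotopy, along contraderived
equivalences. -/
theorem exists_lift_of_isContraIso (hP : P.toGrBimod.IsProjective) (q : P.Hom M) {q' : P'.Hom M}
    (hq' : IsContraIso q') : ∃ (a : P.Hom P') (θ : P.carrier →L[𝕜] M.carrier),
      IsGrMap P.toGrBimod M.toGrBimod (-1) θ ∧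
      ∀ x, q.toCLM x - q'.toCLM (a.toCLM x) = M.d (θ x) + θ (P.d x) := by
  -- The pair `(q, 0)` is a closed morphism into the cone of `q'`, hence null-homotopic. The
  -- `P'`-component of a null-homotopy is the lift, and its `M`-component is the homotopy between
  -- `q` and the composite.
  obtain ⟨ψ, hψ, hψd⟩ := isHomAcyclic_of_isContraacyclic hP hq' 0
    (q.toCLM.prod (0 : P.carrier →L[𝕜] P'.carrier))
    ⟨fun n x => Prod.ext (by
        change q.toCLM (P.proj n x) = M.proj (n + 0) (q.toCLM x)
        rw [q.map_proj, add_zero]) (map_zero (P'.proj (n + 0 + 1))).symm,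
      fun x b => Prod.ext (q.map_ract x b) (LinearMap.map_zero₂ P'.ract b).symm⟩
    fun x => by
      refine (cone_d q' (q.toCLM x) 0).trans ?_
      rw [Int.negOnePow_zero, Units.val_one, one_smul, map_zero, map_zero, add_zero, neg_zero,
        ← q.map_d]
      rfl
  let ψ₁ : P.carrier →L[𝕜] M.carrier := ContinuousLinearMap.fst 𝕜 M.carrier P'.carrier ∘L ψ
  let ψ₂ : P.carrier →L[𝕜] P'.carrier := ContinuousLinearMap.snd 𝕜 M.carrier P'.carrier ∘L ψ
  have hd : ∀ x, (M.d (ψ₁ x) + q'.toCLM (ψ₂ x) + ψ₁ (P.d x), -P'.d (ψ₂ x) + ψ₂ (P.d x)) =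
      (q.toCLM x, (0 : P'.carrier)) := fun x => by
    have := hψd x
    rw [Int.negOnePow_zero, Units.val_one, one_smul] at this
    exact (congrArg (· + ψ (P.d x)) (cone_d q' (ψ₁ x) (ψ₂ x))).symm.trans this
  refine ⟨mkHom ψ₂ (fun n x => ?_) (fun x b => congrArg Prod.snd (hψ.2 x b)) fun x => ?_, ψ₁,
    ⟨fun n x => congrArg Prod.fst (hψ.1 n x), fun x b => congrArg Prod.fst (hψ.2 x b)⟩,
    fun x => ?_⟩
  · refine (congrArg Prod.snd (hψ.1 n x)).trans ?_
    change P'.proj (n + (0 - 1) + 1) (ψ₂ x) = P'.proj n (ψ₂ x)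
    congr 2; ring
  · have := congrArg Prod.snd (hd x)
    exact (neg_add_eq_zero.1 this).symm
  · have : M.d (ψ₁ x) + q'.toCLM (ψ₂ x) + ψ₁ (P.d x) = q.toCLM x := congrArg Prod.fst (hd x)
    change q.toCLM x - q'.toCLM (ψ₂ x) = _
    rw [← this]
    abel

/-- Two graded-projective replacements of a module are homotopy equivalent. -/
theorem exists_homotopic_replacement (hP : P.toGrBimod.IsProjective)
    (hP' : P'.toGrBimod.IsProjective) {q : P.Hom M} {q' : P'.Hom M} (hq : IsContraIso q)
    (hq' : IsContraIso q') :
    ∃ (a : P.Hom P') (b : P'.Hom P), Homotopic (b.comp a) (Hom.id P) := by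
  obtain ⟨a, θ, hθ, hθd⟩ := exists_lift_of_isContraIso hP q hq'
  obtain ⟨b, θ', hθ', hθ'd⟩ := exists_lift_of_isContraIso hP' q' hq
  -- The map `δ = b a - id` becomes null-homotopic through `τ` after composition with `q`. Thus `(τ,
  -- δ)` is a cocycle of degree `-1` with values in the cone of `q`, and the `P`-component of a
  -- primitive is, up to sign, a homotopy from `b a` to the identity.
  let δ : P.carrier →L[𝕜] P.carrier := b.toCLM ∘L a.toCLM - ContinuousLinearMap.id 𝕜 _
  let τ : P.carrier →L[𝕜] M.carrier := θ' ∘L a.toCLM + θ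
  have hτ : IsGrMap P.toGrBimod M.toGrBimod (-1) τ := (hθ'.comp a.isGrMap).add hθ
  have hδ : IsGrMap P.toGrBimod P.toGrBimod 0 δ :=
    ((b.isGrMap.comp a.isGrMap (m := 0)).sub (Hom.id P).isGrMap)
  have hδd : ∀ x, P.d (δ x) = δ (P.d x) := fun x => by
    change P.d (b.toCLM (a.toCLM x) - x) = b.toCLM (a.toCLM (P.d x)) - P.d x
    rw [map_sub, ← b.map_d, ← a.map_d]
  have hqδ : ∀ x, M.d (τ x) + q.toCLM (δ x) = -τ (P.d x) := fun x => by
    change M.d (θ' (a.toCLM x) + θ x) + q.toCLM (b.toCLM (a.toCLM x) - x) =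
      -(θ' (a.toCLM (P.d x)) + θ (P.d x))
    have e1 := hθd x
    have e2 := hθ'd (a.toCLM x)
    rw [← a.map_d] at e2
    rw [map_add, map_sub, eq_sub_of_add_eq e1.symm, eq_sub_of_add_eq e2.symm]
    abel
  have e1 : ((-1 : ℤ).negOnePow : ℤ) = -1 := by simp
  obtain ⟨χ, hχ, hχd⟩ := isHomAcyclic_of_isContraacyclic hP hq (-1) (τ.prod δ)
    ⟨fun n x => Prod.ext (hτ.1 n x) (by
        change δ (P.proj n x) = P.proj (n + -1 + 1) (δ x)
        rw [hδ.1, add_zero, neg_add_cancel_right]),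
      fun x b => Prod.ext (hτ.2 x b) (hδ.2 x b)⟩
    fun x => by
      refine (cone_d q (τ x) (δ x)).trans ?_
      rw [e1, hqδ, hδd, neg_smul, one_smul]
      rfl
  let χ₂ : P.carrier →L[𝕜] P.carrier := ContinuousLinearMap.snd 𝕜 M.carrier P.carrier ∘L χ
  have hd : ∀ x, -P.d (χ₂ x) - χ₂ (P.d x) = δ x := fun x => by
    have := hχd x
    rw [e1, neg_smul, one_smul] at this
    have h3 := (congrArg (· + -χ (P.d x)) (cone_d q (χ x).1 (χ₂ x))).symm.trans this
    exact (sub_eq_add_neg _ _).trans (congrArg Prod.snd h3)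
  refine ⟨a, b, homotopic_of (-χ₂) (fun n x => ?_) (fun x c => ?_) fun x => ?_⟩
  · have h4 : χ₂ (P.proj n x) = P.proj (n + (-1 - 1) + 1) (χ₂ x) := congrArg Prod.snd (hχ.1 n x)
    change -χ₂ (P.proj n x) = P.proj (n + -1) (-χ₂ x)
    rw [h4, map_neg]
    congr 3; ring
  · have h4 : χ₂ (P.ract x c) = P.ract (χ₂ x) c := congrArg Prod.snd (hχ.2 x c)
    change -χ₂ (P.ract x c) = P.ract (-χ₂ x) c
    rw [h4, LinearMap.map_neg₂]
  · change δ x = P.d (-χ₂ x) + -χ₂ (P.d x)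
    rw [← hd, map_neg, sub_eq_add_neg]

end Replacement

end RightDGMod

namespace IsTens

variable {A B C : DGAlg.{w, u} 𝕜} {P : RightDGMod.{w, u, u} A} {T : RightDGMod.{w, u, u} B}
  {f : A.Hom B} {β : P.carrier →ₗ[𝕜] B.carrier →ₗ[𝕜] T.carrier}

/-- The extension of scalars of `P` along `f`. -/
noncomputable abbrev _root_.ClctDG.DGBimod.extension (f : A.Hom B) : DGBimod.{w, u, u, u} A B :=
  (DGBimod.regular B).restrict f (DGAlg.Hom.id B)

/-- The natural map `x ↦ x ⊗ 1`. -/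
noncomputable def unit (h : IsTens P (extension f) T β) : P.carrier →L[𝕜] T.carrier :=
  ⟨β.flip B.one, h.continuous.comp (continuous_id.prodMk continuous_const)⟩

theorem unit_apply (h : IsTens P (extension f) T β) (x : P.carrier) : h.unit x = β x B.one := rfl

theorem isGrMap_unit (h : IsTens P (extension f) T β) :
    IsGrMap P.toGrBimod (restrictScalars f T).toGrBimod 0 h.unit := by
  refine ⟨isDeg_of_homog fun n x hx => ?_, fun x a => ?_⟩
  · exact h.proj n 0 x B.one hx B.proj_one
  · change β (P.ract x a) B.one = T.ract (β x B.one) (f.toCLM a)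
    rw [h.balanced, h.ract]
    change β x (B.mul (f.toCLM a) B.one) = β x (B.mul B.one (f.toCLM a))
    rw [B.mul_one, B.one_mul]

theorem unit_d (h : IsTens P (extension f) T β) (x : P.carrier) :
    T.d (h.unit x) = h.unit (P.d x) := by
  refine (h.d x B.one).trans ?_
  change β (P.d x) B.one + β _ (B.d B.one) = _
  rw [B.d_one, map_zero, add_zero]
  rfl

/-- The natural map `x ↦ x ⊗ 1` is null-homotopic. -/
def UnitNull (h : IsTens P (extension f) T β) : Prop :=
  ∃ ψ : P.carrier →L[𝕜] T.carrier,
    IsGrMap P.toGrBimod (restrictScalars f T).toGrBimod (-1) ψ ∧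
    ∀ x, T.d (ψ x) + ψ (P.d x) = h.unit x

/-- By adjunction, `A`-linear maps `P → T` are `B`-linear maps `T → T`, and `x ↦ x ⊗ 1` corresponds
to the identity. The contraction is therefore `x ⊗ b ↦ ψ(x) b`. -/
theorem UnitNull.isContractible {h : IsTens P (extension f) T β} (hψ : h.UnitNull) :
    IsContractible T := by
  obtain ⟨ψ, hψ, hψd⟩ := hψ
  have hψdeg : IsDeg P.toGrSpace T.toGrSpace (-1) ψ := hψ.1
  have hψr : ∀ x a, ψ (P.ract x a) = T.ract (ψ x) (f.toCLM a) := hψ.2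
  obtain ⟨H, hH, hHβ⟩ := h.exists_grMap (V := T.toGrBimod) (-1) (T.ract ∘ₗ ψ.toLinearMap)
    (T.continuous_ract.comp (ψ.continuous.prodMap continuous_id))
    (fun x a y => by
      change T.ract (ψ (P.ract x a)) y = T.ract (ψ x) (B.mul (f.toCLM a) y)
      rw [hψr, T.ract_mul])
    (fun m n x y hx hy => by
      rw [add_right_comm]
      exact T.proj_ract (m + -1) n _ _ (hψdeg.homog hx) hy)
    (fun x y b => T.ract_mul _ _ _)
  refine ⟨H, hH.1, hH.2, fun t => ?_⟩
  have e : T.d ∘L H + H ∘L T.d = ContinuousLinearMap.id 𝕜 _ := h.ext _ _ _ fun x b => by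
    change T.d (H (β x b)) + H (T.d (β x b)) = β x b
    rw [h.d, map_add, hHβ, hHβ, hHβ]
    change T.d (T.ract (ψ x) b) + (T.ract (ψ (P.d x)) b + T.ract (ψ (P.koszul 1 x)) (B.d b)) = _
    have e2 : T.ract (h.unit x) b = β x b := by
      rw [unit_apply, h.ract]
      exact congrArg (β x) (B.one_mul b)
    rw [T.d_ract', hψdeg.map_koszul, ← e2, ← hψd, LinearMap.map_add₂]
    simp
    abel
  exact DFunLike.congr_fun e t

/-- Only `T` as a module over `A` enters, because the map `x ↦ x ⊗ 1` starts from a module that is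
graded-projective over `A`. Together with `UnitNull.isContractible` this lifts contraacyclicity from
`A` to `B`. -/
theorem unitNull_of_restrictScalars (hP : P.toGrBimod.IsProjective)
    (h : IsTens P (extension f) T β) (hT : (restrictScalars f T).IsContraacyclic) :
    h.UnitNull := by
  obtain ⟨ψ, hψ, hψd⟩ := isHomAcyclic_of_isContraacyclic hP hT 0 h.unit h.isGrMap_unit fun x => by
    rw [Int.negOnePow_zero, Units.val_one, one_smul]
    exact h.unit_d x
  refine ⟨ψ, hψ, fun x => ?_⟩
  have := hψd x
  rwa [Int.negOnePow_zero, Units.val_one, one_smul] at this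

theorem unitNull_of_isContraacyclic (hP : P.toGrBimod.IsProjective)
    (h : IsTens P (extension f) T β) (hT : T.IsContraacyclic) : h.UnitNull :=
  h.unitNull_of_restrictScalars hP (isContraacyclic_restrictScalars f hT)

/-- A module that is both graded-projective and contraacyclic is contractible; its contraction is
composed with `x ↦ x ⊗ 1`. -/
theorem unitNull_of_source (hP : P.toGrBimod.IsProjective)
    (h : IsTens P (extension f) T β) (hP' : P.IsContraacyclic) : h.UnitNull := by
  obtain ⟨η, hη, hηd⟩ := isHomAcyclic_of_isContraacyclic hP hP' 0 (ContinuousLinearMap.id 𝕜 _)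
    (Hom.id P).isGrMap fun x => by
      rw [Int.negOnePow_zero, Units.val_one, one_smul]; rfl
  refine ⟨h.unit ∘L η, h.isGrMap_unit.comp hη, fun x => ?_⟩
  have := hηd x
  rw [Int.negOnePow_zero, Units.val_one, one_smul] at this
  change T.d (h.unit (η x)) + h.unit (η (P.d x)) = h.unit x
  rw [unit_d, ← map_add, this]
  rfl

/-- If `x ↦ x ⊗ 1` is null-homotopic, it remains so after a further extension of scalars. -/
theorem UnitNull.map {S : RightDGMod.{w, u, u} C} {g : B.Hom C} {f' : A.Hom C}
    (hf' : ∀ a, f'.toCLM a = g.toCLM (f.toCLM a))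
    {β' : P.carrier →ₗ[𝕜] C.carrier →ₗ[𝕜] S.carrier} {h : IsTens P (extension f) T β}
    (hψ : h.UnitNull) (h' : IsTens P (extension f') S β') : h'.UnitNull := by
  obtain ⟨ψ, hψ, hψd⟩ := hψ
  have hψdeg : IsDeg P.toGrSpace T.toGrSpace (-1) ψ := hψ.1
  have hψr : ∀ x a, ψ (P.ract x a) = T.ract (ψ x) (f.toCLM a) := hψ.2
  obtain ⟨F, hF⟩ := h.exists_hom (V := restrictScalars g S) (β'.compl₂ g.toCLM.toLinearMap)
    (h'.continuous.comp (continuous_id.prodMap g.toCLM.continuous))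
    (fun x a y => by
      change β' (P.ract x a) (g.toCLM y) = β' x (g.toCLM (B.mul (f.toCLM a) y))
      rw [h'.balanced, g.map_mul, ← hf']
      rfl)
    (fun m n x y hx hy => by
      refine h'.proj m n x _ hx ?_
      change C.proj n (g.toCLM y) = g.toCLM y
      have hy' : B.proj n y = y := hy
      rw [← g.map_proj, hy'])
    (fun x y b => by
      change β' x (g.toCLM (B.mul y b)) = S.ract (β' x (g.toCLM y)) (g.toCLM b)
      rw [h'.ract, g.map_mul]
      rfl)
    (fun x y => by
      change S.d (β' x (g.toCLM y)) = β' (P.d x) (g.toCLM y) + β' (P.koszul 1 x) (g.toCLM (B.d y))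
      rw [h'.d, g.map_d])
  have hFr : ∀ t b, F.toCLM (T.ract t b) = S.ract (F.toCLM t) (g.toCLM b) := F.map_ract
  have hFd : ∀ t, F.toCLM (T.d t) = S.d (F.toCLM t) := F.map_d
  have hFdeg : IsDeg T.toGrSpace S.toGrSpace 0 F.toCLM := fun n t => by
    rw [add_zero]; exact F.map_proj n t
  refine ⟨F.toCLM ∘L ψ, ⟨hFdeg.comp hψdeg, fun x a => ?_⟩, fun x => ?_⟩
  · change F.toCLM (ψ (P.ract x a)) = S.ract (F.toCLM (ψ x)) (f'.toCLM a)
    rw [hψr, hFr, hf']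
  · change S.d (F.toCLM (ψ x)) + F.toCLM (ψ (P.d x)) = _
    rw [← hFd, ← map_add, hψd, unit_apply, unit_apply, hF]
    exact congrArg (β' x) g.map_one

end IsTens

/-! ### Locality of contraacyclicity. -/

section Main

open TopologicalSpace

variable {X : TopCat.{u}} (𝒜 : TopCat.Sheaf (DGAlg.{w, u} 𝕜) X)

theorem isDerivedExtension_tens {A B : DGAlg.{w, u} 𝕜} (f : A.Hom B)
    {P M : RightDGMod.{w, u, u} A} {q : P.Hom M} (hP : P.toGrBimod.IsProjective)
    (hq : IsContraIso q) : IsDerivedExtension f M (tens P (extension f)) :=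
  ⟨P, q, _, hP, hq, isCompletedTensor_iff.2 isTens_tens⟩

/-- Derived extensions of scalars do not depend, up to contraacyclicity, on the replacement. -/
theorem IsDerivedExtension.isContraacyclic_iff {A B : DGAlg.{w, u} 𝕜} {f : A.Hom B}
    {P M : RightDGMod.{w, u, u} A} {T : RightDGMod.{w, u, u} B} {q : P.Hom M}
    (hT : IsDerivedExtension f M T) (hP : P.toGrBimod.IsProjective) (hq : IsContraIso q) :
    T.IsContraacyclic ↔ (tens P (extension f)).IsContraacyclic := by
  obtain ⟨P', q', β, hP', hq', hβ⟩ := hT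
  rw [isCompletedTensor_iff] at hβ
  obtain ⟨a, b, hab⟩ := exists_homotopic_replacement hP hP' hq hq'
  obtain ⟨a', b', hab'⟩ := exists_homotopic_replacement hP' hP hq' hq
  exact ⟨isTens_tens.isContraacyclic_of_retract_left hβ a b hab,
    hβ.isContraacyclic_of_retract_left isTens_tens a' b' hab'⟩

/-- In the nontrivial direction, contraacyclicity over `A` makes `x ↦ x ⊗ 1` null-homotopic, and
this contracts `T` over `B`. -/
theorem IsDerivedExtension.isContraacyclic_iff_restrict {A B : DGAlg.{w, u} 𝕜} {f : A.Hom B}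
    {M : RightDGMod.{w, u, u} A} {T : RightDGMod.{w, u, u} B} (hT : IsDerivedExtension f M T) :
    T.IsContraacyclic ↔ (restrictScalars f T).IsContraacyclic := by
  obtain ⟨P, q, β, hP, hq, hβ⟩ := hT
  rw [isCompletedTensor_iff] at hβ
  exact ⟨isContraacyclic_restrictScalars f,
    fun h => (hβ.unitNull_of_restrictScalars hP h).isContractible.isContraacyclic⟩

variable {𝒜}

/-- Contraacyclicity over `U` is encoded in a null-homotopy of `x ↦ x ⊗ 1`, which is transported
along the restriction of sections. Associativity of tensor products is not needed. -/
theorem isContraacyclic_extension_mono {P : RightDGMod.{w, u, u} (dgSections 𝒜 ⊤)}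
    (hP : P.toGrBimod.IsProjective) {U V : Opens X} (hVU : V ≤ U)
    (hU : (tens P (extension (resHom 𝒜 (le_top : U ≤ ⊤)))).IsContraacyclic) :
    (tens P (extension (resHom 𝒜 (le_top : V ≤ ⊤)))).IsContraacyclic := by
  have h1 := isTens_tens.unitNull_of_isContraacyclic hP hU
  exact (h1.map (g := resHom 𝒜 hVU) (fun a => (resHom_resHom 𝒜 hVU le_top a).symm)
    isTens_tens).isContractible.isContraacyclic

/-- Local contraacyclicity on a cover of finite dimension implies contraacyclicity. -/
theorem isContraacyclic_of_cover (h𝒜 : StrongDescent 𝒜)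
    {P : RightDGMod.{w, u, u} (dgSections 𝒜 ⊤)} (hP : P.toGrBimod.IsProjective) {I : Type u}
    {U : I → Opens X} (hU : IsFiniteDimCover U ⊤)
    (h : ∀ i, (tens P (extension (resHom 𝒜 (le_top : U i ≤ ⊤)))).IsContraacyclic) :
    P.IsContraacyclic := by
  classical
  -- Ordered Čech cochains need an order on the index set. Any linear order will do, and a
  -- well-ordering exists.
  let _ : LinearOrder I := linearOrderOfSTO WellOrderingRel
  obtain ⟨n, hn⟩ := hU.2
  have h1 : (tens P (cech 𝒜 hU.le)).IsContraacyclic := by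
    refine isContraacyclic_tens_cech 𝒜 hU.le hn hP fun k s => ?_
    -- The intersection is contained in its first member, over which contraacyclicity is assumed.
    have h2 := isContraacyclic_extension_mono hP (iInf_le (fun j => U (s j)) 0 : cechInter U s ≤ _)
      (h (s 0))
    -- The Čech complex is a bimodule over the global sections, so contraacyclicity over the
    -- intersection is first restricted to them.
    exact (IsTens.restrict (f := resHom 𝒜 (le_top : cechInter U s ≤ ⊤))
      (isTens_tens (P := P) (N := extension (resHom 𝒜 le_top)))).isContraacyclic_iff.1
      (isContraacyclic_restrictScalars (resHom 𝒜 (le_top : cechInter U s ≤ ⊤)) h2)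
  -- Strong descent tensored with `P`. Under `P ⊗ 𝒜(X) = P` this is the cone of `P → P ⊗ Č`, so
  -- contraacyclicity of the target gives that of `P`.
  have h3 := isContraacyclic_tens hP (h𝒜 ⊤ I U hU)
  obtain ⟨F, hF⟩ := (IsTens.regular P).exists_map isTens_tens (Hom.id P) (cechAug 𝒜 hU.le)
  exact isContraacyclic_source_of_cone
    (((IsTens.regular P).cone isTens_tens _ F hF).isContraacyclic_iff.2 h3) h1

end Main

end DGModules

end ClctDG

open TopologicalSpace ClctDG in
theorem mainTheorem2 {𝕜 : Type w} [RCLike 𝕜] {X : TopCat.{u}}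
    (𝒜 : TopCat.Sheaf (DGAlg.{w, u} 𝕜) X) (h𝒜 : StrongDescent 𝒜)
    (M : RightDGMod.{w, u, u} (dgSections 𝒜 ⊤)) :
    (∀ U : Opens X, ∃ T : RightDGMod.{w, u, u} (dgSections 𝒜 U),
      IsDerivedExtension (resHom 𝒜 (le_top : U ≤ ⊤)) M T) ∧
    ∀ ℳ : ∀ U : Opens X, RightDGMod.{w, u, u} (dgSections 𝒜 U),
      (∀ U, IsDerivedExtension (resHom 𝒜 (le_top : U ≤ ⊤)) M (ℳ U)) →
      (M.IsContraacyclic ↔ ∃ (I : Type u) (U : I → Opens X), IsFiniteDimCover U ⊤ ∧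
        ∀ i, (ℳ (U i)).IsContraacyclic) ∧
      (∀ U : Opens X, (ℳ U).IsContraacyclic ↔
        ((ℳ U).restrict (DGAlg.Hom.id _) (resHom 𝒜 (le_top : U ≤ ⊤))).IsContraacyclic) ∧
      (HasFiniteCoveringDim X → (M.IsContraacyclic ↔
        ∀ x : X, ∃ U : Opens X, x ∈ U ∧ (ℳ U).IsContraacyclic)) := by
  -- One replacement of `M`, the total free resolution, serves all open sets at once. The given
  -- modules are compared with its extensions of scalars.
  have hP := RightDGMod.resolution_isProjective M
  have hq := RightDGMod.isContraIso_resolutionAug M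
  refine ⟨fun U => ⟨_, isDerivedExtension_tens _ hP hq⟩, fun ℳ hℳ => ?_⟩
  have hiff := fun U => (hℳ U).isContraacyclic_iff hP hq
  have hlocal : M.IsContraacyclic → ∀ U, (ℳ U).IsContraacyclic := fun hM U =>
    (hiff U).2 (isTens_tens.unitNull_of_source hP
      (RightDGMod.isContraacyclic_source_of_cone hq hM)).isContractible.isContraacyclic
  have hglobal : ∀ (I : Type u) (U : I → Opens X), IsFiniteDimCover U ⊤ →
      (∀ i, (ℳ (U i)).IsContraacyclic) → M.IsContraacyclic := fun I U hU h =>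
    RightDGMod.isContraacyclic_target_of_cone hq
      (isContraacyclic_of_cover h𝒜 hP hU fun i => (hiff _).1 (h i))
  refine ⟨⟨fun hM => ⟨PUnit, fun _ => ⊤, ⟨iSup_const, 0, fun s hs => ?_⟩, fun _ => hlocal hM ⊤⟩,
    fun ⟨I, U, hU, h⟩ => hglobal I U hU h⟩, fun U => (hℳ U).isContraacyclic_iff_restrict,
    fun ⟨n, hn⟩ => ⟨fun hM x => ⟨⊤, trivial, hlocal hM ⊤⟩, fun h => ?_⟩⟩
  -- The space covers itself, as a family with one member. Such a family has dimension at most `0`,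
  -- since there are no two distinct indices.
  · have := Finset.card_le_univ s
    rw [Fintype.card_punit] at this
    omega
  -- The good neighbourhoods form a cover indexed by the points. Each member of a finite-dimensional
  -- refinement lies in one of them and inherits contraacyclicity.
  · choose U hxU hU using h
    obtain ⟨J, W, hW, hWU, hWn⟩ := hn X U
      (eq_top_iff.2 fun x _ => Opens.mem_iSup.2 ⟨x, hxU x⟩)
    refine hglobal J W ⟨hW, n, hWn⟩ fun j => ?_
    obtain ⟨x, hx⟩ := hWU j
    exact (hiff _).2 (isContraacyclic_extension_mono hP hx ((hiff _).1 (hU x)))
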